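/- Let $M$ be a Fano manifold of dimension $m$, i.e. a compact complex manifold whose class $2\pi c_1(M)$ contains a Kähler form. Let $\omega=\sqrt{-1}\,g_{i\bar j}\,dz^i\wedge dz^{\bar j}$ be a Kähler form in $2\pi c_1(M)$, with Ricci form $\mathrm{Ric}=\sqrt{-1}\,R_{i\bar j}\,dz^i\wedge dz^{\bar j}$, $R_{i\bar j}=-\partial_i\partial_{\bar j}\log\det(g_{k\bar l})$, and let $f$ be a real smooth function (Ricci potential) with $\mathrm{Ric}-\omega=\sqrt{-1}\,\partial\bar\partial f$. On smooth $(0,q)$-forms let $\bar\partial_f^*$ be the formal adjoint of $\bar\partial$ with respect to the weighted $L^2$-inner product $\int_M(\alpha,\beta)\,e^f\omega^m$, where $(\alpha,\beta)=\frac1{q!}g^{i_1\bar j_1}\cdots g^{i_q\bar j_q}\alpha_{\bar j_1\cdots\bar j_q}\overline{\beta_{\bar i_1\cdots\bar i_q}}$ for $\alpha=\frac1{q!}\alpha_{\bar j_1\cdots\bar j_q}dz^{\bar j_1}\wedge\cdots\wedge dz^{\bar j_q}$ and likewise $\beta$ (with $\bar\partial_f^*=0$ on functions), and let $\Delta_f=\bar\partial_f^*\bar\partial+\bar\partial\,\bar\partial_f^*$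 be the weighted Hodge Laplacian. Let $\eta$ be a smooth $(0,q)$-form, $q\ge 0$, and $\lambda\in\mathbb C$ with $\Delta_f\eta=\lambda\eta$ and $\bar\partial\eta\neq 0$. Then: (1) $\lambda$ is real and $\lambda\ge q+1$. (2) If $\lambda=q+1$, then $$(\bar\partial\eta)^\sharp=\frac1{(q+1)!}\,g^{i_0\bar j_0}\cdots g^{i_q\bar j_q}(\bar\partial\eta)_{\bar j_0\cdots\bar j_q}\,\frac{\partial}{\partial z^{i_0}}\wedge\cdots\wedge\frac{\partial}{\partial z^{i_q}}$$ is a holomorphic section of $\wedge^{q+1}T'M$. -/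

import Mathlib

open scoped Manifold ContDiff

noncomputable section

namespace FanoHodge

/-! ### Coordinate frames on a complex manifold

`M` is a complex manifold of dimension `m`, modelled on `Fin m → ℂ`.  Its complex tangent space
`TangentSpace 𝓘(ℂ, Fin m → ℂ) x` is identified with the holomorphic tangent space `T'_x M`, the
vector with components `v^i` standing for `∑ v^i ∂/∂z^i`. -/

section Frames

variable {m : ℕ} {M : Type*} [TopologicalSpace M] [ChartedSpace (Fin m → ℂ) M]

/-- The inverse of the differential at `x` of the chart `e` (`x` in the domain of `e`). -/
def coordInv (e : OpenPartialHomeomorph M (Fin m → ℂ)) (x : M) :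
    (Fin m → ℂ) →L[ℂ] TangentSpace 𝓘(ℂ, Fin m → ℂ) x :=
  ContinuousLinearMap.inverse
    (show TangentSpace 𝓘(ℂ, Fin m → ℂ) x →L[ℂ] (Fin m → ℂ) from
      mfderiv 𝓘(ℂ, Fin m → ℂ) 𝓘(ℂ, Fin m → ℂ) e x)

/-- The coordinate vectors `∂/∂z^i` of the chart `e` at the point `x` of its domain. -/
def frame (e : OpenPartialHomeomorph M (Fin m → ℂ)) (x : M) (i : Fin m) :
    TangentSpace 𝓘(ℂ, Fin m → ℂ) x :=
  coordInv e x (Pi.single i 1)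

end Frames

/-! ### Wirtinger derivatives in `ℂ^m` -/

/-- `∂u/∂z^i` for a complex-valued function `u` on `ℂ^m`. -/
def wirtinger {m : ℕ} (i : Fin m) (u : (Fin m → ℂ) → ℂ) (z : Fin m → ℂ) : ℂ :=
  (1 / 2 : ℂ) * (fderiv ℝ u z (Pi.single i 1) - Complex.I * fderiv ℝ u z (Pi.single i Complex.I))

/-- `∂u/∂z̄^j` for a complex-valued function `u` on `ℂ^m`. -/
def wirtingerBar {m : ℕ} (j : Fin m) (u : (Fin m → ℂ) → ℂ) (z : Fin m → ℂ) : ℂ :=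
  (1 / 2 : ℂ) * (fderiv ℝ u z (Pi.single j 1) + Complex.I * fderiv ℝ u z (Pi.single j Complex.I))

/-! ### Hermitian and Kähler metrics -/

/-- A smooth Hermitian metric on the holomorphic tangent bundle, `val x v w = g_x(v, w̄)`,
linear in `v` and conjugate-linear in `w`. -/
structure HermitianMetric (m : ℕ) (M : Type*) [TopologicalSpace M]
    [ChartedSpace (Fin m → ℂ) M] where
  val : ∀ x : M, TangentSpace 𝓘(ℂ, Fin m → ℂ) x →ₗ[ℂ] TangentSpace 𝓘(ℂ, Fin m → ℂ) x →ₗ⋆[ℂ] ℂ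
  conj_symm : ∀ (x : M) (v w : TangentSpace 𝓘(ℂ, Fin m → ℂ) x),
    val x v w = starRingEnd ℂ (val x w v)
  pos : ∀ (x : M) (v : TangentSpace 𝓘(ℂ, Fin m → ℂ) x), v ≠ 0 → 0 < (val x v v).re
  smooth : ∀ e ∈ atlas (Fin m → ℂ) M, ∀ i j : Fin m,
    ContDiffOn ℝ ∞ (fun z => val (e.symm z) (frame e (e.symm z) i) (frame e (e.symm z) j)) e.target

section Metric

variable {m : ℕ} {M : Type*} [TopologicalSpace M] [ChartedSpace (Fin m → ℂ) M]

/-- The matrix `(g_{i j̄})` of the metric at `x` in the chart `e`; row `i`, column `j`. -/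
def metricMatrix (g : HermitianMetric m M) (e : OpenPartialHomeomorph M (Fin m → ℂ)) (x : M) :
    Matrix (Fin m) (Fin m) ℂ :=
  Matrix.of fun i j => g.val x (frame e x i) (frame e x j)

/-- The inverse metric `g^{i j̄}`, normalized by `∑_j g_{k j̄} g^{i j̄} = δ_k^i`. -/
def invMetric (g : HermitianMetric m M) (e : OpenPartialHomeomorph M (Fin m → ℂ)) (x : M)
    (i j : Fin m) : ℂ :=
  (metricMatrix g e x)⁻¹ j i

/-- The differential `dz^i` on `ℂ^m`. -/
def dz {m : ℕ} (i : Fin m) : (Fin m → ℂ) →L[ℝ] ℂ :=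
  (ContinuousLinearMap.proj (R := ℂ) (φ := fun _ : Fin m => ℂ) i).restrictScalars ℝ

/-- The differential `dz̄^j` on `ℂ^m`. -/
def dzBar {m : ℕ} (j : Fin m) : (Fin m → ℂ) →L[ℝ] ℂ :=
  Complex.conjCLE.toContinuousLinearMap.comp (dz j)

/-- The fundamental form `ω = √-1 ∑ g_{i j̄} dz^i ∧ dz̄^j` in the chart `e`, where
`α ∧ β = α ⊗ β - β ⊗ α` for 1-forms. -/
def fundamentalForm (g : HermitianMetric m M) (e : OpenPartialHomeomorph M (Fin m → ℂ))
    (z : Fin m → ℂ) : (Fin m → ℂ) [⋀^Fin 2]→L[ℝ] ℂ :=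
  ∑ i, ∑ j, (Complex.I * metricMatrix g e (e.symm z) i j) •
    ContinuousAlternatingMap.alternatizeUncurryFin
      ((dz i).smulRight (ContinuousAlternatingMap.ofSubsingleton ℝ (Fin m → ℂ) ℂ (0 : Fin 1)
        (dzBar j)))

/-- The metric is Kähler: `dω = 0`. -/
def IsKahler (g : HermitianMetric m M) : Prop :=
  ∀ e ∈ atlas (Fin m → ℂ) M, ∀ z ∈ e.target, extDeriv (fundamentalForm g e) z = 0

/-- The Ricci tensor `R_{i j̄} = -∂_i ∂_{j̄} log det (g_{k l̄})` in the chart `e`. -/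
def ricci (g : HermitianMetric m M) (e : OpenPartialHomeomorph M (Fin m → ℂ)) (i j : Fin m)
    (z : Fin m → ℂ) : ℂ :=
  -wirtinger i (wirtingerBar j
    (fun w => (Real.log (metricMatrix g e (e.symm w)).det.re : ℂ))) z

/-- `f` is a Ricci potential of `g`: a smooth real function with `Ric - ω = √-1 ∂∂̄f`, that is
`R_{i j̄} - f_{i j̄} = g_{i j̄}`.  As `Ric` represents `2π c₁(M)`, this implies that `ω` lies in
`2π c₁(M)`; so a compact complex manifold with such `g` (Kähler) and `f` is Fano, and conversely,
by the `∂∂̄`-lemma, every Kähler form in `2π c₁(M)` of a Fano manifold has a Ricci potential. -/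
def IsRicciPotential (g : HermitianMetric m M) (f : M → ℝ) : Prop :=
  (∀ e ∈ atlas (Fin m → ℂ) M, ContDiffOn ℝ ∞ (fun z => f (e.symm z)) e.target) ∧
  ∀ e ∈ atlas (Fin m → ℂ) M, ∀ z ∈ e.target, ∀ i j : Fin m,
    ricci g e i j z - wirtinger i (wirtingerBar j (fun w => (f (e.symm w) : ℂ))) z =
      metricMatrix g e (e.symm z) i j

end Metric

/-! ### Forms of type `(0,q)` and the operator `∂̄` -/

/-- Complex-valued `q`-forms on `M` (not necessarily smooth): fields of alternating
real-multilinear `ℂ`-valued maps on the tangent spaces. -/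
abbrev FormField (m : ℕ) (M : Type*) [TopologicalSpace M] [ChartedSpace (Fin m → ℂ) M]
    (q : ℕ) : Type _ :=
  ∀ x : M, TangentSpace 𝓘(ℂ, Fin m → ℂ) x [⋀^Fin q]→L[ℝ] ℂ

section Forms

variable {m : ℕ} {M : Type*} [TopologicalSpace M] [ChartedSpace (Fin m → ℂ) M] {q : ℕ}

/-- The form `η` in the chart `e`, as a form on (the image of the chart in) `ℂ^m`. -/
def formInChart (e : OpenPartialHomeomorph M (Fin m → ℂ)) (η : FormField m M q)
    (z : Fin m → ℂ) : (Fin m → ℂ) [⋀^Fin q]→L[ℝ] ℂ :=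
  (η (e.symm z)).compContinuousLinearMap ((coordInv e (e.symm z)).restrictScalars ℝ)

/-- `η` is a smooth form of type `(0,q)`: it is smooth in all charts, and conjugate-linear in each
of its arguments. -/
structure IsSmoothZeroQ (η : FormField m M q) : Prop where
  smooth : ∀ e ∈ atlas (Fin m → ℂ) M, ContDiffOn ℝ ∞ (formInChart e η) e.target
  conj_linear : ∀ (x : M) (v : Fin q → TangentSpace 𝓘(ℂ, Fin m → ℂ) x) (k : Fin q) (c : ℂ),
    η x (Function.update v k (c • v k)) = starRingEnd ℂ c * η x v

/-- The conjugate-linear part `v ↦ (A v + √-1 A (√-1 v)) / 2` of a real-linear map `A` from `ℂ^m`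
to forms. -/
def conjLinearPart (A : (Fin m → ℂ) →L[ℝ] (Fin m → ℂ) [⋀^Fin q]→L[ℝ] ℂ) :
    (Fin m → ℂ) →L[ℝ] (Fin m → ℂ) [⋀^Fin q]→L[ℝ] ℂ :=
  (1 / 2 : ℂ) • (A + Complex.I •
    A.comp ((Complex.I • ContinuousLinearMap.id ℂ (Fin m → ℂ)).restrictScalars ℝ))

/-- `∂̄` of a `(0,q)`-form on an open subset of `ℂ^m`: the `(0,q+1)`-part of its exterior
derivative, with components
`(∂̄φ)_{j̄₀ … j̄_q} = ∑_β (-1)^β ∂φ_{j̄₀ … (omit j̄_β) … j̄_q} / ∂z̄^{j_β}`. -/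
def localDbar (φ : (Fin m → ℂ) → (Fin m → ℂ) [⋀^Fin q]→L[ℝ] ℂ) (z : Fin m → ℂ) :
    (Fin m → ℂ) [⋀^Fin (q + 1)]→L[ℝ] ℂ :=
  ContinuousAlternatingMap.alternatizeUncurryFin (conjLinearPart (fderiv ℝ φ z))

/-- `∂̄η` for a `(0,q)`-form `η` on `M`, computed at `x` in the preferred chart at `x`. -/
def dbar (η : FormField m M q) : FormField m M (q + 1) := fun x =>
  (localDbar (formInChart (chartAt (Fin m → ℂ) x) η)
    (chartAt (Fin m → ℂ) x x)).compContinuousLinearMap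
      ((show TangentSpace 𝓘(ℂ, Fin m → ℂ) x →L[ℂ] (Fin m → ℂ) from
        mfderiv 𝓘(ℂ, Fin m → ℂ) 𝓘(ℂ, Fin m → ℂ) (chartAt (Fin m → ℂ) x) x).restrictScalars ℝ)

/-- The component `α_{j̄₁ … j̄_q}` of a `(0,q)`-form at `x` in the chart `e`
(`α = (1/q!) ∑_J α_{j̄₁ … j̄_q} dz̄^{j₁} ∧ … ∧ dz̄^{j_q}`). -/
def component (e : OpenPartialHomeomorph M (Fin m → ℂ)) (α : FormField m M q) (x : M)
    (J : Fin q → Fin m) : ℂ :=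
  α x (fun k => frame e x (J k))

/-- The pointwise Hermitian inner product of `(0,q)`-forms,
`(α, β) = (1/q!) ∑ g^{i₁ j̄₁} ⋯ g^{i_q j̄_q} α_{j̄₁ … j̄_q} \overline{β_{ī₁ … ī_q}}`
(a tensor, here evaluated in the preferred chart at `x`). -/
def formInner (g : HermitianMetric m M) (α β : FormField m M q) (x : M) : ℂ :=
  (1 / (q.factorial : ℂ)) * ∑ I : Fin q → Fin m, ∑ J : Fin q → Fin m,
    (∏ k, invMetric g (chartAt (Fin m → ℂ) x) x (I k) (J k)) *
      component (chartAt (Fin m → ℂ) x) α x J *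
      starRingEnd ℂ (component (chartAt (Fin m → ℂ) x) β x I)

end Forms

/-! ### Integration and the weighted Laplacian -/

section Laplacian

variable {m : ℕ} {M : Type*} [TopologicalSpace M] [ChartedSpace (Fin m → ℂ) M]

/-- There is a partition of unity subordinate to the chart domains. -/
theorem exists_chartPartition (m : ℕ) (M : Type*) [TopologicalSpace M]
    [ChartedSpace (Fin m → ℂ) M] [CompactSpace M] [T2Space M] :
    ∃ ρ : PartitionOfUnity M M, ρ.IsSubordinate fun p : M => (chartAt (Fin m → ℂ) p).source :=
  PartitionOfUnity.exists_isSubordinate isClosed_univ _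
    (fun p => (chartAt (Fin m → ℂ) p).open_source)
    (fun x _ => Set.mem_iUnion.2 ⟨x, mem_chart_source _ x⟩)

/-- A partition of unity subordinate to the chart domains. -/
def chartPartition (m : ℕ) (M : Type*) [TopologicalSpace M]
    [ChartedSpace (Fin m → ℂ) M] [CompactSpace M] [T2Space M] : PartitionOfUnity M M :=
  (exists_chartPartition m M).choose

/-- The density of `ω^m` with respect to Lebesgue measure on `ℂ^m` in the chart `e`:
`ω^m = m! 2^m det (g_{i j̄}) dx¹ dy¹ ⋯ dx^m dy^m`. -/
def volumeDensity (g : HermitianMetric m M) (e : OpenPartialHomeomorph M (Fin m → ℂ)) (x : M) :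
    ℂ :=
  (m.factorial : ℂ) * 2 ^ m * (metricMatrix g e x).det

/-- The integral `∫_M u ω^m` of a continuous function `u` on the compact manifold `M`, by means of
a partition of unity (only finitely many terms of the sum are non-zero). -/
def integral [CompactSpace M] [T2Space M] (g : HermitianMetric m M) (u : M → ℂ) : ℂ :=
  ∑ᶠ p : M, ∫ z in (chartAt (Fin m → ℂ) p).target,
    (chartPartition m M p ((chartAt (Fin m → ℂ) p).symm z) : ℂ) *
      u ((chartAt (Fin m → ℂ) p).symm z) *
      volumeDensity g (chartAt (Fin m → ℂ) p) ((chartAt (Fin m → ℂ) p).symm z)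

/-- The weighted `L²`-inner product `∫_M (α, β) e^f ω^m` of `(0,q)`-forms. -/
def weightedInner [CompactSpace M] [T2Space M] {q : ℕ} (g : HermitianMetric m M) (f : M → ℝ)
    (α β : FormField m M q) : ℂ :=
  integral g fun x => formInner g α β x * (Real.exp (f x) : ℂ)

/-- `∂̄_f^* α = β`, where `∂̄_f^*` is the formal adjoint of `∂̄` with respect to the weighted
`L²`-inner product: `β` is the smooth `(0,q)`-form with `(∂̄ξ, α)_f = (ξ, β)_f` for all smooth
`(0,q)`-forms `ξ`. -/
def IsDbarAdjoint [CompactSpace M] [T2Space M] {q : ℕ} (g : HermitianMetric m M) (f : M → ℝ)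
    (α : FormField m M (q + 1)) (β : FormField m M q) : Prop :=
  IsSmoothZeroQ β ∧ ∀ ξ : FormField m M q, IsSmoothZeroQ ξ →
    weightedInner g f (dbar ξ) α = weightedInner g f ξ β

/-- `Δ_f η = ζ`, where `Δ_f = ∂̄_f^* ∂̄ + ∂̄ ∂̄_f^*` acts on smooth `(0,q)`-forms
(with `∂̄_f^* = 0` on functions). -/
def IsWeightedLaplacian [CompactSpace M] [T2Space M] (g : HermitianMetric m M) (f : M → ℝ) :
    ∀ {q : ℕ}, FormField m M q → FormField m M q → Prop
  | 0, η, ζ => IsDbarAdjoint g f (dbar η) ζ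
  | _ + 1, η, ζ => ∃ γ β, IsDbarAdjoint g f (dbar η) γ ∧ IsDbarAdjoint g f η β ∧ ζ = γ + dbar β

end Laplacian

/-! ### Raising indices; holomorphic multivector fields -/

section Sharp

variable {m : ℕ} {M : Type*} [TopologicalSpace M] [ChartedSpace (Fin m → ℂ) M] {p : ℕ}

/-- The section `α^♯` of `∧^p T'M` obtained from a `(0,p)`-form by raising all indices,
`α^♯ = (1/p!) ∑ g^{i₁ j̄₁} ⋯ g^{i_p j̄_p} α_{j̄₁ … j̄_p} ∂/∂z^{i₁} ∧ … ∧ ∂/∂z^{i_p}`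
(a tensor, here evaluated in the preferred chart at `x`). -/
def sharp (g : HermitianMetric m M) (α : FormField m M p) (x : M) :
    ⋀[ℂ]^p (TangentSpace 𝓘(ℂ, Fin m → ℂ) x) :=
  (1 / (p.factorial : ℂ)) • ∑ I : Fin p → Fin m, ∑ J : Fin p → Fin m,
    ((∏ k, invMetric g (chartAt (Fin m → ℂ) x) x (I k) (J k)) *
      component (chartAt (Fin m → ℂ) x) α x J) •
        exteriorPower.ιMulti ℂ p fun k => frame (chartAt (Fin m → ℂ) x) x (I k)

/-- A section `s` of `∧^p T'M` is holomorphic: in every chart, its coefficients with respect to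
the frame `∂/∂z^{i₁} ∧ … ∧ ∂/∂z^{i_p}`, `i₁ < … < i_p`, are holomorphic functions. -/
def IsHolomorphicSection (s : ∀ x : M, ⋀[ℂ]^p (TangentSpace 𝓘(ℂ, Fin m → ℂ) x)) : Prop :=
  ∀ e ∈ atlas (Fin m → ℂ) M, ∃ c : Set.powersetCard (Fin m) p → (Fin m → ℂ) → ℂ,
    (∀ I, DifferentiableOn ℂ (c I) e.target) ∧
    ∀ z ∈ e.target, s (e.symm z) =
      ∑ I, c I z • exteriorPower.ιMulti_family ℂ p (frame e (e.symm z)) I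

end Sharp

end FanoHodge

end

noncomputable section

namespace FanoHodge

set_option linter.unusedSectionVars false

open Filter Topology ComplexConjugate MeasureTheory
open scoped Matrix ComplexOrder

/-! ### Wirtinger calculus -/

section Wirtinger

variable {m : ℕ} {u v : (Fin m → ℂ) → ℂ} {z : Fin m → ℂ}

/-! Put α = ∂̄η. Applying ∂̄ to Δ_f η = λη kills the summand ∂̄∂̄_f^*η, so α is a nonzero ∂̄-closed
form with ∂̄∂̄_f^*α = λα (`IsWeightedLaplacian.exists_adjoint`). The theorem follows from a Bochner
identity for the multivector field σ = α^♯.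

In a chart let ℓ = f + log det g, so that e^f ω^m has density e^ℓ up to a constant. With raised
indices the adjoint is a weighted divergence without Christoffel symbols: if τ = (∂̄_f^*α)^♯, then
τ^I = -e^{-ℓ} Σ_l ∂_l(e^ℓ σ^{lI}) (`IsDbarAdjoint.raised_eq`). The Ricci potential equation reads
∂_l∂̄_k ℓ = -g_{lk̄}, so ∂̄_k τ^I equals Σ_l g_{lk̄} σ^{lI} minus the weighted divergence of ∂̄_k σ
(`wirtingerBar_weighted_divergence`). This commutator is the whole curvature contribution.

Indices may be lowered under an alternated derivative because for a Kähler metric the first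
derivatives of g are symmetric in the pair being alternated, hence cancel
(`sum_wirtingerBar_tensorPow_mul`). Closedness of α turns the norm of ∂̄σ into q+1 times the
contraction of ∂̄_jσ^{lI} with the conjugate of ∂̄_lσ^{jJ} (`norm_eq_of_closed`). Together these
give, with unnormalized norms and V the field `bochnerField`, (q+1) e^{-ℓ} Σ_l ∂_l(e^ℓ V^l) =
(q+1-λ)|σ|² + |∂̄σ|² (`bochner_formula`).

V is a global vector field of type (1,0) (`sum_jacobian_mul_bochnerField`), so with a smooth
partition of unity the left side integrates to zero (`setIntegral_bochner`,
`sum_setIntegral_bochnerDeriv_eq_zero`). Hence (q+1-λ)N + E = 0 with N > 0 and E ≥ 0, that is λ =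
q+1 + E/N. This is real and at least q+1; equality forces ∂̄σ = 0, and then α^♯ is holomorphic by
the Cauchy–Riemann equations (`isHolomorphicSection_sharp`).

Identities between antisymmetric tensors are proved by contracting with an arbitrary antisymmetric
tensor, which replaces an alternating sum by a numerical factor (`sum_alternate_mul`). -/

theorem _root_.ContDiffAt.differentiableAt_top {E F : Type*} [NormedAddCommGroup E] [NormedSpace ℝ E]
    [NormedAddCommGroup F] [NormedSpace ℝ F] {u : E → F} {z : E} (h : ContDiffAt ℝ ∞ u z) :
    DifferentiableAt ℝ u z :=
  h.differentiableAt (by simp)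

theorem wirtinger_congr (i : Fin m) (h : u =ᶠ[𝓝 z] v) : wirtinger i u z = wirtinger i v z := by
  simp only [wirtinger, h.fderiv_eq]

theorem wirtingerBar_congr (i : Fin m) (h : u =ᶠ[𝓝 z] v) :
    wirtingerBar i u z = wirtingerBar i v z := by
  simp only [wirtingerBar, h.fderiv_eq]

theorem wirtinger_conj (i : Fin m) :
    wirtinger i (fun w => conj (u w)) z = conj (wirtingerBar i u z) := by
  have : fderiv ℝ (fun w => conj (u w)) z = Complex.conjCLE.toContinuousLinearMap.comp (fderiv ℝ u z) :=
    Complex.conjCLE.comp_fderiv (f := u)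
  have h2 : conj (2 : ℂ) = 2 := Complex.conj_ofReal 2
  simp only [wirtinger, wirtingerBar, this]
  simp [sub_eq_add_neg, h2]

theorem wirtingerBar_conj (i : Fin m) :
    wirtingerBar i (fun w => conj (u w)) z = conj (wirtinger i u z) := by
  rw [← Complex.conj_conj (wirtingerBar i _ z), ← wirtinger_conj]
  simp

theorem wirtinger_const (i : Fin m) (c : ℂ) : wirtinger i (fun _ => c) z = 0 := by
  simp [wirtinger]

theorem wirtingerBar_const (i : Fin m) (c : ℂ) : wirtingerBar i (fun _ => c) z = 0 := by
  simp [wirtingerBar]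

theorem wirtinger_add (i : Fin m) (hu : ContDiffAt ℝ ∞ u z) (hv : ContDiffAt ℝ ∞ v z) :
    wirtinger i (fun w => u w + v w) z = wirtinger i u z + wirtinger i v z := by
  simp only [wirtinger, fderiv_fun_add hu.differentiableAt_top hv.differentiableAt_top]
  simp; ring

theorem wirtingerBar_add (i : Fin m) (hu : ContDiffAt ℝ ∞ u z) (hv : ContDiffAt ℝ ∞ v z) :
    wirtingerBar i (fun w => u w + v w) z = wirtingerBar i u z + wirtingerBar i v z := by
  simp only [wirtingerBar, fderiv_fun_add hu.differentiableAt_top hv.differentiableAt_top]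
  simp; ring

theorem wirtingerBar_neg (i : Fin m) :
    wirtingerBar i (fun w => -u w) z = -wirtingerBar i u z := by
  simp only [wirtingerBar, fderiv_fun_neg]
  simp; ring

theorem wirtinger_mul (i : Fin m) (hu : ContDiffAt ℝ ∞ u z) (hv : ContDiffAt ℝ ∞ v z) :
    wirtinger i (fun w => u w * v w) z = wirtinger i u z * v z + u z * wirtinger i v z := by
  simp only [wirtinger, fderiv_fun_mul hu.differentiableAt_top hv.differentiableAt_top]
  simp; ring

theorem wirtingerBar_mul (i : Fin m) (hu : ContDiffAt ℝ ∞ u z) (hv : ContDiffAt ℝ ∞ v z) :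
    wirtingerBar i (fun w => u w * v w) z = wirtingerBar i u z * v z + u z * wirtingerBar i v z := by
  simp only [wirtingerBar, fderiv_fun_mul hu.differentiableAt_top hv.differentiableAt_top]
  simp; ring

theorem wirtinger_sum {ι : Type*} (s : Finset ι) {u : ι → (Fin m → ℂ) → ℂ} (i : Fin m)
    (hu : ∀ k ∈ s, ContDiffAt ℝ ∞ (u k) z) :
    wirtinger i (fun w => ∑ k ∈ s, u k w) z = ∑ k ∈ s, wirtinger i (u k) z := by
  simp only [wirtinger, fderiv_fun_sum fun k hk => (hu k hk).differentiableAt_top]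
  simp [Finset.mul_sum, ← Finset.sum_sub_distrib]

theorem wirtingerBar_sum {ι : Type*} (s : Finset ι) {u : ι → (Fin m → ℂ) → ℂ} (i : Fin m)
    (hu : ∀ k ∈ s, ContDiffAt ℝ ∞ (u k) z) :
    wirtingerBar i (fun w => ∑ k ∈ s, u k w) z = ∑ k ∈ s, wirtingerBar i (u k) z := by
  simp only [wirtingerBar, fderiv_fun_sum fun k hk => (hu k hk).differentiableAt_top]
  simp [Finset.mul_sum, ← Finset.sum_add_distrib]

theorem wirtinger_const_mul (i : Fin m) (c : ℂ) :
    wirtinger i (fun w => c * u w) z = c * wirtinger i u z := by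
  simp only [wirtinger]
  rw [show (fun w => c * u w) = c • u from rfl, fderiv_const_smul_field]
  simp; ring

theorem wirtingerBar_const_mul (i : Fin m) (c : ℂ) :
    wirtingerBar i (fun w => c * u w) z = c * wirtingerBar i u z := by
  simp only [wirtingerBar]
  rw [show (fun w => c * u w) = c • u from rfl, fderiv_const_smul_field]
  simp; ring

theorem wirtinger_exp (i : Fin m) (hu : ContDiffAt ℝ ∞ u z) :
    wirtinger i (fun w => Complex.exp (u w)) z = Complex.exp (u z) * wirtinger i u z := by
  have : fderiv ℝ (fun w => Complex.exp (u w)) z = Complex.exp (u z) • fderiv ℝ u z :=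
    (hu.differentiableAt_top.hasFDerivAt.cexp).fderiv
  simp only [wirtinger, this]
  simp; ring

theorem wirtinger_prod {ι : Type*} [DecidableEq ι] (s : Finset ι) {u : ι → (Fin m → ℂ) → ℂ}
    (i : Fin m) (hu : ∀ k ∈ s, ContDiffAt ℝ ∞ (u k) z) :
    wirtinger i (fun w => ∏ k ∈ s, u k w) z =
      ∑ k ∈ s, wirtinger i (u k) z * ∏ l ∈ s.erase k, u l z := by
  have h := (HasFDerivAt.finsetProd (u := s) (g := u)
    fun k hk => (hu k hk).differentiableAt_top.hasFDerivAt).fderiv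
  simp only [wirtinger, h]
  simp only [sum_apply, smul_apply, smul_eq_mul,
    Finset.mul_sum, ← Finset.sum_sub_distrib]
  exact Finset.sum_congr rfl fun k _ => by ring

theorem wirtingerBar_prod {ι : Type*} [DecidableEq ι] (s : Finset ι) {u : ι → (Fin m → ℂ) → ℂ}
    (i : Fin m) (hu : ∀ k ∈ s, ContDiffAt ℝ ∞ (u k) z) :
    wirtingerBar i (fun w => ∏ k ∈ s, u k w) z =
      ∑ k ∈ s, wirtingerBar i (u k) z * ∏ l ∈ s.erase k, u l z := by
  have h := (HasFDerivAt.finsetProd (u := s) (g := u)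
    fun k hk => (hu k hk).differentiableAt_top.hasFDerivAt).fderiv
  simp only [wirtingerBar, h]
  simp only [sum_apply, smul_apply, smul_eq_mul,
    Finset.mul_sum, ← Finset.sum_add_distrib]
  exact Finset.sum_congr rfl fun k _ => by ring

/-! ### Smoothness and commutation of Wirtinger derivatives -/

theorem _root_.ContDiffAt.conj_complex {E : Type*} [NormedAddCommGroup E] [NormedSpace ℝ E]
    {n : WithTop ℕ∞} {u : E → ℂ} {z : E} (hu : ContDiffAt ℝ n u z) :
    ContDiffAt ℝ n (fun w => conj (u w)) z :=
  Complex.conjCLE.contDiff.contDiffAt.comp z hu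

theorem contDiffAt_fderiv_apply {E F : Type*} [NormedAddCommGroup E] [NormedSpace ℝ E]
    [NormedAddCommGroup F] [NormedSpace ℝ F] {u : E → F} {z : E} (hu : ContDiffAt ℝ ∞ u z)
    (c : E) : ContDiffAt ℝ ∞ (fun w => fderiv ℝ u w c) z :=
  (hu.fderiv_right (m := ∞) (by simp)).clm_apply contDiffAt_const

theorem contDiffAt_wirtinger (i : Fin m) (hu : ContDiffAt ℝ ∞ u z) :
    ContDiffAt ℝ ∞ (wirtinger i u) z := by
  unfold wirtinger
  have h1 := contDiffAt_fderiv_apply hu (Pi.single i 1)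
  have h2 := contDiffAt_fderiv_apply hu (Pi.single i Complex.I)
  fun_prop

theorem contDiffAt_wirtingerBar (i : Fin m) (hu : ContDiffAt ℝ ∞ u z) :
    ContDiffAt ℝ ∞ (wirtingerBar i u) z := by
  unfold wirtingerBar
  have h1 := contDiffAt_fderiv_apply hu (Pi.single i 1)
  have h2 := contDiffAt_fderiv_apply hu (Pi.single i Complex.I)
  fun_prop

theorem fderiv_fderiv_apply_comm (hu : ContDiffAt ℝ ∞ u z) (a b : Fin m → ℂ) :
    fderiv ℝ (fun w => fderiv ℝ u w a) z b = fderiv ℝ (fun w => fderiv ℝ u w b) z a := by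
  have hd : DifferentiableAt ℝ (fderiv ℝ u) z :=
    (hu.fderiv_right (m := ∞) (by simp)).differentiableAt_top
  have hs : IsSymmSndFDerivAt ℝ u z := hu.isSymmSndFDerivAt (by simp; exact WithTop.coe_le_coe.2 (le_top : (2 : ℕ∞) ≤ ⊤))
  rw [fderiv_clm_apply hd (differentiableAt_const a), fderiv_clm_apply hd (differentiableAt_const b)]
  simpa using hs.eq b a

theorem wirtinger_wirtingerBar_comm (i j : Fin m) (hu : ContDiffAt ℝ ∞ u z) :
    wirtinger i (wirtingerBar j u) z = wirtingerBar j (wirtinger i u) z := by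
  have hd : ∀ c, DifferentiableAt ℝ (fun w => fderiv ℝ u w c) z := fun c =>
    (contDiffAt_fderiv_apply hu c).differentiableAt_top
  unfold wirtinger wirtingerBar
  have h1 : ∀ (s a b c : _) , fderiv ℝ (fun w => (1 / 2 : ℂ) * (fderiv ℝ u w a + s * fderiv ℝ u w b)) z c
      = (1 / 2 : ℂ) * (fderiv ℝ (fun w => fderiv ℝ u w a) z c + s * fderiv ℝ (fun w => fderiv ℝ u w b) z c) := by
    intro s a b c
    rw [fderiv_const_mul ((hd a).fun_add ((hd b).const_mul s)), fderiv_fun_add (hd a) ((hd b).const_mul s),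
      fderiv_const_mul (hd b)]
    simp [mul_add]
  simp only [sub_eq_add_neg, ← neg_mul] 
  simp only [h1, fderiv_fderiv_apply_comm hu (Pi.single i _) (Pi.single j _)]
  ring

theorem wirtingerBar_comm (i j : Fin m) (hu : ContDiffAt ℝ ∞ u z) :
    wirtingerBar i (wirtingerBar j u) z = wirtingerBar j (wirtingerBar i u) z := by
  have hd : ∀ c, DifferentiableAt ℝ (fun w => fderiv ℝ u w c) z := fun c =>
    (contDiffAt_fderiv_apply hu c).differentiableAt_top
  unfold wirtingerBar
  have h1 : ∀ (s a b c : _) , fderiv ℝ (fun w => (1 / 2 : ℂ) * (fderiv ℝ u w a + s * fderiv ℝ u w b)) z c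
      = (1 / 2 : ℂ) * (fderiv ℝ (fun w => fderiv ℝ u w a) z c + s * fderiv ℝ (fun w => fderiv ℝ u w b) z c) := by
    intro s a b c
    rw [fderiv_const_mul ((hd a).fun_add ((hd b).const_mul s)), fderiv_fun_add (hd a) ((hd b).const_mul s),
      fderiv_const_mul (hd b)]
    simp [mul_add]
  simp only [h1, fderiv_fderiv_apply_comm hu (Pi.single i _) (Pi.single j _)]
  ring

/-! ### Real derivatives in terms of Wirtinger derivatives; holomorphic changes of variable -/

theorem real_linear_single (L : (Fin m → ℂ) →L[ℝ] ℂ) (i : Fin m) (c : ℂ) :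
    L (Pi.single i c) = c.re * L (Pi.single i 1) + c.im * L (Pi.single i Complex.I) := by
  have : (Pi.single i c : Fin m → ℂ) = c.re • (Pi.single i 1 : Fin m → ℂ) + c.im • (Pi.single i Complex.I : Fin m → ℂ) := by
    rw [← Pi.single_smul, ← Pi.single_smul, ← Pi.single_add]
    congr 1
    simp
  rw [this]; simp

theorem fderiv_single_eq (i : Fin m) (c : ℂ) :
    fderiv ℝ u z (Pi.single i c) = c * wirtinger i u z + conj c * wirtingerBar i u z := by
  rw [real_linear_single, wirtinger, wirtingerBar]
  conv_rhs => rw [← Complex.re_add_im c]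
  simp only [map_add, Complex.conj_ofReal, map_mul, Complex.conj_I]
  linear_combination ((c.im : ℂ) * fderiv ℝ u z (Pi.single i Complex.I)) * Complex.I_sq

theorem fderiv_apply_eq (a : Fin m → ℂ) :
    fderiv ℝ u z a = ∑ i, (a i * wirtinger i u z + conj (a i) * wirtingerBar i u z) := by
  conv_lhs => rw [← Finset.univ_sum_single a]
  rw [map_sum]
  exact Finset.sum_congr rfl fun i _ => fderiv_single_eq i (a i)

theorem wirtinger_of_differentiableAt (i : Fin m) (h : DifferentiableAt ℂ u z) :
    wirtinger i u z = fderiv ℂ u z (Pi.single i 1) := by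
  have : (Pi.single i Complex.I : Fin m → ℂ) = Complex.I • Pi.single i 1 := by
    rw [← Pi.single_smul]; simp
  rw [wirtinger, h.fderiv_restrictScalars ℝ, this]
  simp only [ContinuousLinearMap.coe_restrictScalars', map_smul, smul_eq_mul, ← mul_assoc,
    Complex.I_mul_I]
  ring

theorem wirtingerBar_of_differentiableAt (i : Fin m) (h : DifferentiableAt ℂ u z) :
    wirtingerBar i u z = 0 := by
  have : (Pi.single i Complex.I : Fin m → ℂ) = Complex.I • Pi.single i 1 := by
    rw [← Pi.single_smul]; simp
  rw [wirtingerBar, h.fderiv_restrictScalars ℝ, this]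
  simp only [ContinuousLinearMap.coe_restrictScalars', map_smul, smul_eq_mul, ← mul_assoc,
    Complex.I_mul_I]
  ring

/-- The Cauchy–Riemann criterion: without ∂̄-part the real derivative is Σ ∂_i u dz^i, which is
complex-linear. -/
theorem differentiableAt_of_wirtingerBar_eq_zero (hu : DifferentiableAt ℝ u z)
    (h : ∀ i, wirtingerBar i u z = 0) : DifferentiableAt ℂ u z := by
  rw [differentiableAt_iff_restrictScalars ℝ hu]
  refine ⟨∑ i, (wirtinger i u z) • ContinuousLinearMap.proj i, ?_⟩
  ext a
  simp [fderiv_apply_eq, h, mul_comm]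

theorem fderiv_comp_holomorphic {τ : (Fin m → ℂ) → (Fin m → ℂ)} (hτ : DifferentiableAt ℂ τ z)
    (hu : DifferentiableAt ℝ u (τ z)) (a : Fin m → ℂ) :
    fderiv ℝ (fun w => u (τ w)) z a = fderiv ℝ u (τ z) (fderiv ℂ τ z a) := by
  have := fderiv_comp z hu (hτ.restrictScalars ℝ)
  rw [show (fun w => u (τ w)) = u ∘ τ from rfl, this, hτ.fderiv_restrictScalars ℝ]
  rfl

/-- The derivative of a holomorphic τ commutes with multiplication by `I`, so the conjugate terms
cancel in the combination defining ∂/∂z^i; no ∂̄u appears. -/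
theorem wirtinger_comp_holomorphic {τ : (Fin m → ℂ) → (Fin m → ℂ)} (hτ : DifferentiableAt ℂ τ z)
    (hu : DifferentiableAt ℝ u (τ z)) (i : Fin m) :
    wirtinger i (fun w => u (τ w)) z =
      ∑ k, fderiv ℂ τ z (Pi.single i 1) k * wirtinger k u (τ z) := by
  have hs : (Pi.single i Complex.I : Fin m → ℂ) = Complex.I • Pi.single i 1 := by
    rw [← Pi.single_smul]; simp
  rw [wirtinger, fderiv_comp_holomorphic hτ hu, fderiv_comp_holomorphic hτ hu, hs, map_smul,
    fderiv_apply_eq, fderiv_apply_eq, Finset.mul_sum, ← Finset.sum_sub_distrib, Finset.mul_sum]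
  refine Finset.sum_congr rfl fun k _ => ?_
  simp only [Pi.smul_apply, smul_eq_mul, map_mul, Complex.conj_I]
  linear_combination (-1 / 2 * fderiv ℂ τ z (Pi.single i 1) k * wirtinger k u (τ z)
    + 1 / 2 * conj (fderiv ℂ τ z (Pi.single i 1) k) * wirtingerBar k u (τ z)) * Complex.I_sq

theorem wirtingerBar_comp_holomorphic {τ : (Fin m → ℂ) → (Fin m → ℂ)}
    (hτ : DifferentiableAt ℂ τ z) (hu : DifferentiableAt ℝ u (τ z)) (i : Fin m) :
    wirtingerBar i (fun w => u (τ w)) z =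
      ∑ k, conj (fderiv ℂ τ z (Pi.single i 1) k) * wirtingerBar k u (τ z) := by
  have hs : (Pi.single i Complex.I : Fin m → ℂ) = Complex.I • Pi.single i 1 := by
    rw [← Pi.single_smul]; simp
  rw [wirtingerBar, fderiv_comp_holomorphic hτ hu, fderiv_comp_holomorphic hτ hu, hs, map_smul,
    fderiv_apply_eq, fderiv_apply_eq, Finset.mul_sum, ← Finset.sum_add_distrib, Finset.mul_sum]
  refine Finset.sum_congr rfl fun k _ => ?_
  simp only [Pi.smul_apply, smul_eq_mul, map_mul, Complex.conj_I]
  linear_combination (1 / 2 * fderiv ℂ τ z (Pi.single i 1) k * wirtinger k u (τ z)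
    - 1 / 2 * conj (fderiv ℂ τ z (Pi.single i 1) k) * wirtingerBar k u (τ z)) * Complex.I_sq

end Wirtinger

open scoped Matrix

/-! ### Multi-index tensors -/

section Tensor

variable {m q : ℕ}

/-- The action of a matrix on multi-index tensors, as a matrix on multi-indices. -/
def tensorPow (P : Matrix (Fin m) (Fin m) ℂ) : Matrix (Fin q → Fin m) (Fin q → Fin m) ℂ :=
  Matrix.of fun I J => ∏ k, P (I k) (J k)

theorem tensorPow_apply (P : Matrix (Fin m) (Fin m) ℂ) (I J : Fin q → Fin m) :
    tensorPow P I J = ∏ k, P (I k) (J k) := rfl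

theorem tensorPow_mul (P Q : Matrix (Fin m) (Fin m) ℂ) :
    (tensorPow (P * Q) : Matrix (Fin q → Fin m) _ ℂ) = tensorPow P * tensorPow Q := by
  ext I J
  simp only [tensorPow_apply, Matrix.mul_apply, Finset.prod_univ_sum, Fintype.piFinset_univ,
    Finset.prod_mul_distrib]

theorem tensorPow_one : (tensorPow 1 : Matrix (Fin q → Fin m) (Fin q → Fin m) ℂ) = 1 := by
  ext I J
  simp only [tensorPow_apply, Matrix.one_apply, Finset.prod_ite_zero, Finset.mem_univ,
    true_implies, Finset.prod_const_one, funext_iff]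

theorem tensorPow_transpose (P : Matrix (Fin m) (Fin m) ℂ) :
    (tensorPow P.transpose : Matrix (Fin q → Fin m) _ ℂ) = (tensorPow P).transpose := rfl

theorem tensorPow_cons (P : Matrix (Fin m) (Fin m) ℂ) (i j : Fin m) (I J : Fin q → Fin m) :
    tensorPow P (Fin.cons i I : Fin (q + 1) → Fin m) (Fin.cons j J) = P i j * tensorPow P I J := by
  simp [tensorPow_apply, Fin.prod_univ_succ]

theorem tensorPow_perm (P : Matrix (Fin m) (Fin m) ℂ) (π : Equiv.Perm (Fin q))
    (I J : Fin q → Fin m) : tensorPow P (I ∘ π) (J ∘ π) = tensorPow P I J := by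
  simp only [tensorPow_apply, Function.comp]
  exact Equiv.prod_comp π fun k => P (I k) (J k)

theorem sum_cons (F : (Fin (q + 1) → Fin m) → ℂ) :
    ∑ J, F J = ∑ j, ∑ J' : Fin q → Fin m, F (Fin.cons j J') := by
  rw [← Fintype.sum_prod_type']
  exact (Equiv.sum_comp (Fin.consEquiv fun _ => Fin m) F).symm

theorem sum_comp_perm (F : (Fin q → Fin m) → ℂ) (π : Equiv.Perm (Fin q)) :
    ∑ J : Fin q → Fin m, F (J ∘ π) = ∑ J, F J :=
  Equiv.sum_comp (π.symm.arrowCongr (Equiv.refl (Fin m))) F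

/-- Antisymmetric multi-index tensors. -/
def IsAntisymm (u : (Fin q → Fin m) → ℂ) : Prop :=
  ∀ (π : Equiv.Perm (Fin q)) (J : Fin q → Fin m), u (J ∘ π) = (Equiv.Perm.sign π : ℤ) * u J

theorem IsAntisymm.swap {u : (Fin q → Fin m) → ℂ} (hu : IsAntisymm u) {i j : Fin q} (hij : i ≠ j)
    (J : Fin q → Fin m) : u (J ∘ Equiv.swap i j) = -u J := by
  rw [hu, Equiv.Perm.sign_swap hij]; simp

theorem IsAntisymm.conj {u : (Fin q → Fin m) → ℂ} (hu : IsAntisymm u) :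
    IsAntisymm fun J => conj (u J) := fun π J => by
  beta_reduce; rw [hu π J]; simp

theorem IsAntisymm.sub {u v : (Fin q → Fin m) → ℂ} (hu : IsAntisymm u) (hv : IsAntisymm v) :
    IsAntisymm fun J => u J - v J := fun π J => by
  beta_reduce; rw [hu π J, hv π J]; ring

theorem IsAntisymm.const_mul {u : (Fin q → Fin m) → ℂ} (hu : IsAntisymm u) (c : ℂ) :
    IsAntisymm fun J => c * u J := fun π J => by
  beta_reduce; rw [hu π J]; ring

theorem IsAntisymm.sum {ι : Type*} {s : Finset ι} {u : ι → (Fin q → Fin m) → ℂ}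
    (hu : ∀ i ∈ s, IsAntisymm (u i)) : IsAntisymm fun J => ∑ i ∈ s, u i J := fun π J => by
  rw [Finset.mul_sum]
  exact Finset.sum_congr rfl fun i hi => hu i hi π J

/-- A permutation of the tail extends to all slots by fixing slot 0, and the extension has the same
sign. -/
theorem IsAntisymm.cons {u : (Fin (q + 1) → Fin m) → ℂ} (hu : IsAntisymm u) (j : Fin m) :
    IsAntisymm fun J => u (Fin.cons j J) := fun π J => by
  have h : (Fin.cons j (J ∘ π) : Fin (q + 1) → Fin m) =
      Fin.cons j J ∘ (Equiv.Perm.decomposeFin.symm (0, π)) := by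
    funext k
    refine Fin.cases ?_ (fun k => ?_) k
    · simp
    · simp
  simp only [h]
  rw [hu]
  simp

theorem IsAntisymm.mulVec {u : (Fin q → Fin m) → ℂ} (hu : IsAntisymm u)
    (P : Matrix (Fin m) (Fin m) ℂ) : IsAntisymm (tensorPow P *ᵥ u) := fun π J => by
  simp only [Matrix.mulVec, dotProduct, Finset.mul_sum]
  rw [← sum_comp_perm _ π]
  refine Finset.sum_congr rfl fun I _ => ?_
  rw [tensorPow_perm, hu]; ring

/-- Reindexing by the transposition changes the sum into its negative. This is the source of every
cancellation of symmetric against antisymmetric indices. -/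
theorem sum_mul_eq_zero_of_swap {F Y : (Fin q → Fin m) → ℂ} (hY : IsAntisymm Y) {i j : Fin q}
    (hij : i ≠ j) (hF : ∀ J, F (J ∘ Equiv.swap i j) = F J) : ∑ J, F J * Y J = 0 := by
  have h := sum_comp_perm (fun J => F J * Y J) (Equiv.swap i j)
  simp only [hF, hY.swap hij, mul_neg, Finset.sum_neg_distrib] at h
  linear_combination -(1 / 2 : ℂ) * h

/-- Contracting an alternated expression with an antisymmetric tensor. -/
theorem sum_alternate_mul {F : Fin m → (Fin q → Fin m) → ℂ} {Y : (Fin (q + 1) → Fin m) → ℂ}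
    (hY : IsAntisymm Y) :
    ∑ K : Fin (q + 1) → Fin m,
        (∑ b : Fin (q + 1), (-1 : ℂ) ^ (b : ℕ) * F (K b) (fun k => K (b.succAbove k))) * Y K =
      (q + 1) * ∑ K : Fin (q + 1) → Fin m, F (K 0) (Fin.tail K) * Y K := by
  have h : ∀ b : Fin (q + 1), ∑ K : Fin (q + 1) → Fin m,
      (-1 : ℂ) ^ (b : ℕ) * F (K b) (fun k => K (b.succAbove k)) * Y K =
        ∑ K : Fin (q + 1) → Fin m, F (K 0) (Fin.tail K) * Y K := by
    intro b
    -- This cycle brings slot `b` to the front and keeps the order of the others; its sign (-1)^b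
    -- cancels the one in the alternating sum.
    rw [← sum_comp_perm (fun K => F (K 0) (Fin.tail K) * Y K) b.cycleRange.symm]
    refine Finset.sum_congr rfl fun K _ => ?_
    have h0 : (K ∘ b.cycleRange.symm) 0 = K b := by simp
    have h1 : Fin.tail (K ∘ b.cycleRange.symm) = fun k => K (b.succAbove k) := by
      funext k
      simp [Fin.tail]
    rw [h0, h1, hY]
    have : ((Equiv.Perm.sign b.cycleRange.symm : ℤ) : ℂ) = (-1) ^ (b : ℕ) := by
      rw [Equiv.Perm.sign_symm, Fin.sign_cycleRange]; simp
    rw [this]; ring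
  simp only [Finset.sum_mul]
  rw [Finset.sum_comm, Finset.sum_congr rfl fun b _ => h b]
  simp

/-- The derivative terms of a coefficient matrix with symmetric derivatives do not contribute to
the contraction with an antisymmetric tensor. -/
theorem sum_deriv_tensorPow_mul {P : Matrix (Fin m) (Fin m) ℂ}
    {dP : Fin m → Matrix (Fin m) (Fin m) ℂ} (hdP : ∀ i j k, dP i j k = dP j i k)
    {u : (Fin q → Fin m) → ℂ} {Y : (Fin (q + 1) → Fin m) → ℂ} (hY : IsAntisymm Y) :
    ∑ J : Fin (q + 1) → Fin m, (∑ I : Fin q → Fin m,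
      (∑ s, dP (J 0) (Fin.tail J s) (I s) *
        ∏ l ∈ Finset.univ.erase s, P (Fin.tail J l) (I l)) * u I) * Y J = 0 := by
  simp only [Finset.sum_mul]
  rw [Finset.sum_comm]
  refine Finset.sum_eq_zero fun I _ => ?_
  rw [Finset.sum_comm]
  refine Finset.sum_eq_zero fun s _ => ?_
  -- Swapping slots 0 and `s.succ` exchanges the direction of differentiation with the row index of
  -- the differentiated factor, which `hdP` allows; the other factors do not see these slots.
  refine sum_mul_eq_zero_of_swap hY (i := 0) (j := s.succ) (Fin.succ_ne_zero s).symm fun J => ?_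
  have h0 : (J ∘ Equiv.swap 0 s.succ) 0 = J s.succ := by simp
  have h1 : Fin.tail (J ∘ Equiv.swap 0 s.succ) s = J 0 := by simp [Fin.tail]
  rw [h0, h1, hdP]
  congr 2
  refine Finset.prod_congr rfl fun l hl => ?_
  have hls : l ≠ s := Finset.ne_of_mem_erase hl
  have : Fin.tail (J ∘ Equiv.swap 0 s.succ) l = Fin.tail J l := by
    simp only [Fin.tail, Function.comp]
    rw [Equiv.swap_apply_of_ne_of_ne (Fin.succ_ne_zero l) (by simpa using hls)]
  rw [this]

/-- Alternation of a tensor that is antisymmetric in all indices but the first. -/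
def altFirst (T : (Fin (q + 1) → Fin m) → ℂ) (J : Fin (q + 1) → Fin m) : ℂ :=
  T J - ∑ s : Fin q, T (J ∘ Equiv.swap 0 s.succ)

/-- Every permutation is a transposition of 0 with some p composed with one fixing 0. The latter
contribute equally by antisymmetry in the tail, which gives q!; the former give the q + 1 terms of
`altFirst`. -/
theorem sum_sign_mul_eq_altFirst {T : (Fin (q + 1) → Fin m) → ℂ}
    (hT : ∀ j, IsAntisymm fun J => T (Fin.cons j J)) (J : Fin (q + 1) → Fin m) :
    ∑ π : Equiv.Perm (Fin (q + 1)), ((Equiv.Perm.sign π : ℤ) : ℂ) * T (J ∘ π) =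
      (q.factorial : ℂ) * altFirst T J := by
  rw [← Equiv.sum_comp Equiv.Perm.decomposeFin.symm, Fintype.sum_prod_type]
  have h : ∀ (p : Fin (q + 1)) (e : Equiv.Perm (Fin q)),
      ((Equiv.Perm.sign (Equiv.Perm.decomposeFin.symm (p, e)) : ℤ) : ℂ) *
        T (J ∘ Equiv.Perm.decomposeFin.symm (p, e)) =
      (if p = 0 then 1 else -1) * T (J ∘ Equiv.swap 0 p) := by
    intro p e
    have h1 : J ∘ Equiv.Perm.decomposeFin.symm (p, e) =
        Fin.cons (J p) (Fin.tail (J ∘ Equiv.swap 0 p) ∘ e) := by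
      funext k
      refine Fin.cases ?_ (fun k => ?_) k
      · simp
      · simp [Fin.tail]
    have h2 : (Fin.cons (J p) (Fin.tail (J ∘ Equiv.swap 0 p)) : Fin (q + 1) → Fin m) =
        J ∘ Equiv.swap 0 p := by
      conv_rhs => rw [← Fin.cons_self_tail (J ∘ Equiv.swap 0 p)]
      simp
    have h4 : T (Fin.cons (J p) (Fin.tail (J ∘ Equiv.swap 0 p) ∘ e)) = _ := hT (J p) e _
    beta_reduce at h4
    rw [h1, h4, h2, Equiv.Perm.decomposeFin.symm_sign]
    have h3 : ((Equiv.Perm.sign e : ℤ) : ℂ) * ((Equiv.Perm.sign e : ℤ) : ℂ) = 1 := by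
      norm_cast
      simp
    split_ifs
    · push_cast; linear_combination T (J ∘ Equiv.swap 0 p) * h3
    · push_cast; linear_combination -T (J ∘ Equiv.swap 0 p) * h3
  simp only [h, Finset.sum_const, Finset.card_univ, Fintype.card_perm, Fintype.card_fin,
    nsmul_eq_mul]
  rw [← Finset.mul_sum, Fin.sum_univ_succ, altFirst]
  simp [Fin.succ_ne_zero, sub_eq_add_neg]

/-- The full signed sum over permutations is antisymmetric, by translation in the symmetric group,
and `altFirst` differs from it by the nonzero factor q!. -/
theorem isAntisymm_altFirst {T : (Fin (q + 1) → Fin m) → ℂ}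
    (hT : ∀ j, IsAntisymm fun J => T (Fin.cons j J)) : IsAntisymm (altFirst T) := fun ρ J => by
  have hq : (q.factorial : ℂ) ≠ 0 := by exact_mod_cast q.factorial_ne_zero
  refine mul_left_cancel₀ hq ?_
  rw [← sum_sign_mul_eq_altFirst hT, mul_left_comm, ← sum_sign_mul_eq_altFirst hT, Finset.mul_sum,
    ← Equiv.sum_comp (Equiv.mulLeft ρ)
      fun π => ((Equiv.Perm.sign ρ : ℤ) : ℂ) * (((Equiv.Perm.sign π : ℤ) : ℂ) * T (J ∘ π))]
  refine Finset.sum_congr rfl fun π _ => ?_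
  have h3 : ((Equiv.Perm.sign ρ : ℤ) : ℂ) * ((Equiv.Perm.sign ρ : ℤ) : ℂ) = 1 := by
    norm_cast
    simp
  simp only [Equiv.coe_mulLeft, Equiv.Perm.sign_mul, Equiv.Perm.coe_mul]
  rw [← Function.comp_assoc]
  push_cast
  linear_combination (-((Equiv.Perm.sign π : ℤ) : ℂ) * T ((J ∘ ρ) ∘ π)) * h3

end Tensor

open scoped Matrix

/-! ### Derivatives of contracted tensors -/

section TensorDeriv

variable {m q : ℕ} {z : Fin m → ℂ} {P : (Fin m → ℂ) → Matrix (Fin m) (Fin m) ℂ}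
  {u : (Fin m → ℂ) → (Fin q → Fin m) → ℂ}

theorem contDiffAt_tensorPow (hP : ∀ i j, ContDiffAt ℝ ∞ (fun w => P w i j) z)
    (I J : Fin q → Fin m) : ContDiffAt ℝ ∞ (fun w => tensorPow (P w) I J) z :=
  (contDiffAt_prod fun k _ => hP (I k) (J k) : ContDiffAt ℝ ∞ (fun w => ∏ k, P w (I k) (J k)) z)

theorem contDiffAt_tensorPow_mulVec (hP : ∀ i j, ContDiffAt ℝ ∞ (fun w => P w i j) z)
    (hu : ∀ I, ContDiffAt ℝ ∞ (fun w => u w I) z) (J : Fin q → Fin m) :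
    ContDiffAt ℝ ∞ (fun w => (tensorPow (P w) *ᵥ u w) J) z :=
  ContDiffAt.sum fun I _ => (contDiffAt_tensorPow hP J I).mul (hu I)

theorem wirtinger_tensorPow_mulVec (hP : ∀ i j, ContDiffAt ℝ ∞ (fun w => P w i j) z)
    (hu : ∀ I, ContDiffAt ℝ ∞ (fun w => u w I) z) (j : Fin m) (J : Fin q → Fin m) :
    wirtinger j (fun w => (tensorPow (P w) *ᵥ u w) J) z =
      (∑ I, (∑ s, wirtinger j (fun w => P w (J s) (I s)) z *
        ∏ l ∈ Finset.univ.erase s, P z (J l) (I l)) * u z I) +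
      (tensorPow (P z) *ᵥ fun I => wirtinger j (fun w => u w I) z) J := by
  simp only [Matrix.mulVec, dotProduct]
  rw [wirtinger_sum _ _ fun I _ => (contDiffAt_tensorPow hP J I).mul (hu I),
    ← Finset.sum_add_distrib]
  refine Finset.sum_congr rfl fun I _ => ?_
  rw [wirtinger_mul _ (contDiffAt_tensorPow hP J I) (hu I)]
  simp only [tensorPow_apply]
  rw [wirtinger_prod _ _ fun k _ => hP (J k) (I k)]

theorem wirtingerBar_tensorPow_mulVec (hP : ∀ i j, ContDiffAt ℝ ∞ (fun w => P w i j) z)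
    (hu : ∀ I, ContDiffAt ℝ ∞ (fun w => u w I) z) (j : Fin m) (J : Fin q → Fin m) :
    wirtingerBar j (fun w => (tensorPow (P w) *ᵥ u w) J) z =
      (∑ I, (∑ s, wirtingerBar j (fun w => P w (J s) (I s)) z *
        ∏ l ∈ Finset.univ.erase s, P z (J l) (I l)) * u z I) +
      (tensorPow (P z) *ᵥ fun I => wirtingerBar j (fun w => u w I) z) J := by
  simp only [Matrix.mulVec, dotProduct]
  rw [wirtingerBar_sum _ _ fun I _ => (contDiffAt_tensorPow hP J I).mul (hu I),
    ← Finset.sum_add_distrib]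
  refine Finset.sum_congr rfl fun I _ => ?_
  rw [wirtingerBar_mul _ (contDiffAt_tensorPow hP J I) (hu I)]
  simp only [tensorPow_apply]
  rw [wirtingerBar_prod _ _ fun k _ => hP (J k) (I k)]

/-- By `hsymm` the product-rule terms that differentiate `P` are symmetric in a pair of slots and
vanish against `Y`. Thus `P` moves through an alternated derivative; `P` will be the Kähler metric.
-/
theorem sum_wirtinger_tensorPow_mul (hP : ∀ i j, ContDiffAt ℝ ∞ (fun w => P w i j) z)
    (hsymm : ∀ i j k, wirtinger i (fun w => P w j k) z = wirtinger j (fun w => P w i k) z)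
    (hu : ∀ I, ContDiffAt ℝ ∞ (fun w => u w I) z) {Y : (Fin (q + 1) → Fin m) → ℂ}
    (hY : IsAntisymm Y) :
    ∑ J : Fin (q + 1) → Fin m,
        wirtinger (J 0) (fun w => (tensorPow (P w) *ᵥ u w) (Fin.tail J)) z * Y J =
      ∑ J : Fin (q + 1) → Fin m,
        (tensorPow (P z) *ᵥ fun I => wirtinger (J 0) (fun w => u w I) z) (Fin.tail J) * Y J := by
  simp only [wirtinger_tensorPow_mulVec hP hu, add_mul, Finset.sum_add_distrib]
  rw [add_eq_right]
  exact sum_deriv_tensorPow_mul (P := P z)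
    (dP := fun i => Matrix.of fun j k => wirtinger i (fun w => P w j k) z) hsymm hY

/-- The same cancellation for ∂̄, applied with `P` the transposed metric and with `P` the conjugate
transpose of a Jacobian of a coordinate change. -/
theorem sum_wirtingerBar_tensorPow_mul (hP : ∀ i j, ContDiffAt ℝ ∞ (fun w => P w i j) z)
    (hsymm : ∀ i j k, wirtingerBar i (fun w => P w j k) z = wirtingerBar j (fun w => P w i k) z)
    (hu : ∀ I, ContDiffAt ℝ ∞ (fun w => u w I) z) {Y : (Fin (q + 1) → Fin m) → ℂ}
    (hY : IsAntisymm Y) :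
    ∑ J : Fin (q + 1) → Fin m,
        wirtingerBar (J 0) (fun w => (tensorPow (P w) *ᵥ u w) (Fin.tail J)) z * Y J =
      ∑ J : Fin (q + 1) → Fin m,
        (tensorPow (P z) *ᵥ fun I => wirtingerBar (J 0) (fun w => u w I) z) (Fin.tail J) * Y J := by
  simp only [wirtingerBar_tensorPow_mulVec hP hu, add_mul, Finset.sum_add_distrib]
  rw [add_eq_right]
  exact sum_deriv_tensorPow_mul (P := P z)
    (dP := fun i => Matrix.of fun j k => wirtingerBar i (fun w => P w j k) z) hsymm hY

theorem IsAntisymm.wirtingerBar (hu : ∀ᶠ w in 𝓝 z, IsAntisymm (u w)) (j : Fin m) :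
    IsAntisymm fun I => wirtingerBar j (fun w => u w I) z := fun π J => by
  beta_reduce
  rw [← wirtingerBar_const_mul]
  refine wirtingerBar_congr j ?_
  filter_upwards [hu] with w hw using hw π J

end TensorDeriv

/-! ### The pointwise Bochner formula -/

section Bochner

variable {m q : ℕ}

theorem sum_mul_sum_swap {ι κ : Type*} [Fintype ι] [Fintype κ] (A : ι → κ → ℂ) (x : κ → ℂ)
    (y : ι → ℂ) : ∑ i, (∑ k, A i k * x k) * y i = ∑ k, x k * ∑ i, A i k * y i := by
  simp only [Finset.sum_mul, Finset.mul_sum]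
  rw [Finset.sum_comm]
  exact Finset.sum_congr rfl fun k _ => Finset.sum_congr rfl fun i _ => by ring

theorem mulVec_transpose_pairing {ι : Type*} [Fintype ι] (A : Matrix ι ι ℂ) (x y : ι → ℂ) :
    ∑ i, (Aᵀ *ᵥ x) i * y i = ∑ k, x k * (A *ᵥ y) k := by
  simp only [Matrix.mulVec, dotProduct, Matrix.transpose_apply]
  rw [sum_mul_sum_swap (fun i k => A k i) x y]

theorem tensorPow_mulVec_cons (P : Matrix (Fin m) (Fin m) ℂ) (u : (Fin (q + 1) → Fin m) → ℂ)
    (b : Fin m) (J : Fin q → Fin m) :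
    (tensorPow P *ᵥ u) (Fin.cons b J) =
      ∑ l, P b l * (tensorPow P *ᵥ fun I => u (Fin.cons l I)) J := by
  simp only [Matrix.mulVec, dotProduct]
  rw [sum_cons]
  simp only [tensorPow_cons, Finset.mul_sum, mul_assoc]

theorem comp_swap_succ {T : (Fin (q + 1) → Fin m) → ℂ}
    (hT : ∀ j, IsAntisymm fun J => T (Fin.cons j J)) {a b : Fin q} (hab : a ≠ b)
    (K : Fin (q + 1) → Fin m) : T (K ∘ Equiv.swap a.succ b.succ) = -T K := by
  have h : K ∘ Equiv.swap a.succ b.succ = Fin.cons (K 0) (Fin.tail K ∘ Equiv.swap a b) := by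
    funext k
    refine Fin.cases ?_ (fun k => ?_) k
    · simp [Equiv.swap_apply_of_ne_of_ne (Fin.succ_ne_zero a).symm (Fin.succ_ne_zero b).symm]
    · simp [Fin.tail, (Fin.succ_injective q).map_swap]
  have h2 := (hT (K 0)).swap hab (Fin.tail K)
  rw [h, h2, Fin.cons_self_tail]

/-- Reindexing by the transposition of slots 1 and `s.succ` conjugates one swap into the other; the
signs produced by `S` and by `T` cancel. -/
theorem sum_mul_swap_eq {S T : (Fin (q + 2) → Fin m) → ℂ}
    (hS : ∀ j, IsAntisymm fun J => S (Fin.cons j J))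
    (hT : ∀ j, IsAntisymm fun J => T (Fin.cons j J)) (s : Fin (q + 1)) :
    ∑ K, S K * T (K ∘ Equiv.swap 0 s.succ) = ∑ K, S K * T (K ∘ Equiv.swap 0 (Fin.succ 0)) := by
  rcases eq_or_ne s 0 with rfl | hs
  · rfl
  rw [← sum_comp_perm _ (Equiv.swap (Fin.succ 0) s.succ)]
  refine Finset.sum_congr rfl fun K _ => ?_
  have h : (K ∘ Equiv.swap (Fin.succ 0) s.succ) ∘ Equiv.swap 0 s.succ =
      (K ∘ Equiv.swap 0 (Fin.succ 0)) ∘ Equiv.swap (Fin.succ 0) s.succ := by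
    rw [Function.comp_assoc, Function.comp_assoc, ← Equiv.Perm.coe_mul, ← Equiv.Perm.coe_mul]
    congr 2
    rw [Equiv.mul_swap_eq_swap_mul, Equiv.swap_apply_right, Equiv.swap_apply_of_ne_of_ne
      (Fin.succ_ne_zero 0).symm (Fin.succ_ne_zero s).symm]
  rw [h, comp_swap_succ hS hs.symm, comp_swap_succ hT hs.symm]
  ring

/-- The norm of the `(0,1)`-derivative of a closed form, in terms of the contraction with its
transpose. -/
theorem norm_eq_of_closed {G H : Matrix (Fin m) (Fin m) ℂ} (hGH : G * Hᵀ = 1)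
    (hH : ∀ i j, conj (H i j) = H j i) {X : Fin m → (Fin (q + 1) → Fin m) → ℂ}
    (hX : ∀ j, IsAntisymm (X j))
    (hclosed : ∀ Y : (Fin (q + 2) → Fin m) → ℂ, IsAntisymm Y →
      ∑ K : Fin (q + 2) → Fin m, (tensorPow Gᵀ *ᵥ X (K 0)) (Fin.tail K) * Y K = 0) :
    ∑ K : Fin (q + 2) → Fin m, (tensorPow Gᵀ *ᵥ X (K 0)) (Fin.tail K) *
        conj (∑ j, H (K 0) j * X j (Fin.tail K)) =
      (q + 1) * ∑ l, ∑ j, ∑ I : Fin q → Fin m, X j (Fin.cons l I) *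
        (tensorPow G *ᵥ fun J => conj (X l (Fin.cons j J))) I := by
  set S : (Fin (q + 2) → Fin m) → ℂ := fun K => (tensorPow Gᵀ *ᵥ X (K 0)) (Fin.tail K) with hSdef
  set T : (Fin (q + 2) → Fin m) → ℂ := fun K => ∑ j, H (K 0) j * X j (Fin.tail K) with hTdef
  have hS : ∀ j, IsAntisymm fun J => S (Fin.cons j J) := fun j => by
    simpa [hSdef] using (hX j).mulVec Gᵀ
  have hT : ∀ j, IsAntisymm fun J => T (Fin.cons j J) := fun j => by
    simpa [hTdef] using IsAntisymm.sum fun i _ => (hX i).const_mul (H j i)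
  have hT' : ∀ j, IsAntisymm fun J => conj (T (Fin.cons j J)) := fun j => (hT j).conj
  -- Testing closedness on the alternation of T itself expresses the norm through the q + 1
  -- transposed contractions, which all agree by `sum_mul_swap_eq`.
  have h0 := hclosed _ (isAntisymm_altFirst hT).conj
  have h1 : ∑ K, S K * conj (T K) =
      ∑ s : Fin (q + 1), ∑ K, S K * conj (T (K ∘ Equiv.swap 0 s.succ)) := by
    rw [← sub_eq_zero, ← h0, Finset.sum_comm, ← Finset.sum_sub_distrib]
    refine Finset.sum_congr rfl fun K _ => ?_
    simp [altFirst, mul_sub, Finset.mul_sum, hSdef]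
  rw [h1, Finset.sum_congr rfl fun s _ => sum_mul_swap_eq (T := fun K => conj (T K)) hS hT' s]
  simp only [Finset.sum_const, Finset.card_univ, Fintype.card_fin, nsmul_eq_mul]
  push_cast
  congr 1
  rw [sum_cons]
  simp only [sum_cons (q := q)]
  have hsw : ∀ (a b : Fin m) (J : Fin q → Fin m),
      (Fin.cons a (Fin.cons b J : Fin (q + 1) → Fin m) : Fin (q + 2) → Fin m) ∘
        Equiv.swap 0 (Fin.succ 0) = Fin.cons b (Fin.cons a J : Fin (q + 1) → Fin m) := by
    intro a b J
    funext k
    refine Fin.cases ?_ (fun k => Fin.cases ?_ (fun k => ?_) k) k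
    · simp
    · simp
    · simp only [Function.comp]
      rw [Equiv.swap_apply_of_ne_of_ne (Fin.succ_ne_zero _)
        (by simp [Fin.ext_iff])]
      simp
  -- After the swap, the lowering by `G` in `S` meets the raising by `H` in the conjugate of `T`,
  -- and the two cancel.
  have hδ : ∀ l c, ∑ b, G l b * conj (H b c) = if l = c then 1 else 0 := by
    intro l c
    have := congrFun (congrFun hGH l) c
    simp only [Matrix.mul_apply, Matrix.transpose_apply, Matrix.one_apply] at this
    rw [← this]
    exact Finset.sum_congr rfl fun b _ => by rw [hH]
  simp only [hsw, hSdef, hTdef, Fin.cons_zero, Fin.tail_cons, tensorPow_mulVec_cons, map_sum,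
    map_mul, Matrix.transpose_apply]
  have key : ∀ (a : Fin m) (J : Fin q → Fin m),
      ∑ b, (∑ l, G l b * (tensorPow Gᵀ *ᵥ fun I => X a (Fin.cons l I)) J) *
        (∑ c, conj (H b c) * conj (X c (Fin.cons a J))) =
      ∑ l, (tensorPow Gᵀ *ᵥ fun I => X a (Fin.cons l I)) J * conj (X l (Fin.cons a J)) := by
    intro a J
    rw [sum_mul_sum_swap (fun b l => G l b)
      (fun l => (tensorPow Gᵀ *ᵥ fun I => X a (Fin.cons l I)) J)]
    refine Finset.sum_congr rfl fun l _ => ?_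
    congr 1
    simp only [Finset.mul_sum, ← mul_assoc]
    rw [Finset.sum_comm]
    simp only [← Finset.sum_mul, hδ]
    simp
  conv_rhs => rw [Finset.sum_comm]
  refine Finset.sum_congr rfl fun a _ => ?_
  rw [Finset.sum_comm, Finset.sum_congr rfl fun J _ => key a J, Finset.sum_comm]
  refine Finset.sum_congr rfl fun l _ => ?_
  rw [← mulVec_transpose_pairing, tensorPow_transpose]

/-- The vector field whose weighted divergence appears in the Bochner formula. -/
def bochnerField (G : (Fin m → ℂ) → Matrix (Fin m) (Fin m) ℂ)
    (σ : (Fin m → ℂ) → (Fin (q + 1) → Fin m) → ℂ) (l : Fin m) (w : Fin m → ℂ) : ℂ :=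
  ∑ j, ∑ I : Fin q → Fin m, wirtingerBar j (fun w => σ w (Fin.cons l I)) w *
    (tensorPow (G w) *ᵥ fun J => conj (σ w (Fin.cons j J))) I

/-- The squared norm of the `(0,1)`-derivative of a multivector field. -/
def dbarNormSq (G H : (Fin m → ℂ) → Matrix (Fin m) (Fin m) ℂ)
    (σ : (Fin m → ℂ) → (Fin (q + 1) → Fin m) → ℂ) (w : Fin m → ℂ) : ℂ :=
  ∑ K : Fin (q + 2) → Fin m,
    (tensorPow (G w)ᵀ *ᵥ fun I => wirtingerBar (K 0) (fun w => σ w I) w) (Fin.tail K) *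
      conj (∑ j, H w (K 0) j * wirtingerBar j (fun w => σ w (Fin.tail K)) w)

variable {z : Fin m → ℂ} {G H : (Fin m → ℂ) → Matrix (Fin m) (Fin m) ℂ}
  {σ : (Fin m → ℂ) → (Fin (q + 1) → Fin m) → ℂ} {τ : (Fin m → ℂ) → (Fin q → Fin m) → ℂ}
  {ℓ : (Fin m → ℂ) → ℂ} {lam : ℂ}

theorem wirtinger_exp_mul {u : (Fin m → ℂ) → ℂ} (hℓ : ContDiffAt ℝ ∞ ℓ z)
    (hu : ContDiffAt ℝ ∞ u z) (l : Fin m) :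
    wirtinger l (fun w => Complex.exp (ℓ w) * u w) z =
      Complex.exp (ℓ z) * (wirtinger l u z + wirtinger l ℓ z * u z) := by
  rw [wirtinger_mul l hℓ.cexp hu, wirtinger_exp l hℓ]; ring

/-- The weighted divergence is ∂_l plus multiplication by ∂_lℓ. Since ∂̄_k commutes with ∂_l, the
only commutator is (∂_l∂̄_kℓ)σ, which `hricci` turns into -g_{lk̄}σ. -/
theorem wirtingerBar_weighted_divergence (hℓe : ∀ᶠ w in 𝓝 z, ContDiffAt ℝ ∞ ℓ w)
    (hricci : ∀ l k, wirtinger l (wirtingerBar k ℓ) z = -G z l k)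
    (hσe : ∀ᶠ w in 𝓝 z, ∀ I, ContDiffAt ℝ ∞ (fun w => σ w I) w)
    (hτ : ∀ᶠ w in 𝓝 z, ∀ I, Complex.exp (ℓ w) * τ w I =
      -∑ l, wirtinger l (fun w => Complex.exp (ℓ w) * σ w (Fin.cons l I)) w)
    (k : Fin m) (I : Fin q → Fin m) :
    wirtingerBar k (fun w => τ w I) z = ∑ l, G z l k * σ z (Fin.cons l I) -
      ∑ l, Complex.exp (-ℓ z) * wirtinger l (fun w => Complex.exp (ℓ w) *
        wirtingerBar k (fun w => σ w (Fin.cons l I)) w) z := by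
  have hσ := hσe.self_of_nhds
  have hℓ := hℓe.self_of_nhds
  have hexp : ∀ w, Complex.exp (-ℓ w) * Complex.exp (ℓ w) = 1 := fun w => by
    rw [← Complex.exp_add]; simp
  have h1 : (fun w => τ w I) =ᶠ[𝓝 z] fun w => ∑ l, -(wirtinger l (fun w => σ w (Fin.cons l I)) w +
      wirtinger l ℓ w * σ w (Fin.cons l I)) := by
    filter_upwards [hσe, hℓe, hτ] with w h2 h3 h4
    have := h4 I
    simp only [wirtinger_exp_mul h3 (h2 _)] at this
    rw [← Finset.mul_sum, ← mul_neg] at this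
    rw [mul_left_cancel₀ (Complex.exp_ne_zero _) this, Finset.sum_neg_distrib]
  have hs : ∀ l, ContDiffAt ℝ ∞ (wirtinger l (fun w => σ w (Fin.cons l I))) z := fun l =>
    contDiffAt_wirtinger l (hσ _)
  have hl : ∀ l, ContDiffAt ℝ ∞ (wirtinger l ℓ) z := fun l => contDiffAt_wirtinger l hℓ
  rw [wirtingerBar_congr k h1, wirtingerBar_sum _ _ fun l _ => ((hs l).add ((hl l).mul (hσ _))).neg,
    ← Finset.sum_sub_distrib]
  refine Finset.sum_congr rfl fun l _ => ?_
  rw [wirtingerBar_neg, wirtingerBar_add _ (hs l) ((hl l).mul (hσ _)),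
    wirtingerBar_mul _ (hl l) (hσ _), ← wirtinger_wirtingerBar_comm _ _ (hσ _),
    ← wirtinger_wirtingerBar_comm _ _ hℓ, hricci, wirtinger_exp_mul hℓ
      (contDiffAt_wirtingerBar k (hσ _)), ← mul_assoc, hexp]
  ring

/-- The weighted divergence of `bochnerField`. -/
theorem weighted_divergence_bochnerField (hℓ : ContDiffAt ℝ ∞ ℓ z)
    (hG : ∀ i j, ContDiffAt ℝ ∞ (fun w => G w i j) z)
    (hK : ∀ i j k, wirtinger i (fun w => G w j k) z = wirtinger j (fun w => G w i k) z)
    (hσ : ∀ I, ContDiffAt ℝ ∞ (fun w => σ w I) z) (hanti : ∀ᶠ w in 𝓝 z, IsAntisymm (σ w)) :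
    ∑ l, Complex.exp (-ℓ z) *
        wirtinger l (fun w => Complex.exp (ℓ w) * bochnerField G σ l w) z =
      (∑ l, ∑ j, ∑ I : Fin q → Fin m, (Complex.exp (-ℓ z) * wirtinger l (fun w =>
        Complex.exp (ℓ w) * wirtingerBar j (fun w => σ w (Fin.cons l I)) w) z) *
          (tensorPow (G z) *ᵥ fun J => conj (σ z (Fin.cons j J))) I) +
      ∑ l, ∑ j, ∑ I : Fin q → Fin m, wirtingerBar j (fun w => σ w (Fin.cons l I)) z *
        (tensorPow (G z) *ᵥ fun J => conj (wirtingerBar l (fun w => σ w (Fin.cons j J)) z)) I := by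
  have hX : ∀ (l j : Fin m) (I : Fin q → Fin m), ContDiffAt ℝ ∞ (fun w => Complex.exp (ℓ w) *
      wirtingerBar j (fun w => σ w (Fin.cons l I)) w) z := fun l j I =>
    hℓ.cexp.mul (contDiffAt_wirtingerBar j (hσ _))
  have hC : ∀ (j : Fin m) (I : Fin q → Fin m), ContDiffAt ℝ ∞ (fun w =>
      (tensorPow (G w) *ᵥ fun J => conj (σ w (Fin.cons j J))) I) z := fun j I =>
    contDiffAt_tensorPow_mulVec hG (fun J => (hσ _).conj_complex) I
  have hexp : Complex.exp (-ℓ z) * Complex.exp (ℓ z) = 1 := by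
    rw [← Complex.exp_add]; simp
  have h1 : ∀ l, Complex.exp (-ℓ z) *
      wirtinger l (fun w => Complex.exp (ℓ w) * bochnerField G σ l w) z =
      ∑ j, ∑ I : Fin q → Fin m, ((Complex.exp (-ℓ z) * wirtinger l (fun w =>
        Complex.exp (ℓ w) * wirtingerBar j (fun w => σ w (Fin.cons l I)) w) z) *
          (tensorPow (G z) *ᵥ fun J => conj (σ z (Fin.cons j J))) I +
        wirtingerBar j (fun w => σ w (Fin.cons l I)) z *
        wirtinger l (fun w => (tensorPow (G w) *ᵥ fun J => conj (σ w (Fin.cons j J))) I) z) := by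
    intro l
    simp only [bochnerField, Finset.mul_sum, ← mul_assoc]
    rw [wirtinger_sum _ _ fun j _ => ContDiffAt.sum fun I _ => (hX l j I).mul (hC j I),
      Finset.mul_sum]
    refine Finset.sum_congr rfl fun j _ => ?_
    rw [wirtinger_sum _ _ fun I _ => (hX l j I).mul (hC j I), Finset.mul_sum]
    refine Finset.sum_congr rfl fun I _ => ?_
    rw [wirtinger_mul _ (hX l j I) (hC j I)]
    linear_combination (wirtingerBar j (fun w => σ w (Fin.cons l I)) z * wirtinger l (fun w =>
      (tensorPow (G w) *ᵥ fun J => conj (σ w (Fin.cons j J))) I) z) * hexp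
  simp only [h1, Finset.sum_add_distrib]
  congr 1
  rw [Finset.sum_comm]
  conv_rhs => rw [Finset.sum_comm]
  refine Finset.sum_congr rfl fun j _ => ?_
  -- For fixed `j`, the derivative of the lowered conjugate of σ is contracted over (l, I) with the
  -- antisymmetric tensor ∂̄_jσ, so the Kähler condition removes the derivatives of `G`.
  have h2 := sum_wirtinger_tensorPow_mul (u := fun w J => conj (σ w (Fin.cons j J))) hG hK
    (fun I => (hσ _).conj_complex) (IsAntisymm.wirtingerBar hanti j)
  rw [sum_cons, sum_cons] at h2
  simp only [Fin.cons_zero, Fin.tail_cons, wirtinger_conj] at h2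
  simpa only [mul_comm (wirtingerBar j _ z)] using h2

/-- The Bochner formula for a closed `(0,q+1)`-form `α` with `∂̄∂̄_f^* α = λ α`, in terms of the
multivector field `σ = α^♯`. -/
theorem bochner_formula (hℓe : ∀ᶠ w in 𝓝 z, ContDiffAt ℝ ∞ ℓ w)
    (hG : ∀ i j, ContDiffAt ℝ ∞ (fun w => G w i j) z)
    (hGH : G z * (H z)ᵀ = 1) (hH : ∀ i j, conj (H z i j) = H z j i)
    (hK : ∀ i j k, wirtinger i (fun w => G w j k) z = wirtinger j (fun w => G w i k) z)
    (hK' : ∀ i j k, wirtingerBar i (fun w => G w k j) z = wirtingerBar j (fun w => G w k i) z)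
    (hricci : ∀ l k, wirtinger l (wirtingerBar k ℓ) z = -G z l k)
    (hσe : ∀ᶠ w in 𝓝 z, ∀ I, ContDiffAt ℝ ∞ (fun w => σ w I) w) (hanti : ∀ᶠ w in 𝓝 z, IsAntisymm (σ w))
    (hτs : ∀ I, ContDiffAt ℝ ∞ (fun w => τ w I) z)
    (hτ : ∀ᶠ w in 𝓝 z, ∀ I, Complex.exp (ℓ w) * τ w I =
      -∑ l, wirtinger l (fun w => Complex.exp (ℓ w) * σ w (Fin.cons l I)) w)
    (heigen : ∀ K : Fin (q + 1) → Fin m, ∑ b : Fin (q + 1), (-1 : ℂ) ^ (b : ℕ) *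
      wirtingerBar (K b) (fun w => (tensorPow (G w)ᵀ *ᵥ τ w) fun k => K (b.succAbove k)) z =
        lam * (tensorPow (G z)ᵀ *ᵥ σ z) K)
    (hclosed : ∀ K : Fin (q + 2) → Fin m, ∑ b : Fin (q + 2), (-1 : ℂ) ^ (b : ℕ) *
      wirtingerBar (K b) (fun w => (tensorPow (G w)ᵀ *ᵥ σ w) fun k => K (b.succAbove k)) z = 0) :
    (q + 1) * ∑ l, Complex.exp (-ℓ z) *
        wirtinger l (fun w => Complex.exp (ℓ w) * bochnerField G σ l w) z =
      (q + 1 - lam) * ∑ K, (tensorPow (G z)ᵀ *ᵥ σ z) K * conj (σ z K) + dbarNormSq G H σ z := by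
  have hσ := hσe.self_of_nhds
  have hℓ := hℓe.self_of_nhds
  have hGt : ∀ i j, ContDiffAt ℝ ∞ (fun w => (G w)ᵀ i j) z := fun i j => hG j i
  have hσz : IsAntisymm (σ z) := hanti.self_of_nhds
  -- the closedness of the form
  have h1 : dbarNormSq G H σ z = (q + 1) * ∑ l, ∑ j, ∑ I : Fin q → Fin m,
      wirtingerBar j (fun w => σ w (Fin.cons l I)) z *
        (tensorPow (G z) *ᵥ fun J => conj (wirtingerBar l (fun w => σ w (Fin.cons j J)) z)) I := by
    refine norm_eq_of_closed (X := fun j I => wirtingerBar j (fun w => σ w I) z) hGH hH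
      (fun j => IsAntisymm.wirtingerBar hanti j) fun Y hY => ?_
    rw [← sum_wirtingerBar_tensorPow_mul (P := fun w => (G w)ᵀ) hGt (fun i j k => hK' i j k) hσ hY]
    have h2 := sum_alternate_mul (F := fun j J =>
      wirtingerBar j (fun w => (tensorPow (G w)ᵀ *ᵥ σ w) J) z) hY
    simp only [hclosed, zero_mul, Finset.sum_const_zero] at h2
    refine (mul_eq_zero.1 h2.symm).resolve_left ?_
    exact_mod_cast Nat.succ_ne_zero (q + 1)
  -- the eigenvalue equation
  have h3 : lam * ∑ K, (tensorPow (G z)ᵀ *ᵥ σ z) K * conj (σ z K) =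
      (q + 1) * ∑ K : Fin (q + 1) → Fin m, (tensorPow (G z)ᵀ *ᵥ fun I =>
        wirtingerBar (K 0) (fun w => τ w I) z) (Fin.tail K) * conj (σ z K) := by
    rw [← sum_wirtingerBar_tensorPow_mul (P := fun w => (G w)ᵀ) hGt (fun i j k => hK' i j k) hτs
      hσz.conj, ← sum_alternate_mul (F := fun j J =>
        wirtingerBar j (fun w => (tensorPow (G w)ᵀ *ᵥ τ w) J) z) hσz.conj]
    simp only [heigen, Finset.mul_sum, mul_assoc]
  -- Substituting the commutation formula for ∂̄τ: its curvature term is σ with the first index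
  -- lowered, so it completes to |σ|². The rest is the first half of the divergence of
  -- `bochnerField`.
  have h4 : ∑ K : Fin (q + 1) → Fin m, (tensorPow (G z)ᵀ *ᵥ fun I =>
        wirtingerBar (K 0) (fun w => τ w I) z) (Fin.tail K) * conj (σ z K) =
      ∑ K, (tensorPow (G z)ᵀ *ᵥ σ z) K * conj (σ z K) -
      ∑ l, ∑ j, ∑ I : Fin q → Fin m, (Complex.exp (-ℓ z) * wirtinger l (fun w =>
        Complex.exp (ℓ w) * wirtingerBar j (fun w => σ w (Fin.cons l I)) w) z) *
          (tensorPow (G z) *ᵥ fun J => conj (σ z (Fin.cons j J))) I := by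
    simp only [sum_cons, Fin.cons_zero, Fin.tail_cons,
      wirtingerBar_weighted_divergence hℓe hricci hσe hτ, tensorPow_mulVec_cons]
    conv_rhs => rw [Finset.sum_comm (s := Finset.univ (α := Fin m)) (t := Finset.univ (α := Fin m))]
    rw [← Finset.sum_sub_distrib]
    refine Finset.sum_congr rfl fun j _ => ?_
    simp only [tensorPow_transpose, mulVec_transpose_pairing, Matrix.transpose_apply,
      sub_mul, Finset.sum_sub_distrib, Finset.sum_mul, mul_assoc]
    congr 1
    · conv_rhs => rw [Finset.sum_comm]
      rw [Finset.sum_comm]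
      refine Finset.sum_congr rfl fun l _ => ?_
      rw [← Finset.mul_sum, ← Finset.mul_sum, mulVec_transpose_pairing]
    · rw [Finset.sum_comm]
  rw [weighted_divergence_bochnerField hℓ hG hK hσ hanti, h1]
  rw [h4] at h3
  linear_combination h3

end Bochner

/-! ### Conjugate-linear alternating maps -/

section ConjLinear

variable {E : Type*} [AddCommGroup E] [TopologicalSpace E] [Module ℂ E] {m q : ℕ}

/-- A real-multilinear alternating map that is conjugate-linear in each argument. -/
def IsConjLinear (α : E [⋀^Fin q]→L[ℝ] ℂ) : Prop :=
  ∀ (v : Fin q → E) (k : Fin q) (c : ℂ), α (Function.update v k (c • v k)) = conj c * α v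

/-- The complex-multilinear map conjugate to a conjugate-linear alternating map. -/
def IsConjLinear.conjMultilinear {α : E [⋀^Fin q]→L[ℝ] ℂ} (hα : IsConjLinear α) :
    MultilinearMap ℂ (fun _ : Fin q => E) ℂ where
  toFun v := conj (α v)
  map_update_add' v k x y := by
    have := α.toAlternatingMap.toMultilinearMap.map_update_add v k x y
    rw [← map_add]
    exact congrArg conj this
  map_update_smul' {hd} v k c x := by
    have := hα (Function.update v k x) k c
    obtain rfl : hd = instDecidableEqFin q := Subsingleton.elim _ _
    simp only [Function.update_self, Function.update_idem] at this
    rw [this]; simp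

theorem IsConjLinear.conjMultilinear_apply {α : E [⋀^Fin q]→L[ℝ] ℂ} (hα : IsConjLinear α)
    (v : Fin q → E) : hα.conjMultilinear v = conj (α v) := rfl

/-- After conjugation the map is complex-multilinear, so the multilinear expansion applies. -/
theorem IsConjLinear.map_sum_smul {α : E [⋀^Fin q]→L[ℝ] ℂ} (hα : IsConjLinear α)
    (c : Fin q → Fin m → ℂ) (f : Fin m → E) :
    α (fun k => ∑ i, c k i • f i) =
      ∑ K : Fin q → Fin m, (∏ k, conj (c k (K k))) * α fun k => f (K k) := by
  apply (starRingEnd ℂ).injective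
  rw [← hα.conjMultilinear_apply, MultilinearMap.map_sum, map_sum]
  refine Finset.sum_congr rfl fun K _ => ?_
  rw [hα.conjMultilinear.map_smul_univ (fun k => c k (K k)) fun k => f (K k),
    hα.conjMultilinear_apply]
  simp

theorem isAntisymm_apply (α : E [⋀^Fin q]→L[ℝ] ℂ) (f : Fin m → E) :
    IsAntisymm fun J : Fin q → Fin m => α fun k => f (J k) := fun π J => by
  have := α.toAlternatingMap.map_perm (fun k => f (J k)) π
  refine Eq.trans this ?_
  rcases Int.units_eq_one_or (Equiv.Perm.sign π) with h | h <;> simp [h]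

theorem IsConjLinear.compContinuousLinearMap {F : Type*} [AddCommGroup F] [TopologicalSpace F]
    [Module ℂ F] {α : E [⋀^Fin q]→L[ℝ] ℂ} (hα : IsConjLinear α) (L : F →L[ℂ] E) :
    IsConjLinear (α.compContinuousLinearMap (L.restrictScalars ℝ)) := fun v k c => by
  simp only [ContinuousAlternatingMap.compContinuousLinearMap_apply,
    ContinuousLinearMap.coe_restrictScalars']
  have : (L ∘ Function.update v k (c • v k)) =
      Function.update (L ∘ v) k (c • (L ∘ v) k) := by
    rw [Function.comp_update]
    simp
  rw [this, hα]

theorem IsConjLinear.ext_basis {α β : (Fin m → ℂ) [⋀^Fin q]→L[ℝ] ℂ} (hα : IsConjLinear α)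
    (hβ : IsConjLinear β)
    (h : ∀ J : Fin q → Fin m, (α fun k => Pi.single (J k) 1) = β fun k => Pi.single (J k) 1) :
    α = β := by
  ext v
  have hv : v = fun k => ∑ i, v k i • (Pi.single i 1 : Fin m → ℂ) := by
    funext k
    conv_lhs => rw [← Finset.univ_sum_single (v k)]
    refine Finset.sum_congr rfl fun i _ => ?_
    rw [← Pi.single_smul]; simp
  rw [hv, hα.map_sum_smul, hβ.map_sum_smul]
  simp only [h]

end ConjLinear

/-! ### Coordinate changes -/

section Charts

variable {m q : ℕ} {M : Type*} [TopologicalSpace M] [ChartedSpace (Fin m → ℂ) M]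
  [IsManifold 𝓘(ℂ, Fin m → ℂ) ω M]
  {e e' : OpenPartialHomeomorph M (Fin m → ℂ)} {x : M}

/-- The differential of a chart. -/
def chartDeriv (e : OpenPartialHomeomorph M (Fin m → ℂ)) (x : M) :
    TangentSpace 𝓘(ℂ, Fin m → ℂ) x →L[ℂ] (Fin m → ℂ) :=
  mfderiv 𝓘(ℂ, Fin m → ℂ) 𝓘(ℂ, Fin m → ℂ) e x

theorem mdifferentiable_chart (he : e ∈ atlas (Fin m → ℂ) M) :
    e.MDifferentiable 𝓘(ℂ, Fin m → ℂ) 𝓘(ℂ, Fin m → ℂ) :=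
  haveI : IsManifold 𝓘(ℂ, Fin m → ℂ) 1 M := .of_le (n := ω) le_top
  mdifferentiable_of_mem_atlas he

/-- The differential of a chart as a linear equivalence. -/
def chartDerivEquiv (he : e ∈ atlas (Fin m → ℂ) M) (hx : x ∈ e.source) :
    TangentSpace 𝓘(ℂ, Fin m → ℂ) x ≃L[ℂ] (Fin m → ℂ) :=
  ContinuousLinearEquiv.equivOfInverse (chartDeriv e x)
    (show (Fin m → ℂ) →L[ℂ] TangentSpace 𝓘(ℂ, Fin m → ℂ) x from
      ((mdifferentiable_chart he).mfderiv hx).symm.toContinuousLinearMap)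
    ((mdifferentiable_chart he).mfderiv hx).symm_apply_apply
    ((mdifferentiable_chart he).mfderiv hx).apply_symm_apply

theorem coordInv_eq (he : e ∈ atlas (Fin m → ℂ) M) (hx : x ∈ e.source) :
    coordInv e x = ((chartDerivEquiv he hx).symm : (Fin m → ℂ) →L[ℂ] _) := by
  have : chartDeriv e x = (chartDerivEquiv he hx : _ →L[ℂ] (Fin m → ℂ)) := rfl
  change ContinuousLinearMap.inverse (chartDeriv e x) = _
  rw [this]
  exact ContinuousLinearMap.inverse_equiv _

theorem chartDeriv_coordInv (he : e ∈ atlas (Fin m → ℂ) M) (hx : x ∈ e.source) (v : Fin m → ℂ) :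
    chartDeriv e x (coordInv e x v) = v := by
  rw [coordInv_eq he hx]
  exact (chartDerivEquiv he hx).apply_symm_apply v

theorem coordInv_chartDeriv (he : e ∈ atlas (Fin m → ℂ) M) (hx : x ∈ e.source)
    (v : TangentSpace 𝓘(ℂ, Fin m → ℂ) x) : coordInv e x (chartDeriv e x v) = v := by
  rw [coordInv_eq he hx]
  exact (chartDerivEquiv he hx).symm_apply_apply v

theorem contDiffOn_transition (he : e ∈ atlas (Fin m → ℂ) M) (he' : e' ∈ atlas (Fin m → ℂ) M) :
    ContDiffOn ℂ ω (fun z => e' (e.symm z)) (e.target ∩ e.symm ⁻¹' e'.source) := by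
  rw [← contMDiffOn_iff_contDiffOn]
  have h1 := contMDiffOn_of_mem_maximalAtlas (I := 𝓘(ℂ, Fin m → ℂ)) (n := ω)
    (IsManifold.subset_maximalAtlas he')
  have h2 := contMDiffOn_symm_of_mem_maximalAtlas (I := 𝓘(ℂ, Fin m → ℂ)) (n := ω)
    (IsManifold.subset_maximalAtlas he)
  exact h1.comp (h2.mono Set.inter_subset_left) fun z hz => hz.2

theorem isOpen_overlap (e e' : OpenPartialHomeomorph M (Fin m → ℂ)) :
    IsOpen (e.target ∩ e.symm ⁻¹' e'.source) :=
  e.isOpen_inter_preimage_symm e'.open_source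

theorem contDiffAt_transition (he : e ∈ atlas (Fin m → ℂ) M) (he' : e' ∈ atlas (Fin m → ℂ) M)
    {z : Fin m → ℂ} (hz : z ∈ e.target ∩ e.symm ⁻¹' e'.source) :
    ContDiffAt ℂ ω (fun z => e' (e.symm z)) z :=
  (contDiffOn_transition he he').contDiffAt ((isOpen_overlap e e').mem_nhds hz)

theorem differentiableAt_transition (he : e ∈ atlas (Fin m → ℂ) M)
    (he' : e' ∈ atlas (Fin m → ℂ) M) {z : Fin m → ℂ}
    (hz : z ∈ e.target ∩ e.symm ⁻¹' e'.source) :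
    DifferentiableAt ℂ (fun z => e' (e.symm z)) z :=
  (contDiffAt_transition he he' hz).differentiableAt (by simp)

theorem chartDeriv_comp_coordInv (he : e ∈ atlas (Fin m → ℂ) M) (he' : e' ∈ atlas (Fin m → ℂ) M)
    (hx : x ∈ e.source) (hx' : x ∈ e'.source) (v : Fin m → ℂ) :
    chartDeriv e' x (coordInv e x v) = fderiv ℂ (fun z => e' (e.symm z)) (e x) v := by
  have hz : e x ∈ e.target ∩ e.symm ⁻¹' e'.source := ⟨e.map_source hx, by simpa [hx] using hx'⟩
  have hd := differentiableAt_transition he he' hz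
  have h1 : HasMFDerivAt 𝓘(ℂ, Fin m → ℂ) 𝓘(ℂ, Fin m → ℂ) (fun y => e' (e.symm (e y))) x
      ((fderiv ℂ (fun z => e' (e.symm z)) (e x)).comp (chartDeriv e x)) :=
    HasMFDerivAt.comp (g := fun z => e' (e.symm z)) x hd.hasFDerivAt.hasMFDerivAt
      ((mdifferentiable_chart he).mdifferentiableAt hx).hasMFDerivAt
  have h2 : HasMFDerivAt 𝓘(ℂ, Fin m → ℂ) 𝓘(ℂ, Fin m → ℂ) e' x
      ((fderiv ℂ (fun z => e' (e.symm z)) (e x)).comp (chartDeriv e x)) := by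
    refine h1.congr_of_eventuallyEq ?_
    filter_upwards [e.open_source.mem_nhds hx] with y hy
    rw [e.left_inv hy]
  have h3 : chartDeriv e' x = (fderiv ℂ (fun z => e' (e.symm z)) (e x)).comp (chartDeriv e x) :=
    h2.mfderiv
  rw [h3, ContinuousLinearMap.comp_apply, chartDeriv_coordInv he hx]

theorem coordInv_eq_coordInv_fderiv (he : e ∈ atlas (Fin m → ℂ) M)
    (he' : e' ∈ atlas (Fin m → ℂ) M) (hx : x ∈ e.source) (hx' : x ∈ e'.source) (v : Fin m → ℂ) :
    coordInv e x v = coordInv e' x (fderiv ℂ (fun z => e' (e.symm z)) (e x) v) := by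
  rw [← chartDeriv_comp_coordInv he he' hx hx', coordInv_chartDeriv he' hx']

/-- The Jacobian matrix `∂w^i/∂z^j` of the coordinate change from `e` to `e'`. -/
def jacobian (e e' : OpenPartialHomeomorph M (Fin m → ℂ)) (z : Fin m → ℂ) :
    Matrix (Fin m) (Fin m) ℂ :=
  Matrix.of fun i j => fderiv ℂ (fun z => e' (e.symm z)) z (Pi.single j 1) i

theorem coordInv_sum (e : OpenPartialHomeomorph M (Fin m → ℂ)) (x : M) (v : Fin m → ℂ) :
    coordInv e x v = ∑ i, v i • frame e x i := by
  conv_lhs => rw [← Finset.univ_sum_single v]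
  rw [map_sum]
  refine Finset.sum_congr rfl fun i _ => ?_
  rw [frame, ← map_smul, ← Pi.single_smul]; simp

theorem frame_eq_sum (he : e ∈ atlas (Fin m → ℂ) M) (he' : e' ∈ atlas (Fin m → ℂ) M)
    (hx : x ∈ e.source) (hx' : x ∈ e'.source) (j : Fin m) :
    frame e x j = ∑ i, jacobian e e' (e x) i j • frame e' x i := by
  rw [frame, coordInv_eq_coordInv_fderiv he he' hx hx', coordInv_sum]
  rfl

theorem sum_smul_frame_injective (he : e ∈ atlas (Fin m → ℂ) M) (hx : x ∈ e.source)
    {v w : Fin m → ℂ} (h : ∑ i, v i • frame e x i = ∑ i, w i • frame e x i) : v = w := by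
  rw [← coordInv_sum, ← coordInv_sum] at h
  rw [← chartDeriv_coordInv he hx v, h, chartDeriv_coordInv he hx]

theorem jacobian_mul_jacobian (he : e ∈ atlas (Fin m → ℂ) M) (he' : e' ∈ atlas (Fin m → ℂ) M)
    (hx : x ∈ e.source) (hx' : x ∈ e'.source) :
    jacobian e e' (e x) * jacobian e' e (e' x) = 1 := by
  ext i j
  have h := frame_eq_sum he' he hx' hx j
  simp only [frame_eq_sum he he' hx hx', Finset.smul_sum, smul_smul] at h
  rw [Finset.sum_comm] at h
  simp only [← Finset.sum_smul] at h
  have h2 : frame e' x j = ∑ i, (Pi.single j 1 : Fin m → ℂ) i • frame e' x i := by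
    rw [← coordInv_sum]; rfl
  rw [h2] at h
  have h3 := congrFun (sum_smul_frame_injective he' hx' h) i
  rw [Matrix.mul_apply, Matrix.one_apply]
  rw [Pi.single_apply] at h3
  rw [h3]
  exact Finset.sum_congr rfl fun k _ => mul_comm _ _

/-! ### Transformation of components -/

theorem component_eq_mulVec {α : FormField m M q} (hα : IsConjLinear (α x))
    (he : e ∈ atlas (Fin m → ℂ) M) (he' : e' ∈ atlas (Fin m → ℂ) M)
    (hx : x ∈ e.source) (hx' : x ∈ e'.source) :
    component e α x = tensorPow (jacobian e e' (e x))ᴴ *ᵥ component e' α x := by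
  funext J
  simp only [component, frame_eq_sum he he' hx hx', hα.map_sum_smul]
  simp only [Matrix.mulVec, dotProduct, tensorPow_apply, Matrix.conjTranspose_apply]
  rfl

theorem isAntisymm_component (e : OpenPartialHomeomorph M (Fin m → ℂ)) (α : FormField m M q)
    (x : M) : IsAntisymm (component e α x) :=
  isAntisymm_apply (α x) (frame e x)

/-! ### The metric, its inverse and raised components under coordinate changes -/

variable (g : HermitianMetric m M)

theorem metricMatrix_eq (he : e ∈ atlas (Fin m → ℂ) M) (he' : e' ∈ atlas (Fin m → ℂ) M)
    (hx : x ∈ e.source) (hx' : x ∈ e'.source) :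
    metricMatrix g e x = (jacobian e e' (e x))ᵀ * metricMatrix g e' x *
      (jacobian e e' (e x)).map conj := by
  ext i j
  simp only [metricMatrix, Matrix.of_apply, frame_eq_sum he he' hx hx', map_sum, map_smul,
    LinearMap.sum_apply, LinearMap.smul_apply, LinearMap.map_smulₛₗ, smul_eq_mul,
    Matrix.mul_apply, Matrix.transpose_apply, Matrix.map_apply, Finset.sum_mul]
  refine Finset.sum_congr rfl fun l _ => ?_
  rw [Finset.mul_sum]
  exact Finset.sum_congr rfl fun k _ => by ring

theorem metricMatrix_conj (e : OpenPartialHomeomorph M (Fin m → ℂ)) (x : M) (i j : Fin m) :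
    conj (metricMatrix g e x i j) = metricMatrix g e x j i :=
  (g.conj_symm x (frame e x j) (frame e x i)).symm

theorem posDef_metricMatrix (he : e ∈ atlas (Fin m → ℂ) M) (hx : x ∈ e.source) :
    (metricMatrix g e x).PosDef := by
  -- The metric is linear in its first argument, so g(v, v̄) is the quadratic form v* Gᵀ v, with a
  -- transpose.
  rw [← Matrix.PosDef.transpose_iff]
  refine Matrix.PosDef.of_dotProduct_mulVec_pos ?_ fun v hv => ?_
  · ext i j
    exact metricMatrix_conj g e x i j
  · have h : star v ⬝ᵥ ((metricMatrix g e x)ᵀ *ᵥ v) =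
        g.val x (coordInv e x v) (coordInv e x v) := by
      simp only [coordInv_sum, map_sum, map_smul, LinearMap.sum_apply, LinearMap.smul_apply,
        LinearMap.map_smulₛₗ, smul_eq_mul, dotProduct, Matrix.mulVec, Finset.mul_sum]
      refine Finset.sum_congr rfl fun l _ => Finset.sum_congr rfl fun k _ => ?_
      simp only [metricMatrix, Matrix.transpose_apply, Matrix.of_apply, Pi.star_apply,
        RCLike.star_def]
      ring
    have hne : coordInv e x v ≠ 0 := fun h0 => hv <| by
      rw [← chartDeriv_coordInv he hx v, h0, map_zero]
    rw [h, Complex.lt_def]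
    refine ⟨g.pos x _ hne, ?_⟩
    have := congrArg Complex.im (g.conj_symm x (coordInv e x v) (coordInv e x v))
    simp only [Complex.conj_im] at this
    simp only [Complex.zero_im]
    linarith

theorem isUnit_det_metricMatrix (he : e ∈ atlas (Fin m → ℂ) M) (hx : x ∈ e.source) :
    IsUnit (metricMatrix g e x).det :=
  (Matrix.isUnit_iff_isUnit_det _).1 (posDef_metricMatrix g he hx).isUnit

/-- The inverse metric `(g^{i j̄})` as a matrix. -/
def invMatrix (e : OpenPartialHomeomorph M (Fin m → ℂ)) (x : M) : Matrix (Fin m) (Fin m) ℂ :=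
  ((metricMatrix g e x)⁻¹)ᵀ

theorem metricMatrix_mul_invMatrix_transpose (he : e ∈ atlas (Fin m → ℂ) M) (hx : x ∈ e.source) :
    metricMatrix g e x * (invMatrix g e x)ᵀ = 1 := by
  rw [invMatrix, Matrix.transpose_transpose,
    Matrix.mul_nonsing_inv _ (isUnit_det_metricMatrix g he hx)]

theorem metricMatrix_transpose_mul_invMatrix (he : e ∈ atlas (Fin m → ℂ) M) (hx : x ∈ e.source) :
    (metricMatrix g e x)ᵀ * invMatrix g e x = 1 := by
  rw [invMatrix, ← Matrix.transpose_mul,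
    Matrix.nonsing_inv_mul _ (isUnit_det_metricMatrix g he hx), Matrix.transpose_one]

theorem invMatrix_mul_metricMatrix_transpose (he : e ∈ atlas (Fin m → ℂ) M) (hx : x ∈ e.source) :
    invMatrix g e x * (metricMatrix g e x)ᵀ = 1 := by
  rw [invMatrix, ← Matrix.transpose_mul,
    Matrix.mul_nonsing_inv _ (isUnit_det_metricMatrix g he hx), Matrix.transpose_one]

theorem invMatrix_conj (e : OpenPartialHomeomorph M (Fin m → ℂ)) (x : M) (i j : Fin m) :
    conj (invMatrix g e x i j) = invMatrix g e x j i := by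
  have h : (metricMatrix g e x)ᴴ = metricMatrix g e x := by
    ext i j
    exact metricMatrix_conj g e x j i
  have h2 : ((metricMatrix g e x)⁻¹)ᴴ = (metricMatrix g e x)⁻¹ := by
    rw [Matrix.conjTranspose_nonsing_inv, h]
  have h3 := congrFun (congrFun h2 i) j
  simpa [invMatrix, Matrix.conjTranspose_apply] using h3

/-- Inverting the congruence relating the two metric matrices: the right-hand side is checked to be
a right inverse of the transposed metric in `e'`, and inverses are unique. -/
theorem invMatrix_eq (he : e ∈ atlas (Fin m → ℂ) M) (he' : e' ∈ atlas (Fin m → ℂ) M)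
    (hx : x ∈ e.source) (hx' : x ∈ e'.source) :
    invMatrix g e' x = jacobian e e' (e x) * invMatrix g e x * (jacobian e e' (e x))ᴴ := by
  set A := jacobian e e' (e x)
  set B := jacobian e' e (e' x)
  have hAB : A * B = 1 := jacobian_mul_jacobian he he' hx hx'
  have hBA : B * A = 1 := jacobian_mul_jacobian he' he hx' hx
  have h1 := metricMatrix_eq g he he' hx hx'
  have h2 : (metricMatrix g e x)ᵀ = Aᴴ * (metricMatrix g e' x)ᵀ * A := by
    rw [h1, Matrix.transpose_mul, Matrix.transpose_mul, Matrix.transpose_transpose, ← mul_assoc]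
    rfl
  have h3 := metricMatrix_transpose_mul_invMatrix g he hx
  have h4 := invMatrix_mul_metricMatrix_transpose g he' hx'
  rw [h2] at h3
  have hAB' : Bᴴ * Aᴴ = 1 := by rw [← Matrix.conjTranspose_mul, hAB, Matrix.conjTranspose_one]
  have h5 : (metricMatrix g e' x)ᵀ * (A * invMatrix g e x * Aᴴ) = 1 := by
    calc (metricMatrix g e' x)ᵀ * (A * invMatrix g e x * Aᴴ)
        = (Bᴴ * Aᴴ) * (metricMatrix g e' x)ᵀ * (A * invMatrix g e x * Aᴴ) := by
          rw [hAB', one_mul]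
      _ = Bᴴ * (Aᴴ * (metricMatrix g e' x)ᵀ * A * invMatrix g e x) * Aᴴ := by
          simp only [mul_assoc]
      _ = 1 := by rw [h3, mul_one, hAB']
  calc invMatrix g e' x = invMatrix g e' x * ((metricMatrix g e' x)ᵀ * (A * invMatrix g e x * Aᴴ)) := by
        rw [h5, mul_one]
    _ = A * invMatrix g e x * Aᴴ := by rw [← mul_assoc, h4, one_mul]

/-- The components of the multivector `α^♯` in the chart `e`. -/
def raised (e : OpenPartialHomeomorph M (Fin m → ℂ)) (α : FormField m M q) (x : M) :
    (Fin q → Fin m) → ℂ :=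
  tensorPow (invMatrix g e x) *ᵥ component e α x

theorem isAntisymm_raised (e : OpenPartialHomeomorph M (Fin m → ℂ)) (α : FormField m M q)
    (x : M) : IsAntisymm (raised g e α x) :=
  (isAntisymm_component e α x).mulVec _

theorem lower_raised (he : e ∈ atlas (Fin m → ℂ) M) (hx : x ∈ e.source) (α : FormField m M q) :
    tensorPow (metricMatrix g e x)ᵀ *ᵥ raised g e α x = component e α x := by
  rw [raised, Matrix.mulVec_mulVec, ← tensorPow_mul, metricMatrix_transpose_mul_invMatrix g he hx,
    tensorPow_one, Matrix.one_mulVec]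

theorem raised_eq_mulVec {α : FormField m M q} (hα : IsConjLinear (α x))
    (he : e ∈ atlas (Fin m → ℂ) M) (he' : e' ∈ atlas (Fin m → ℂ) M)
    (hx : x ∈ e.source) (hx' : x ∈ e'.source) :
    raised g e' α x = tensorPow (jacobian e e' (e x)) *ᵥ raised g e α x := by
  rw [raised, raised, invMatrix_eq g he he' hx hx', component_eq_mulVec hα he he' hx hx',
    Matrix.mulVec_mulVec, tensorPow_mul, tensorPow_mul, Matrix.mulVec_mulVec, ← Matrix.mulVec_mulVec,
    Matrix.mulVec_mulVec]

/-- Raised components transform by the Jacobian and conjugated lower components by its transpose in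
the opposite direction, so the pairing is invariant. Hence `formInner`, defined in a preferred
chart, may be computed in any chart. -/
theorem sum_raised_mul_conj_component {α β : FormField m M q} (hα : IsConjLinear (α x))
    (hβ : IsConjLinear (β x)) (he : e ∈ atlas (Fin m → ℂ) M) (he' : e' ∈ atlas (Fin m → ℂ) M)
    (hx : x ∈ e.source) (hx' : x ∈ e'.source) :
    ∑ I, raised g e α x I * conj (component e β x I) =
      ∑ I, raised g e' α x I * conj (component e' β x I) := by
  rw [raised_eq_mulVec g hα he he' hx hx', component_eq_mulVec hβ he he' hx hx']
  have : ∀ I, conj ((tensorPow (jacobian e e' (e x))ᴴ *ᵥ component e' β x) I) =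
      ((tensorPow (jacobian e e' (e x)))ᵀ *ᵥ fun J => conj (component e' β x J)) I := by
    intro I
    simp [Matrix.mulVec, dotProduct, tensorPow_apply]
  simp only [this]
  simp only [mul_comm (raised g e α x _)]
  rw [mulVec_transpose_pairing]
  exact Finset.sum_congr rfl fun _ _ => mul_comm _ _

theorem formInner_eq {α β : FormField m M q} (hα : IsConjLinear (α x))
    (hβ : IsConjLinear (β x)) (he : e ∈ atlas (Fin m → ℂ) M) (hx : x ∈ e.source) :
    formInner g α β x =
      (1 / (q.factorial : ℂ)) * ∑ I, raised g e α x I * conj (component e β x I) := by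
  rw [sum_raised_mul_conj_component g hα hβ he (chart_mem_atlas (Fin m → ℂ) x) hx
    (mem_chart_source _ x)]
  simp only [formInner, raised, Matrix.mulVec, dotProduct, Finset.sum_mul]
  rfl

/-! ### Positivity -/

open scoped MatrixOrder Matrix.Norms.L2Operator in
-- Writing P = B*B makes the tensor power a Gram matrix, hence positive semidefinite; the tensor
-- power of P⁻¹ inverts it.
theorem posDef_tensorPow {P : Matrix (Fin m) (Fin m) ℂ} (hP : P.PosDef) :
    (tensorPow P : Matrix (Fin q → Fin m) (Fin q → Fin m) ℂ).PosDef := by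
  have hs : ∀ B : Matrix (Fin m) (Fin m) ℂ,
      (tensorPow Bᴴ : Matrix (Fin q → Fin m) (Fin q → Fin m) ℂ) = (tensorPow B)ᴴ := by
    intro B
    ext I J
    simp [tensorPow_apply]
  obtain ⟨B, rfl⟩ : ∃ B : Matrix (Fin m) (Fin m) ℂ, P = Bᴴ * B := by
    obtain ⟨B, hB⟩ := CStarAlgebra.nonneg_iff_eq_star_mul_self.mp hP.posSemidef.nonneg
    exact ⟨B, hB⟩
  have hpos : (tensorPow (Bᴴ * B) : Matrix (Fin q → Fin m) (Fin q → Fin m) ℂ).PosSemidef := by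
    rw [tensorPow_mul, hs]
    exact Matrix.posSemidef_conjTranspose_mul_self _
  rw [hpos.posDef_iff_isUnit]
  have hu := hP.isUnit
  rw [Matrix.isUnit_iff_isUnit_det] at hu
  refine (IsUnit.of_mul_eq_one (tensorPow (Bᴴ * B)⁻¹) ?_)
  rw [← tensorPow_mul, Matrix.mul_nonsing_inv _ hu, tensorPow_one]

theorem sum_tensorPow_mul_conj_nonneg {P : Matrix (Fin m) (Fin m) ℂ} (hP : P.PosDef)
    (u : (Fin q → Fin m) → ℂ) : 0 ≤ ∑ I, (tensorPow P *ᵥ u) I * conj (u I) := by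
  have h := (posDef_tensorPow (q := q) hP).posSemidef.dotProduct_mulVec_nonneg u
  simpa only [dotProduct, mul_comm, Pi.star_apply, RCLike.star_def] using h

theorem eq_zero_of_sum_tensorPow_mul_conj {P : Matrix (Fin m) (Fin m) ℂ} (hP : P.PosDef)
    {u : (Fin q → Fin m) → ℂ} (hu : ∑ I, (tensorPow P *ᵥ u) I * conj (u I) = 0) : u = 0 := by
  by_contra hne
  have h := (posDef_tensorPow (q := q) hP).dotProduct_mulVec_pos hne
  simp only [dotProduct, mul_comm, Pi.star_apply, RCLike.star_def] at h hu
  exact h.ne' hu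

/-- In `dbarNormSq` the derivative index is raised only in the conjugated factor. Inserting GᵀH = 1
raises it in the other factor too and displays a Hermitian form of a single tensor, so positivity
can be read off. -/
theorem dbarNormSq_eq {G H : (Fin m → ℂ) → Matrix (Fin m) (Fin m) ℂ}
    {σ : (Fin m → ℂ) → (Fin (q + 1) → Fin m) → ℂ} {w : Fin m → ℂ} (hGH : (G w)ᵀ * H w = 1) :
    dbarNormSq G H σ w = ∑ K : Fin (q + 2) → Fin m,
      (tensorPow (G w)ᵀ *ᵥ fun K => ∑ j, H w (K 0) j *
        wirtingerBar j (fun w => σ w (Fin.tail K)) w) K *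
      conj (∑ j, H w (K 0) j * wirtingerBar j (fun w => σ w (Fin.tail K)) w) := by
  have hδ : ∀ b j, ∑ k, (G w)ᵀ b k * H w k j = if b = j then 1 else 0 := by
    intro b j
    rw [← Matrix.mul_apply, hGH, Matrix.one_apply]
  refine Finset.sum_congr rfl fun K _ => ?_
  congr 1
  rw [← Fin.cons_self_tail K, tensorPow_mulVec_cons]
  simp only [Fin.cons_zero, Fin.tail_cons, Matrix.mulVec, dotProduct, Finset.mul_sum]
  rw [Finset.sum_comm]
  refine Finset.sum_congr rfl fun I _ => ?_
  rw [Finset.sum_comm]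
  have : ∀ j, ∑ k, (G w)ᵀ (K 0) k * (tensorPow (G w)ᵀ (Fin.tail K) I *
      (H w k j * wirtingerBar j (fun w => σ w I) w)) = (if K 0 = j then 1 else 0) *
        (tensorPow (G w)ᵀ (Fin.tail K) I * wirtingerBar j (fun w => σ w I) w) := by
    intro j
    rw [← hδ, Finset.sum_mul]
    exact Finset.sum_congr rfl fun k _ => by ring
  rw [Finset.sum_congr rfl fun j _ => this j]
  simp

theorem dbarNormSq_nonneg {G H : (Fin m → ℂ) → Matrix (Fin m) (Fin m) ℂ}
    {σ : (Fin m → ℂ) → (Fin (q + 1) → Fin m) → ℂ} {w : Fin m → ℂ} (hG : (G w).PosDef)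
    (hGH : (G w)ᵀ * H w = 1) : 0 ≤ dbarNormSq G H σ w := by
  rw [dbarNormSq_eq hGH]
  exact sum_tensorPow_mul_conj_nonneg hG.transpose _

theorem wirtingerBar_eq_zero_of_dbarNormSq {G H : (Fin m → ℂ) → Matrix (Fin m) (Fin m) ℂ}
    {σ : (Fin m → ℂ) → (Fin (q + 1) → Fin m) → ℂ} {w : Fin m → ℂ} (hG : (G w).PosDef)
    (hGH : (G w)ᵀ * H w = 1) (h : dbarNormSq G H σ w = 0) (j : Fin m) (I : Fin (q + 1) → Fin m) :
    wirtingerBar j (fun w => σ w I) w = 0 := by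
  rw [dbarNormSq_eq hGH] at h
  have h1 := eq_zero_of_sum_tensorPow_mul_conj hG.transpose h
  have h2 : H w *ᵥ (fun j => wirtingerBar j (fun w => σ w I) w) = 0 := by
    funext k
    simpa [Matrix.mulVec, dotProduct] using congrFun h1 (Fin.cons k I)
  have h3 := congrArg (fun v => (G w)ᵀ *ᵥ v) h2
  simp only [Matrix.mulVec_mulVec, hGH, Matrix.one_mulVec, Matrix.mulVec_zero] at h3
  exact congrFun h3 j

end Charts

/-! ### Forms with prescribed components -/

section Components

variable {m q : ℕ}

/-- The standard basis multivector `(e_{J_1}, …, e_{J_q})` of `ℂ^m`. -/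
def basisTuple (J : Fin q → Fin m) : Fin q → Fin m → ℂ := fun k => Pi.single (J k) 1

/-- The form `dz̄^{j₁} ∧ ⋯ ∧ dz̄^{j_q}`. -/
def dzBarWedge (J : Fin q → Fin m) : (Fin m → ℂ) [⋀^Fin q]→L[ℝ] ℂ :=
  ContinuousMultilinearMap.alternatization
    ((ContinuousMultilinearMap.mkPiAlgebra ℝ (Fin q) ℂ).compContinuousLinearMap
      fun k => dzBar (J k))

theorem dzBarWedge_apply (J : Fin q → Fin m) (v : Fin q → Fin m → ℂ) :
    dzBarWedge J v = ∑ π : Equiv.Perm (Fin q),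
      ((Equiv.Perm.sign π : ℤ) : ℂ) * ∏ k, conj (v (π k) (J k)) := by
  rw [dzBarWedge, ContinuousMultilinearMap.alternatization_apply_apply]
  refine Finset.sum_congr rfl fun π _ => ?_
  rcases Int.units_eq_one_or (Equiv.Perm.sign π) with h | h <;> simp [h, dzBar, dz]

/-- The form of type `(0,q)` on `ℂ^m` with the given components. -/
def formOfComponents (c : (Fin q → Fin m) → ℂ) : (Fin m → ℂ) [⋀^Fin q]→L[ℝ] ℂ :=
  (1 / (q.factorial : ℂ)) • ∑ J, c J • dzBarWedge J

theorem formOfComponents_apply (c : (Fin q → Fin m) → ℂ) (v : Fin q → Fin m → ℂ) :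
    formOfComponents c v = (1 / (q.factorial : ℂ)) * ∑ J, c J * dzBarWedge J v := by
  simp [formOfComponents]

theorem isConjLinear_dzBarWedge (J : Fin q → Fin m) : IsConjLinear (dzBarWedge J) := by
  intro v k c
  rw [dzBarWedge_apply, dzBarWedge_apply, Finset.mul_sum]
  refine Finset.sum_congr rfl fun π _ => ?_
  rw [mul_left_comm]
  congr 1
  obtain ⟨l, rfl⟩ := π.surjective k
  rw [← Finset.mul_prod_erase _ _ (Finset.mem_univ l),
    ← Finset.mul_prod_erase (a := l) _ (fun k => conj (v (π k) (J k))) (Finset.mem_univ l),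
    ← mul_assoc]
  congr 1
  · simp
  · refine Finset.prod_congr rfl fun i hi => ?_
    rw [Function.update_of_ne]
    exact fun h => Finset.ne_of_mem_erase hi (π.injective h)

theorem isConjLinear_formOfComponents (c : (Fin q → Fin m) → ℂ) :
    IsConjLinear (formOfComponents c) := by
  intro v k a
  simp only [formOfComponents_apply, isConjLinear_dzBarWedge _ v k a, Finset.mul_sum]
  exact Finset.sum_congr rfl fun J _ => by ring

/-- Each of the q! permutations selects one multi-index and, by antisymmetry, contributes c K; the
factor 1/q! compensates. -/
theorem formOfComponents_basisTuple {c : (Fin q → Fin m) → ℂ} (hc : IsAntisymm c)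
    (K : Fin q → Fin m) : formOfComponents c (basisTuple K) = c K := by
  have h1 : ∀ (π : Equiv.Perm (Fin q)) (J : Fin q → Fin m),
      ∏ k, conj (basisTuple K (π k) (J k)) = if J = K ∘ π then 1 else 0 := by
    intro π J
    simp only [basisTuple, Pi.single_apply, apply_ite (starRingEnd ℂ), map_one, map_zero,
      Finset.prod_ite_zero, Finset.prod_const_one, Finset.mem_univ, true_implies, funext_iff,
      Function.comp]
  have h2 : ∀ π : Equiv.Perm (Fin q),
      ((Equiv.Perm.sign π : ℤ) : ℂ) * c (K ∘ π) = c K := by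
    intro π
    rw [hc, ← mul_assoc]
    norm_cast
    simp
  have hq : (q.factorial : ℂ) ≠ 0 := by exact_mod_cast q.factorial_ne_zero
  rw [formOfComponents_apply]
  simp only [dzBarWedge_apply, h1, Finset.mul_sum]
  rw [Finset.sum_comm]
  have h3 : ∀ π : Equiv.Perm (Fin q), ∑ J : Fin q → Fin m, 1 / (q.factorial : ℂ) *
      (c J * (((Equiv.Perm.sign π : ℤ) : ℂ) * if J = K ∘ π then 1 else 0)) =
        1 / (q.factorial : ℂ) * c K := by
    intro π
    rw [← h2 π]
    simp [mul_comm]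
  simp only [h3, Finset.sum_const, Finset.card_univ, Fintype.card_perm, Fintype.card_fin,
    nsmul_eq_mul]
  field_simp

/-- Two conjugate-linear forms agreeing on basis vectors coincide. This reduces smoothness of forms
to smoothness of components. -/
theorem IsConjLinear.eq_formOfComponents {α : (Fin m → ℂ) [⋀^Fin q]→L[ℝ] ℂ}
    (hα : IsConjLinear α) : α = formOfComponents fun J => α (basisTuple J) :=
  hα.ext_basis (isConjLinear_formOfComponents _) fun J =>
    (formOfComponents_basisTuple (isAntisymm_apply α fun i => Pi.single i 1) J).symm

theorem contDiffAt_formOfComponents {c : (Fin m → ℂ) → (Fin q → Fin m) → ℂ} {z : Fin m → ℂ}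
    (hc : ∀ J, ContDiffAt ℝ ∞ (fun w => c w J) z) :
    ContDiffAt ℝ ∞ (fun w => formOfComponents (c w)) z :=
  (ContDiffAt.sum fun J _ => (hc J).smul contDiffAt_const).const_smul _

theorem contDiffAt_form_apply {φ : (Fin m → ℂ) → (Fin m → ℂ) [⋀^Fin q]→L[ℝ] ℂ} {z : Fin m → ℂ}
    (hφ : ContDiffAt ℝ ∞ φ z) (v : Fin q → Fin m → ℂ) : ContDiffAt ℝ ∞ (fun w => φ w v) z :=
  (ContinuousAlternatingMap.apply ℝ (Fin m → ℂ) ℂ v).contDiff.contDiffAt.comp z hφ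

/-- Testing on the conjugate of the difference gives its squared norm. -/
theorem eq_of_forall_isAntisymm {u v : (Fin q → Fin m) → ℂ} (hu : IsAntisymm u)
    (hv : IsAntisymm v) (h : ∀ Y, IsAntisymm Y → ∑ I, u I * Y I = ∑ I, v I * Y I) : u = v := by
  have h1 := h _ (hu.sub hv).conj
  rw [← sub_eq_zero, ← Finset.sum_sub_distrib] at h1
  have h2 : ∑ I, ((Complex.normSq (u I - v I) : ℝ) : ℂ) = 0 := by
    rw [← h1]
    refine Finset.sum_congr rfl fun I _ => ?_
    rw [← Complex.mul_conj]; ring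
  rw [← Complex.ofReal_sum, Complex.ofReal_eq_zero,
    Finset.sum_eq_zero_iff_of_nonneg fun I _ => Complex.normSq_nonneg _] at h2
  funext I
  exact sub_eq_zero.1 (Complex.normSq_eq_zero.1 (h2 I (Finset.mem_univ I)))

end Components

/-! ### The operator `∂̄` in components -/

section LocalDbar

variable {m q : ℕ} {z : Fin m → ℂ} {φ : (Fin m → ℂ) → (Fin m → ℂ) [⋀^Fin q]→L[ℝ] ℂ}

/-- The components of `∂̄` of a form with components `a`. -/
def dbarComponents (a : (Fin m → ℂ) → (Fin q → Fin m) → ℂ) (z : Fin m → ℂ)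
    (K : Fin (q + 1) → Fin m) : ℂ :=
  ∑ b : Fin (q + 1), (-1 : ℂ) ^ (b : ℕ) *
    wirtingerBar (K b) (fun w => a w fun k => K (b.succAbove k)) z

theorem dbarComponents_congr {a a' : (Fin m → ℂ) → (Fin q → Fin m) → ℂ} (h : a =ᶠ[𝓝 z] a') :
    dbarComponents a z = dbarComponents a' z := by
  funext K
  refine Finset.sum_congr rfl fun b _ => ?_
  congr 1
  exact wirtingerBar_congr _ (h.mono fun w hw => by simp [hw])

theorem conjLinearPart_apply (A : (Fin m → ℂ) →L[ℝ] (Fin m → ℂ) [⋀^Fin q]→L[ℝ] ℂ)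
    (a : Fin m → ℂ) (v : Fin q → Fin m → ℂ) :
    conjLinearPart A a v = (1 / 2 : ℂ) * (A a v + Complex.I * A (Complex.I • a) v) := by
  simp [conjLinearPart, mul_add]

theorem localDbar_apply (hφ : DifferentiableAt ℝ φ z) (v : Fin (q + 1) → Fin m → ℂ) :
    localDbar φ z v = ∑ b : Fin (q + 1), (-1 : ℂ) ^ (b : ℕ) *
      ((1 / 2 : ℂ) * (fderiv ℝ (fun w => φ w (b.removeNth v)) z (v b) +
        Complex.I * fderiv ℝ (fun w => φ w (b.removeNth v)) z (Complex.I • v b))) := by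
  rw [localDbar, ContinuousAlternatingMap.alternatizeUncurryFin_apply]
  refine Finset.sum_congr rfl fun b _ => ?_
  rw [conjLinearPart_apply, fderiv_continuousAlternatingMap_apply_const_apply hφ,
    fderiv_continuousAlternatingMap_apply_const_apply hφ]
  rw [← Int.cast_smul_eq_zsmul ℂ]
  simp

theorem localDbar_basisTuple (hφ : DifferentiableAt ℝ φ z) (K : Fin (q + 1) → Fin m) :
    localDbar φ z (basisTuple K) = dbarComponents (fun w J => φ w (basisTuple J)) z K := by
  rw [localDbar_apply hφ]
  refine Finset.sum_congr rfl fun b _ => ?_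
  have h : Complex.I • basisTuple K b = Pi.single (K b) Complex.I := by
    rw [basisTuple, ← Pi.single_smul]; simp
  rw [h]
  rfl

theorem isConjLinear_localDbar (hφ : DifferentiableAt ℝ φ z)
    (hlin : ∀ᶠ w in 𝓝 z, IsConjLinear (φ w)) : IsConjLinear (localDbar φ z) := by
  intro v k c
  rw [localDbar_apply hφ, localDbar_apply hφ, Finset.mul_sum]
  refine Finset.sum_congr rfl fun b _ => ?_
  rw [mul_left_comm (conj c)]
  congr 1
  -- In the slot of differentiation conjugate-linearity comes from taking the conjugate-linear part
  -- of the derivative; in the other slots it is inherited from φ.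
  rcases eq_or_ne k b with rfl | hkb
  · rw [Function.update_self, Fin.removeNth_update]
    set L := fderiv ℝ (fun w => φ w (k.removeNth v)) z
    have h1 : ∀ d : ℂ, L (d • v k) = d.re * L (v k) + d.im * L (Complex.I • v k) := by
      intro d
      have : d • v k = d.re • v k + d.im • (Complex.I • v k) := by
        conv_lhs => rw [← Complex.re_add_im d]
        rw [add_smul, mul_smul, Complex.coe_smul, Complex.coe_smul]
      rw [this]; simp
    rw [smul_smul, h1 c, h1 (Complex.I * c)]
    have hc : conj c = c.re - c.im * Complex.I := by
      apply Complex.ext <;> simp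
    rw [hc]
    simp only [Complex.mul_re, Complex.I_re, Complex.I_im, Complex.mul_im]
    push_cast
    linear_combination ((c.im : ℂ) * L (Complex.I • v k) / 2) * Complex.I_sq
  · obtain ⟨i, rfl⟩ := Fin.exists_succAbove_eq hkb
    rw [Function.update_of_ne hkb.symm, Fin.removeNth_update_succAbove]
    have h1 : (fun w => φ w (Function.update (b.removeNth v) i (c • v (b.succAbove i)))) =ᶠ[𝓝 z]
        fun w => conj c • φ w (b.removeNth v) := by
      filter_upwards [hlin] with w hw using hw (b.removeNth v) i c
    rw [h1.fderiv_eq, fderiv_fun_const_smul (hφ.continuousAlternatingMap_apply_const _)]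
    simp only [smul_apply, smul_eq_mul]
    ring

theorem sum_dbarComponents_mul (a : (Fin m → ℂ) → (Fin q → Fin m) → ℂ)
    {Y : (Fin (q + 1) → Fin m) → ℂ} (hY : IsAntisymm Y) :
    ∑ K, dbarComponents a z K * Y K =
      (q + 1) * ∑ K : Fin (q + 1) → Fin m,
        wirtingerBar (K 0) (fun w => a w (Fin.tail K)) z * Y K :=
  sum_alternate_mul (F := fun j J => wirtingerBar j (fun w => a w J) z) hY

/-- These are the components of an honest alternating form, the local ∂̄ of the form with components
`a`. -/
theorem isAntisymm_dbarComponents {a : (Fin m → ℂ) → (Fin q → Fin m) → ℂ}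
    (ha : ∀ J, ContDiffAt ℝ ∞ (fun w => a w J) z) (hanti : ∀ᶠ w in 𝓝 z, IsAntisymm (a w)) :
    IsAntisymm (dbarComponents a z) := by
  have hd : DifferentiableAt ℝ (fun w => formOfComponents (a w)) z :=
    (contDiffAt_formOfComponents ha).differentiableAt_top
  have h : dbarComponents a z = fun K =>
      localDbar (fun w => formOfComponents (a w)) z (basisTuple K) := by
    funext K
    rw [localDbar_basisTuple hd]
    refine congrFun (dbarComponents_congr ?_) K
    filter_upwards [hanti] with w hw
    funext J
    rw [formOfComponents_basisTuple hw]
  rw [h]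
  exact isAntisymm_apply (localDbar (fun w => formOfComponents (a w)) z) fun i => Pi.single i 1

/-- Contracted with an antisymmetric tensor, both alternations become numerical factors and leave
∂̄_i∂̄_j a, symmetric in i and j. -/
theorem dbarComponents_dbarComponents {a : (Fin m → ℂ) → (Fin q → Fin m) → ℂ}
    (ha : ∀ᶠ w in 𝓝 z, ∀ J, ContDiffAt ℝ ∞ (fun w => a w J) w)
    (hanti : ∀ᶠ w in 𝓝 z, IsAntisymm (a w)) :
    dbarComponents (dbarComponents a) z = 0 := by
  have hs : ∀ K, ContDiffAt ℝ ∞ (fun w => dbarComponents a w K) z := fun K =>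
    ContDiffAt.sum fun b _ =>
      contDiffAt_const.mul (contDiffAt_wirtingerBar _ (ha.self_of_nhds _))
  have hanti' : ∀ᶠ w in 𝓝 z, IsAntisymm (dbarComponents a w) := by
    filter_upwards [ha, hanti.eventually_nhds] with w h1 h2 using isAntisymm_dbarComponents h1 h2
  refine eq_of_forall_isAntisymm (isAntisymm_dbarComponents hs hanti')
    (fun π J => by simp) fun Y hY => ?_
  rw [sum_dbarComponents_mul _ hY, sum_cons]
  have h1 : ∀ (j : Fin m) (K : Fin (q + 1) → Fin m),
      wirtingerBar j (fun w => dbarComponents a w K) z = ∑ b : Fin (q + 1), (-1 : ℂ) ^ (b : ℕ) *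
        wirtingerBar j (wirtingerBar (K b) fun w => a w fun k => K (b.succAbove k)) z := by
    intro j K
    simp only [dbarComponents]
    rw [wirtingerBar_sum _ _ fun b _ =>
      contDiffAt_const.mul (contDiffAt_wirtingerBar _ (ha.self_of_nhds _))]
    exact Finset.sum_congr rfl fun b _ => wirtingerBar_const_mul _ _
  have h2 : ∀ j : Fin m, ∑ K : Fin (q + 1) → Fin m,
      wirtingerBar j (fun w => dbarComponents a w K) z * Y (Fin.cons j K) =
      (q + 1) * ∑ K : Fin (q + 1) → Fin m,
        wirtingerBar j (wirtingerBar (K 0) fun w => a w (Fin.tail K)) z * Y (Fin.cons j K) := by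
    intro j
    simp only [h1]
    exact sum_alternate_mul
      (F := fun i J => wirtingerBar j (wirtingerBar i fun w => a w J) z) (hY.cons j)
  simp only [Fin.cons_zero, Fin.tail_cons, h2, ← Finset.mul_sum]
  have h3 : ∑ K : Fin (q + 2) → Fin m, wirtingerBar (K 0) (wirtingerBar (Fin.tail K 0)
      fun w => a w (Fin.tail (Fin.tail K))) z * Y K = 0 := by
    refine sum_mul_eq_zero_of_swap hY (i := 0) (j := Fin.succ 0) (Fin.succ_ne_zero 0).symm ?_
    intro J
    rw [wirtingerBar_comm _ _ (ha.self_of_nhds _)]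
    have e1 : (J ∘ Equiv.swap 0 (Fin.succ 0)) 0 = Fin.tail J 0 := by simp [Fin.tail]
    have e2 : Fin.tail (J ∘ Equiv.swap 0 (Fin.succ 0)) 0 = J 0 := by simp [Fin.tail]
    have e3 : Fin.tail (Fin.tail (J ∘ Equiv.swap 0 (Fin.succ 0))) = Fin.tail (Fin.tail J) := by
      funext k
      simp only [Fin.tail, Function.comp]
      rw [Equiv.swap_apply_of_ne_of_ne (Fin.succ_ne_zero _) (by simp [Fin.ext_iff])]
    rw [e1, e2, e3]
  rw [sum_cons] at h3
  simp only [Fin.cons_zero, Fin.tail_cons] at h3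
  rw [h3]
  simp

end LocalDbar

/-! ### The operator `∂̄` on a manifold, in charts -/

section ManifoldDbar

variable {m q : ℕ} {M : Type*} [TopologicalSpace M] [ChartedSpace (Fin m → ℂ) M]
  [IsManifold 𝓘(ℂ, Fin m → ℂ) ω M]
  {e e' : OpenPartialHomeomorph M (Fin m → ℂ)} {x : M} {z : Fin m → ℂ}

/-- The components of a form in the chart `e`, as functions of the coordinates. -/
def chartComponents (e : OpenPartialHomeomorph M (Fin m → ℂ)) (η : FormField m M q)
    (z : Fin m → ℂ) : (Fin q → Fin m) → ℂ :=
  component e η (e.symm z)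

theorem IsSmoothZeroQ.isConjLinear {η : FormField m M q} (hη : IsSmoothZeroQ η) (x : M) :
    IsConjLinear (η x) := hη.conj_linear x

theorem IsSmoothZeroQ.isConjLinear_formInChart {η : FormField m M q} (hη : IsSmoothZeroQ η)
    (e : OpenPartialHomeomorph M (Fin m → ℂ)) (z : Fin m → ℂ) :
    IsConjLinear (formInChart e η z) :=
  (hη.isConjLinear _).compContinuousLinearMap _

theorem IsSmoothZeroQ.contDiffAt_formInChart {η : FormField m M q} (hη : IsSmoothZeroQ η)
    (he : e ∈ atlas (Fin m → ℂ) M) (hz : z ∈ e.target) :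
    ContDiffAt ℝ ∞ (formInChart e η) z :=
  (hη.smooth e he).contDiffAt (e.open_target.mem_nhds hz)

theorem IsSmoothZeroQ.contDiffAt_chartComponents {η : FormField m M q} (hη : IsSmoothZeroQ η)
    (he : e ∈ atlas (Fin m → ℂ) M) (hz : z ∈ e.target) (J : Fin q → Fin m) :
    ContDiffAt ℝ ∞ (fun w => chartComponents e η w J) z :=
  contDiffAt_form_apply (hη.contDiffAt_formInChart he hz) (basisTuple J)

theorem isAntisymm_chartComponents (e : OpenPartialHomeomorph M (Fin m → ℂ))
    (η : FormField m M q) (z : Fin m → ℂ) : IsAntisymm (chartComponents e η z) :=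
  isAntisymm_component e η _

theorem isSmoothZeroQ_of_components {η : FormField m M q} (hη : ∀ x, IsConjLinear (η x))
    (h : ∀ e ∈ atlas (Fin m → ℂ) M, ∀ z ∈ e.target, ∀ J,
      ContDiffAt ℝ ∞ (fun w => chartComponents e η w J) z) : IsSmoothZeroQ η where
  smooth e he z hz := by
    have : formInChart e η = fun w => formOfComponents (chartComponents e η w) := by
      funext w
      exact ((hη _).compContinuousLinearMap _).eq_formOfComponents
    rw [this]
    exact (contDiffAt_formOfComponents (h e he z hz)).contDiffWithinAt
  conj_linear x := hη x

theorem wirtinger_comm {u : (Fin m → ℂ) → ℂ} (i j : Fin m) (hu : ContDiffAt ℝ ∞ u z) :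
    wirtinger i (wirtinger j u) z = wirtinger j (wirtinger i u) z := by
  have h := wirtingerBar_comm i j hu.conj_complex
  have h1 : ∀ k, wirtingerBar k (fun w => conj (u w)) = fun w => conj (wirtinger k u w) :=
    fun k => funext fun w => wirtingerBar_conj k
  rw [h1, h1, wirtingerBar_conj, wirtingerBar_conj] at h
  exact (starRingEnd ℂ).injective h

/-! ### Derivatives of coordinate changes and naturality of ∂̄ -/

theorem contDiffAt_transition_real (he : e ∈ atlas (Fin m → ℂ) M)
    (he' : e' ∈ atlas (Fin m → ℂ) M) (hz : z ∈ e.target ∩ e.symm ⁻¹' e'.source) :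
    ContDiffAt ℝ ∞ (fun z => e' (e.symm z)) z :=
  ((contDiffAt_transition he he' hz).restrict_scalars ℝ).of_le le_top

theorem contDiffAt_transition_apply (he : e ∈ atlas (Fin m → ℂ) M)
    (he' : e' ∈ atlas (Fin m → ℂ) M) (hz : z ∈ e.target ∩ e.symm ⁻¹' e'.source) (k : Fin m) :
    ContDiffAt ℝ ∞ (fun z => e' (e.symm z) k) z :=
  (contDiffAt_pi.1 (contDiffAt_transition_real he he' hz)) k

theorem jacobian_eventuallyEq (he : e ∈ atlas (Fin m → ℂ) M) (he' : e' ∈ atlas (Fin m → ℂ) M)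
    (hz : z ∈ e.target ∩ e.symm ⁻¹' e'.source) (i j : Fin m) :
    (fun w => jacobian e e' w i j) =ᶠ[𝓝 z] wirtinger j fun w => e' (e.symm w) i := by
  filter_upwards [(isOpen_overlap e e').mem_nhds hz] with w hw
  have hd := differentiableAt_transition he he' hw
  rw [wirtinger_of_differentiableAt j (differentiableAt_pi.1 hd i), jacobian, Matrix.of_apply,
    fderiv_pi (differentiableAt_pi.1 hd)]
  rfl

theorem contDiffAt_jacobian (he : e ∈ atlas (Fin m → ℂ) M) (he' : e' ∈ atlas (Fin m → ℂ) M)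
    (hz : z ∈ e.target ∩ e.symm ⁻¹' e'.source) (i j : Fin m) :
    ContDiffAt ℝ ∞ (fun w => jacobian e e' w i j) z :=
  (contDiffAt_wirtinger j (contDiffAt_transition_apply he he' hz i)).congr_of_eventuallyEq
    (jacobian_eventuallyEq he he' hz i j)

theorem wirtinger_jacobian_symm (he : e ∈ atlas (Fin m → ℂ) M) (he' : e' ∈ atlas (Fin m → ℂ) M)
    (hz : z ∈ e.target ∩ e.symm ⁻¹' e'.source) (i j k : Fin m) :
    wirtinger i (fun w => jacobian e e' w k j) z = wirtinger j (fun w => jacobian e e' w k i) z := by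
  rw [wirtinger_congr i (jacobian_eventuallyEq he he' hz k j),
    wirtinger_congr j (jacobian_eventuallyEq he he' hz k i),
    wirtinger_comm _ _ (contDiffAt_transition_apply he he' hz k)]

theorem wirtingerBar_jacobian (he : e ∈ atlas (Fin m → ℂ) M) (he' : e' ∈ atlas (Fin m → ℂ) M)
    (hz : z ∈ e.target ∩ e.symm ⁻¹' e'.source) (i j k : Fin m) :
    wirtingerBar i (fun w => jacobian e e' w k j) z = 0 := by
  rw [wirtingerBar_congr i (jacobian_eventuallyEq he he' hz k j),
    ← wirtinger_wirtingerBar_comm _ _ (contDiffAt_transition_apply he he' hz k)]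
  have : wirtingerBar i (fun w => e' (e.symm w) k) =ᶠ[𝓝 z] fun _ => 0 := by
    filter_upwards [(isOpen_overlap e e').mem_nhds hz] with w hw
    exact wirtingerBar_of_differentiableAt i
      (differentiableAt_pi.1 (differentiableAt_transition he he' hw) k)
  rw [wirtinger_congr j this, wirtinger_const]

theorem transition_mem (hz : z ∈ e.target ∩ e.symm ⁻¹' e'.source) : e' (e.symm z) ∈ e'.target :=
  e'.map_source hz.2

theorem chartComponents_eq_mulVec {η : FormField m M q} (hη : ∀ x, IsConjLinear (η x))
    (he : e ∈ atlas (Fin m → ℂ) M) (he' : e' ∈ atlas (Fin m → ℂ) M)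
    (hz : z ∈ e.target ∩ e.symm ⁻¹' e'.source) :
    chartComponents e η z =
      tensorPow (jacobian e e' z)ᴴ *ᵥ chartComponents e' η (e' (e.symm z)) := by
  have h := component_eq_mulVec (hη (e.symm z)) he he' (e.map_target hz.1) hz.2
  rw [e.right_inv hz.1] at h
  rw [chartComponents, chartComponents, e'.left_inv hz.2, h]

theorem sum_conjTranspose_mulVec (A : Matrix (Fin m) (Fin m) ℂ) (u v : (Fin q → Fin m) → ℂ) :
    ∑ I, (tensorPow Aᴴ *ᵥ u) I * v I = ∑ I, u I * (tensorPow (A.map conj) *ᵥ v) I := by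
  rw [← mulVec_transpose_pairing]
  rfl

/-- Differentiating the transformation law of components produces the chain-rule term and
derivatives of the conjugate Jacobian. The latter are second derivatives of the coordinate change,
symmetric, and disappear under alternation. -/
theorem dbarComponents_eq_mulVec {η : FormField m M q} (hη : IsSmoothZeroQ η)
    (he : e ∈ atlas (Fin m → ℂ) M) (he' : e' ∈ atlas (Fin m → ℂ) M)
    (hz : z ∈ e.target ∩ e.symm ⁻¹' e'.source) :
    dbarComponents (chartComponents e η) z =
      tensorPow (jacobian e e' z)ᴴ *ᵥ dbarComponents (chartComponents e' η) (e' (e.symm z)) := by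
  have ha' : ∀ J, ContDiffAt ℝ ∞ (fun w => chartComponents e' η w J) (e' (e.symm z)) :=
    hη.contDiffAt_chartComponents he' (transition_mem hz)
  have hat : ∀ J, ContDiffAt ℝ ∞ (fun w => chartComponents e' η (e' (e.symm w)) J) z := fun J =>
    ContDiffAt.comp (g := fun w => chartComponents e' η w J) z (ha' J)
      (contDiffAt_transition_real he he' hz)
  have hA : ∀ i j, ContDiffAt ℝ ∞ (fun w => (jacobian e e' w)ᴴ i j) z := fun i j =>
    (contDiffAt_jacobian he he' hz j i).conj_complex
  have hanti : ∀ (e : OpenPartialHomeomorph M (Fin m → ℂ)) (z : Fin m → ℂ),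
      ∀ᶠ w in 𝓝 z, IsAntisymm (chartComponents e η w) := fun e z =>
    Eventually.of_forall (isAntisymm_chartComponents e η)
  have h1 : ∀ (j : Fin m) (J : Fin q → Fin m),
      wirtingerBar j (fun w => chartComponents e η w J) z =
        wirtingerBar j (fun w => (tensorPow (jacobian e e' w)ᴴ *ᵥ
          chartComponents e' η (e' (e.symm w))) J) z := by
    intro j J
    refine wirtingerBar_congr j ?_
    filter_upwards [(isOpen_overlap e e').mem_nhds hz] with w hw
    rw [chartComponents_eq_mulVec hη.isConjLinear he he' hw]
  have hD' := isAntisymm_dbarComponents ha' (hanti e' _)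
  refine eq_of_forall_isAntisymm
    (isAntisymm_dbarComponents (hη.contDiffAt_chartComponents he hz.1) (hanti e z))
    (hD'.mulVec _) fun Y hY => ?_
  rw [sum_conjTranspose_mulVec, sum_dbarComponents_mul _ hY,
    sum_dbarComponents_mul _ (hY.mulVec _), ← sum_conjTranspose_mulVec]
  congr 1
  simp only [h1]
  rw [sum_wirtingerBar_tensorPow_mul (P := fun w => (jacobian e e' w)ᴴ) hA ?_ hat hY]
  · refine Finset.sum_congr rfl fun K _ => ?_
    congr 1
    conv_rhs => rw [← Fin.cons_self_tail K]
    rw [tensorPow_mulVec_cons]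
    simp only [Fin.cons_zero, Fin.tail_cons]
    have h2 : ∀ I : Fin q → Fin m,
        wirtingerBar (K 0) (fun w => chartComponents e' η (e' (e.symm w)) I) z =
          ∑ k, (jacobian e e' z)ᴴ (K 0) k *
            wirtingerBar k (fun w => chartComponents e' η w I) (e' (e.symm z)) := fun I =>
      wirtingerBar_comp_holomorphic (u := fun w => chartComponents e' η w I)
        (differentiableAt_transition he he' hz) (ha' I).differentiableAt_top (K 0)
    simp only [h2, Matrix.mulVec, dotProduct, Finset.mul_sum]
    rw [Finset.sum_comm]
    exact Finset.sum_congr rfl fun k _ => Finset.sum_congr rfl fun I _ => by ring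
  · intro i j k
    simp only [Matrix.conjTranspose_apply, RCLike.star_def, wirtingerBar_conj]
    rw [wirtinger_jacobian_symm he he' hz]

theorem dbar_apply (η : FormField m M q) (x : M) :
    dbar η x = (localDbar (formInChart (chartAt (Fin m → ℂ) x) η)
      (chartAt (Fin m → ℂ) x x)).compContinuousLinearMap
        ((chartDeriv (chartAt (Fin m → ℂ) x) x).restrictScalars ℝ) := rfl

theorem chartDeriv_frame (he : e ∈ atlas (Fin m → ℂ) M) (hx : x ∈ e.source) (i : Fin m) :
    chartDeriv e x (frame e x i) = Pi.single i 1 :=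
  chartDeriv_coordInv he hx _

theorem component_compContinuousLinearMap (he : e ∈ atlas (Fin m → ℂ) M) (hx : x ∈ e.source)
    (β : FormField m M q) {φ : (Fin m → ℂ) [⋀^Fin q]→L[ℝ] ℂ}
    (hβ : β x = φ.compContinuousLinearMap ((chartDeriv e x).restrictScalars ℝ)) :
    component e β x = fun J => φ (basisTuple J) := by
  funext J
  rw [component, hβ, ContinuousAlternatingMap.compContinuousLinearMap_apply]
  congr 1
  funext k
  exact chartDeriv_frame he hx (J k)

theorem IsSmoothZeroQ.isConjLinear_dbar {η : FormField m M q} (hη : IsSmoothZeroQ η) (x : M) :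
    IsConjLinear (dbar η x) := by
  rw [dbar_apply]
  refine IsConjLinear.compContinuousLinearMap (isConjLinear_localDbar ?_ ?_) _
  · exact (hη.contDiffAt_formInChart (chart_mem_atlas _ x)
      (mem_chart_target _ x)).differentiableAt_top
  · exact Eventually.of_forall fun w => hη.isConjLinear_formInChart _ w

/-- `dbar` uses a chart that varies with the point. By naturality a single fixed chart may be used
instead, which is what makes `dbar η` differentiable in coordinates. -/
theorem IsSmoothZeroQ.component_dbar {η : FormField m M q} (hη : IsSmoothZeroQ η)
    (he : e ∈ atlas (Fin m → ℂ) M) (hx : x ∈ e.source) :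
    component e (dbar η) x = dbarComponents (chartComponents e η) (e x) := by
  set c := chartAt (Fin m → ℂ) x with hc
  have hc' : c ∈ atlas (Fin m → ℂ) M := chart_mem_atlas _ x
  have hxc : x ∈ c.source := mem_chart_source _ x
  have h1 : component c (dbar η) x = dbarComponents (chartComponents c η) (c x) := by
    rw [component_compContinuousLinearMap hc' hxc (dbar η) (dbar_apply η x)]
    funext K
    exact localDbar_basisTuple
      (hη.contDiffAt_formInChart hc' (c.map_source hxc)).differentiableAt_top K
  have hz : e x ∈ e.target ∩ e.symm ⁻¹' c.source := ⟨e.map_source hx, by simpa [hx] using hxc⟩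
  rw [component_eq_mulVec (hη.isConjLinear_dbar x) he hc' hx hxc, h1,
    dbarComponents_eq_mulVec hη he hc' hz, e.left_inv hx]

theorem IsSmoothZeroQ.chartComponents_dbar {η : FormField m M q} (hη : IsSmoothZeroQ η)
    (he : e ∈ atlas (Fin m → ℂ) M) (hz : z ∈ e.target) :
    chartComponents e (dbar η) z = dbarComponents (chartComponents e η) z := by
  rw [chartComponents, hη.component_dbar he (e.map_target hz), e.right_inv hz]

theorem IsSmoothZeroQ.dbar {η : FormField m M q} (hη : IsSmoothZeroQ η) :
    IsSmoothZeroQ (dbar η) := by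
  refine isSmoothZeroQ_of_components hη.isConjLinear_dbar fun e he z hz J => ?_
  have h : (fun w => chartComponents e (FanoHodge.dbar η) w J) =ᶠ[𝓝 z]
      fun w => dbarComponents (chartComponents e η) w J := by
    filter_upwards [e.open_target.mem_nhds hz] with w hw
    rw [hη.chartComponents_dbar he hw]
  refine ContDiffAt.congr_of_eventuallyEq ?_ h
  exact ContDiffAt.sum fun b _ => contDiffAt_const.mul
    (contDiffAt_wirtingerBar _ (hη.contDiffAt_chartComponents he hz _))

theorem IsSmoothZeroQ.dbarComponents_chartComponents_dbar {η : FormField m M q}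
    (hη : IsSmoothZeroQ η) (he : e ∈ atlas (Fin m → ℂ) M) (hz : z ∈ e.target) :
    dbarComponents (chartComponents e (FanoHodge.dbar η)) z = 0 := by
  have h : chartComponents e (FanoHodge.dbar η) =ᶠ[𝓝 z] dbarComponents (chartComponents e η) := by
    filter_upwards [e.open_target.mem_nhds hz] with w hw
    rw [hη.chartComponents_dbar he hw]
  rw [dbarComponents_congr h]
  refine dbarComponents_dbarComponents ?_
    (Eventually.of_forall (isAntisymm_chartComponents e η))
  filter_upwards [e.open_target.mem_nhds hz] with w hw
  exact hη.contDiffAt_chartComponents he hw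

/-! ### Forms supported in a chart -/

open Classical in
/-- The form on `M` with the given components in the chart `e`, extended by zero. -/
def extendForm (e : OpenPartialHomeomorph M (Fin m → ℂ))
    (c : (Fin m → ℂ) → (Fin q → Fin m) → ℂ) : FormField m M q := fun x =>
  if x ∈ e.source then
    (formOfComponents (c (e x))).compContinuousLinearMap ((chartDeriv e x).restrictScalars ℝ)
  else 0

theorem component_extendForm (he : e ∈ atlas (Fin m → ℂ) M) (hx : x ∈ e.source)
    {c : (Fin m → ℂ) → (Fin q → Fin m) → ℂ} (hc : IsAntisymm (c (e x))) :
    component e (extendForm e c) x = c (e x) := by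
  rw [component_compContinuousLinearMap he hx (extendForm e c) (if_pos hx)]
  funext J
  exact formOfComponents_basisTuple hc J

theorem isConjLinear_extendForm (e : OpenPartialHomeomorph M (Fin m → ℂ))
    (c : (Fin m → ℂ) → (Fin q → Fin m) → ℂ) (x : M) : IsConjLinear (extendForm e c x) := by
  unfold extendForm
  split_ifs
  · exact (isConjLinear_formOfComponents _).compContinuousLinearMap _
  · intro v k a
    simp

theorem chartComponents_extendForm (he : e ∈ atlas (Fin m → ℂ) M) (hz : z ∈ e.target)
    {c : (Fin m → ℂ) → (Fin q → Fin m) → ℂ} (hc : IsAntisymm (c z)) :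
    chartComponents e (extendForm e c) z = c z := by
  have := component_extendForm (c := c) he (e.map_target hz) (by rwa [e.right_inv hz])
  rwa [e.right_inv hz] at this

theorem extendForm_eq_zero {c : (Fin m → ℂ) → (Fin q → Fin m) → ℂ}
    (hx : x ∈ e.source → c (e x) = 0) : extendForm e c x = 0 := by
  unfold extendForm
  split_ifs with h
  · rw [hx h]
    ext v
    simp [formOfComponents_apply]
  · rfl

theorem isSmoothZeroQ_extendForm [T2Space M] (he : e ∈ atlas (Fin m → ℂ) M)
    {c : (Fin m → ℂ) → (Fin q → Fin m) → ℂ} (hanti : ∀ z, IsAntisymm (c z))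
    (hsmooth : ∀ z ∈ e.target, ∀ J, ContDiffAt ℝ ∞ (fun w => c w J) z)
    {K : Set (Fin m → ℂ)} (hK : IsCompact K) (hKe : K ⊆ e.target)
    (hcK : ∀ z ∈ e.target, z ∉ K → c z = 0) : IsSmoothZeroQ (extendForm e c) := by
  refine isSmoothZeroQ_of_components (isConjLinear_extendForm e c) fun e' he' z hz J => ?_
  by_cases hze : e'.symm z ∈ e.source
  · have hz' : z ∈ e'.target ∩ e'.symm ⁻¹' e.source := ⟨hz, hze⟩
    have h : (fun w => chartComponents e' (extendForm e c) w J) =ᶠ[𝓝 z]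
        fun w => (tensorPow (jacobian e' e w)ᴴ *ᵥ c (e (e'.symm w))) J := by
      filter_upwards [(isOpen_overlap e' e).mem_nhds hz'] with w hw
      rw [chartComponents_eq_mulVec (isConjLinear_extendForm e c) he' he hw,
        chartComponents_extendForm he (transition_mem hw) (hanti _)]
    refine ContDiffAt.congr_of_eventuallyEq ?_ h
    refine contDiffAt_tensorPow_mulVec (P := fun w => (jacobian e' e w)ᴴ)
      (fun i j => (contDiffAt_jacobian he' he hz' j i).conj_complex) (fun I => ?_) J
    exact (hsmooth _ (transition_mem hz') I).comp z (contDiffAt_transition_real he' he hz')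
  -- Away from the domain of `e`: the image of `K` is compact, hence closed in the Hausdorff space
  -- `M`, and the extension vanishes on its open complement.
  · have hcl : IsClosed (e.symm '' K) :=
      (hK.image_of_continuousOn (e.continuousOn_symm.mono hKe)).isClosed
    have hnot : e'.symm z ∉ e.symm '' K := by
      rintro ⟨w, hw, hwe⟩
      exact hze (hwe ▸ e.map_target (hKe hw))
    have hnear : ∀ᶠ w in 𝓝 z, e'.symm w ∉ e.symm '' K :=
      (e'.continuousAt_symm hz).eventually (hcl.isOpen_compl.mem_nhds hnot)
    have h : (fun w => chartComponents e' (extendForm e c) w J) =ᶠ[𝓝 z] fun _ => 0 := by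
      filter_upwards [hnear] with w hw
      have : extendForm e c (e'.symm w) = 0 := by
        refine extendForm_eq_zero fun hx => hcK _ (e.map_source hx) fun hmem => hw ?_
        exact ⟨_, hmem, e.left_inv hx⟩
      simp [chartComponents, component, this]
    exact contDiffAt_const.congr_of_eventuallyEq h

end ManifoldDbar

/-! ### Integration by parts in `ℂ^m` -/

section IntegrationByParts

variable {m : ℕ} {U K : Set (Fin m → ℂ)} {h : (Fin m → ℂ) → ℂ}

theorem integrableOn_of_compact_support (hU : IsOpen U) (hK : IsCompact K) (hKU : K ⊆ U)
    (hc : ContinuousOn h U) (h0 : ∀ z ∈ U, z ∉ K → h z = 0) : IntegrableOn h U :=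
  ((hc.mono hKU).integrableOn_compact hK).of_forall_sdiff_eq_zero hU.measurableSet
    fun z hz => h0 z hz.1 hz.2

/-- Extension by zero gives a smooth compactly supported function on ℂ^m, whose directional
derivatives have integral zero. -/
theorem setIntegral_wirtinger_eq_zero (hU : IsOpen U) (hK : IsCompact K) (hKU : K ⊆ U)
    (hs : ∀ z ∈ U, ContDiffAt ℝ ∞ h z) (h0 : ∀ z ∈ U, z ∉ K → h z = 0) (l : Fin m) :
    ∫ z in U, wirtinger l h z = 0 := by
  set k := U.indicator h with hk
  have hkU : ∀ z ∈ U, k =ᶠ[𝓝 z] h := fun z hz => by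
    filter_upwards [hU.mem_nhds hz] with w hw using Set.indicator_of_mem hw h
  have hkK : ∀ z, z ∉ K → k z = 0 := fun z hz => by
    by_cases hzU : z ∈ U
    · rw [hk, Set.indicator_of_mem hzU, h0 z hzU hz]
    · exact Set.indicator_of_notMem hzU h
  have hkK' : ∀ z, z ∉ K → k =ᶠ[𝓝 z] fun _ => 0 := fun z hz => by
    filter_upwards [hK.isClosed.isOpen_compl.mem_nhds hz] with w hw using hkK w hw
  have hks : ContDiff ℝ ∞ k := contDiff_iff_contDiffAt.2 fun z => by
    by_cases hz : z ∈ K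
    · exact (hs z (hKU hz)).congr_of_eventuallyEq (hkU z (hKU hz))
    · exact contDiffAt_const.congr_of_eventuallyEq (hkK' z hz)
  have hkc : HasCompactSupport k := HasCompactSupport.intro hK hkK
  have hint : ∀ v, Integrable (fun z => fderiv ℝ k z v) := fun v =>
    (((hks.continuous_fderiv (by simp)).clm_apply continuous_const).integrable_of_hasCompactSupport
      (hkc.fderiv_apply (𝕜 := ℝ) v))
  have hzero : ∀ v, ∫ z, fderiv ℝ k z v = 0 := fun v => by
    -- Integration by parts against the constant function 1.
    have := integral_mul_fderiv_eq_neg_fderiv_mul_of_integrable (μ := volume) (𝕜 := ℂ)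
      (f := fun _ : Fin m → ℂ => (1 : ℂ)) (g := k) (v := v) (by simp) (by simpa using hint v)
      (by simpa using hks.continuous.integrable_of_hasCompactSupport hkc)
      (fun z _ => differentiableAt_const _) fun z _ => hks.contDiffAt.differentiableAt_top
    simpa using this
  have hall : ∫ z, wirtinger l k z = 0 := by
    simp only [wirtinger]
    rw [integral_const_mul, integral_sub (hint _) ((hint _).const_mul _), integral_const_mul,
      hzero, hzero]
    simp
  rw [← hall, ← setIntegral_eq_integral_of_forall_compl_eq_zero (s := U) (f := wirtinger l k)]
  · exact setIntegral_congr_fun hU.measurableSet fun z hz => (wirtinger_congr l (hkU z hz)).symm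
  · intro z hz
    rw [wirtinger_congr l (hkK' z fun h => hz (hKU h)), wirtinger_const]

end IntegrationByParts

/-! ### Integration on the manifold -/

section Integration

variable {m q : ℕ} {M : Type*} [TopologicalSpace M] [ChartedSpace (Fin m → ℂ) M]
  [IsManifold 𝓘(ℂ, Fin m → ℂ) ω M]
  {e e' : OpenPartialHomeomorph M (Fin m → ℂ)} (g : HermitianMetric m M)

theorem contDiffAt_metricMatrix (he : e ∈ atlas (Fin m → ℂ) M) {z : Fin m → ℂ}
    (hz : z ∈ e.target) (i j : Fin m) :
    ContDiffAt ℝ ∞ (fun w => metricMatrix g e (e.symm w) i j) z :=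
  (g.smooth e he i j).contDiffAt (e.open_target.mem_nhds hz)

theorem contDiffAt_det {P : (Fin m → ℂ) → Matrix (Fin m) (Fin m) ℂ} {z : Fin m → ℂ}
    (hP : ∀ i j, ContDiffAt ℝ ∞ (fun w => P w i j) z) :
    ContDiffAt ℝ ∞ (fun w => (P w).det) z := by
  simp only [Matrix.det_apply']
  exact ContDiffAt.sum fun σ _ => contDiffAt_const.mul (contDiffAt_prod fun i _ => hP _ _)

theorem contDiffAt_volumeDensity (he : e ∈ atlas (Fin m → ℂ) M) {z : Fin m → ℂ}
    (hz : z ∈ e.target) : ContDiffAt ℝ ∞ (fun w => volumeDensity g e (e.symm w)) z :=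
  contDiffAt_const.mul (contDiffAt_det (contDiffAt_metricMatrix g he hz))

theorem continuousOn_volumeDensity (he : e ∈ atlas (Fin m → ℂ) M) :
    ContinuousOn (fun w => volumeDensity g e (e.symm w)) e.target := fun _ hz =>
  (contDiffAt_volumeDensity g he hz).continuousAt.continuousWithinAt

/-- The integral `∫ u ω^m` over the domain of the chart `e`. -/
def chartIntegral (e : OpenPartialHomeomorph M (Fin m → ℂ)) (u : M → ℂ) : ℂ :=
  ∫ z in e.target, u (e.symm z) * volumeDensity g e (e.symm z)

/-! ### Change of variables between charts -/

/-- The real determinant of a complex-linear map is the norm from ℂ to ℝ of its complex determinant.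
-/
theorem det_fderiv_transition (he : e ∈ atlas (Fin m → ℂ) M) (he' : e' ∈ atlas (Fin m → ℂ) M)
    {z : Fin m → ℂ} (hz : z ∈ e.target ∩ e.symm ⁻¹' e'.source) :
    (fderiv ℝ (fun z => e' (e.symm z)) z).det = Complex.normSq (jacobian e e' z).det := by
  have hd := differentiableAt_transition he he' hz
  have h1 : (jacobian e e' z).det = (fderiv ℂ (fun z => e' (e.symm z)) z).det := by
    rw [ContinuousLinearMap.det, ← LinearMap.det_toMatrix']
    congr 1
  rw [h1, hd.fderiv_restrictScalars ℝ]
  have h2 := LinearMap.det_restrictScalars (R := ℝ)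
    (f := (fderiv ℂ (fun z => e' (e.symm z)) z).toLinearMap)
  rw [Algebra.norm_complex_eq] at h2
  exact h2

theorem volumeDensity_eq (he : e ∈ atlas (Fin m → ℂ) M) (he' : e' ∈ atlas (Fin m → ℂ) M)
    {x : M} (hx : x ∈ e.source) (hx' : x ∈ e'.source) :
    volumeDensity g e x =
      (Complex.normSq (jacobian e e' (e x)).det : ℂ) * volumeDensity g e' x := by
  have h : ((jacobian e e' (e x)).map conj).det = conj (jacobian e e' (e x)).det :=
    ((starRingEnd ℂ).map_det _).symm
  rw [volumeDensity, volumeDensity, metricMatrix_eq g he he' hx hx', Matrix.det_mul,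
    Matrix.det_mul, Matrix.det_transpose, h, ← Complex.mul_conj]
  ring

theorem image_transition (e e' : OpenPartialHomeomorph M (Fin m → ℂ)) :
    (fun z => e' (e.symm z)) '' (e.target ∩ e.symm ⁻¹' e'.source) =
      e'.target ∩ e'.symm ⁻¹' e.source := by
  ext w
  constructor
  · rintro ⟨z, hz, rfl⟩
    refine ⟨e'.map_source hz.2, ?_⟩
    simp only [Set.mem_preimage, e'.left_inv hz.2]
    exact e.map_target hz.1
  · intro hw
    refine ⟨e (e'.symm w), ⟨e.map_source hw.2, ?_⟩, ?_⟩
    · simp only [Set.mem_preimage, e.left_inv hw.2]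
      exact e'.map_target hw.1
    · simp only [e.left_inv hw.2, e'.right_inv hw.1]

/-- Both integrals live on the overlap. The density changes by |det A|², A the holomorphic Jacobian,
which is exactly the real Jacobian determinant. -/
theorem chartIntegral_eq (he : e ∈ atlas (Fin m → ℂ) M) (he' : e' ∈ atlas (Fin m → ℂ) M)
    {u : M → ℂ} (hu : ∀ x, x ∉ e.source → u x = 0) (hu' : ∀ x, x ∉ e'.source → u x = 0) :
    chartIntegral g e u = chartIntegral g e' u := by
  have hrestr : ∀ c c' : OpenPartialHomeomorph M (Fin m → ℂ), (∀ x, x ∉ c'.source → u x = 0) →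
      chartIntegral g c u = ∫ z in c.target ∩ c.symm ⁻¹' c'.source,
        u (c.symm z) * volumeDensity g c (c.symm z) := by
    intro c c' hc
    refine setIntegral_eq_of_subset_of_forall_sdiff_eq_zero
      (f := fun z : Fin m → ℂ => u (c.symm z) * volumeDensity g c (c.symm z))
      c.open_target.measurableSet Set.inter_subset_left fun z hz => ?_
    rw [hc _ fun h => hz.2 ⟨hz.1, h⟩, zero_mul]
  rw [hrestr e e' hu', hrestr e' e hu, ← image_transition e e',
    integral_image_eq_integral_abs_det_fderiv_smul volume (isOpen_overlap e e').measurableSet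
      (f' := fun z => fderiv ℝ (fun z => e' (e.symm z)) z)]
  · refine setIntegral_congr_fun (isOpen_overlap e e').measurableSet fun z hz => ?_
    have h1 := volumeDensity_eq g he he' (e.map_target hz.1) hz.2
    rw [e.right_inv hz.1] at h1
    rw [det_fderiv_transition he he' hz, e'.left_inv hz.2, h1, abs_of_nonneg (Complex.normSq_nonneg _),
      Complex.real_smul]
    ring
  · intro z hz
    exact (contDiffAt_transition_real he he' hz).differentiableAt_top.hasFDerivAt.hasFDerivWithinAt
  · intro z hz w hw h
    have h2 : e.symm z = e.symm w := e'.injOn hz.2 hw.2 h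
    rw [← e.right_inv hz.1, h2, e.right_inv hw.1]

variable [CompactSpace M] [T2Space M]

theorem chartPartition_isSubordinate :
    (chartPartition m M).IsSubordinate fun p : M => (chartAt (Fin m → ℂ) p).source :=
  (exists_chartPartition m M).choose_spec

theorem exists_finset_chartPartition (m : ℕ) (M : Type*) [TopologicalSpace M]
    [ChartedSpace (Fin m → ℂ) M] [CompactSpace M] [T2Space M] :
    ∃ S : Finset M, ∀ p ∉ S, ∀ x, chartPartition m M p x = 0 := by
  have h := (chartPartition m M).locallyFinite.finite_nonempty_of_compact
  refine ⟨h.toFinset, fun p hp x => ?_⟩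
  by_contra hne
  exact hp (h.mem_toFinset.2 ⟨x, hne⟩)

theorem integral_eq_sum {S : Finset M} (hS : ∀ p ∉ S, ∀ x, chartPartition m M p x = 0)
    (u : M → ℂ) : integral g u = ∑ p ∈ S, chartIntegral g (chartAt (Fin m → ℂ) p)
      fun x => (chartPartition m M p x : ℂ) * u x := by
  rw [integral, finsum_eq_sum_of_support_subset]
  · rfl
  · intro p hp
    by_contra hpS
    refine hp ?_
    simp [hS p hpS]

theorem isCompact_image_tsupport {χ : M → ℝ} (hχ : tsupport χ ⊆ e.source) :
    IsCompact (e '' tsupport χ) :=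
  (isClosed_tsupport χ).isCompact.image_of_continuousOn (e.continuousOn.mono hχ)

theorem image_tsupport_subset {χ : M → ℝ} (hχ : tsupport χ ⊆ e.source) :
    e '' tsupport χ ⊆ e.target := by
  rintro _ ⟨x, hx, rfl⟩
  exact e.map_source (hχ hx)

theorem eq_zero_of_notMem_image_tsupport {χ : M → ℝ} {z : Fin m → ℂ} (hz : z ∈ e.target)
    (h : z ∉ e '' tsupport χ) : χ (e.symm z) = 0 := by
  by_contra hne
  exact h ⟨e.symm z, subset_tsupport _ hne, e.right_inv hz⟩

theorem integrableOn_chart (he : e ∈ atlas (Fin m → ℂ) M) {χ : M → ℝ} (hc : Continuous χ)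
    (hχ : tsupport χ ⊆ e.source) {u : M → ℂ}
    (hu : ContinuousOn (fun z => u (e.symm z)) e.target) :
    IntegrableOn (fun z => (χ (e.symm z) : ℂ) * u (e.symm z) * volumeDensity g e (e.symm z))
      e.target := by
  refine integrableOn_of_compact_support e.open_target (isCompact_image_tsupport hχ)
    (image_tsupport_subset hχ) ?_ fun z hz h => ?_
  · refine ContinuousOn.mul (ContinuousOn.mul ?_ hu) (continuousOn_volumeDensity g he)
    exact Complex.continuous_ofReal.comp_continuousOn (hc.comp_continuousOn e.continuousOn_symm)
  · rw [eq_zero_of_notMem_image_tsupport hz h]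
    simp

theorem integral_finset_sum {ι : Type*} (T : Finset ι) {u : ι → M → ℂ}
    (hu : ∀ i ∈ T, ∀ e ∈ atlas (Fin m → ℂ) M, ContinuousOn (fun z => u i (e.symm z)) e.target) :
    integral g (fun x => ∑ i ∈ T, u i x) = ∑ i ∈ T, integral g (u i) := by
  obtain ⟨S, hS⟩ := exists_finset_chartPartition m M
  simp only [integral_eq_sum g hS]
  rw [Finset.sum_comm]
  refine Finset.sum_congr rfl fun p _ => ?_
  simp only [chartIntegral, Finset.mul_sum, Finset.sum_mul]
  exact integral_finsetSum T fun i hi => integrableOn_chart g (chart_mem_atlas _ p)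
    (chartPartition m M p).continuous (chartPartition_isSubordinate p)
    (hu i hi _ (chart_mem_atlas _ p))

/-- Each piece of the partition of unity, multiplied by `u`, is supported in both charts and can be
moved to `e`; there the pieces sum to `u`. -/
theorem integral_eq_chartIntegral (he : e ∈ atlas (Fin m → ℂ) M) {K : Set M} (hK : IsCompact K)
    (hKe : K ⊆ e.source) {u : M → ℂ} (hu : ContinuousOn (fun z => u (e.symm z)) e.target)
    (hu0 : ∀ x, x ∉ K → u x = 0) : integral g u = chartIntegral g e u := by
  obtain ⟨S, hS⟩ := exists_finset_chartPartition m M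
  have h1 : ∀ p, chartIntegral g (chartAt (Fin m → ℂ) p)
      (fun x => (chartPartition m M p x : ℂ) * u x) =
        chartIntegral g e fun x => (chartPartition m M p x : ℂ) * u x := by
    intro p
    refine chartIntegral_eq g (chart_mem_atlas _ p) he (fun x hx => ?_) fun x hx => ?_
    · rw [image_eq_zero_of_notMem_tsupport fun h => hx (chartPartition_isSubordinate p h)]
      simp
    · rw [hu0 x fun h => hx (hKe h), mul_zero]
  rw [integral_eq_sum g hS, Finset.sum_congr rfl fun p _ => h1 p]
  simp only [chartIntegral]
  rw [← integral_finsetSum]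
  · refine setIntegral_congr_fun e.open_target.measurableSet fun z hz => ?_
    simp only [← Finset.sum_mul]
    have h2 : ∑ p ∈ S, chartPartition m M p (e.symm z) = 1 := by
      rw [← (chartPartition m M).sum_eq_one (Set.mem_univ (e.symm z)),
        finsum_eq_sum_of_support_subset]
      intro p hp
      by_contra hpS
      exact hp (hS p hpS _)
    rw [← Complex.ofReal_sum, h2]
    simp
  · intro p _
    refine integrableOn_of_compact_support e.open_target
      (hK.image_of_continuousOn (e.continuousOn.mono hKe)) ?_ ?_ fun z hz h => ?_
    · rintro _ ⟨x, hx, rfl⟩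
      exact e.map_source (hKe hx)
    · refine ContinuousOn.mul (ContinuousOn.mul ?_ hu) (continuousOn_volumeDensity g he)
      exact Complex.continuous_ofReal.comp_continuousOn
        ((chartPartition m M p).continuous.comp_continuousOn e.continuousOn_symm)
    · rw [hu0 _ fun hx => h ⟨_, hx, e.right_inv hz⟩]
      simp

/-! ### Smooth partitions of unity -/

theorem isManifold_real : IsManifold 𝓘(ℝ, Fin m → ℂ) ∞ M := by
  refine isManifold_of_contDiffOn _ _ _ fun e e' he he' => ?_
  have h : ContDiffOn ℝ ∞ (fun z => e' (e.symm z)) (e.target ∩ e.symm ⁻¹' e'.source) :=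
    fun z hz => (contDiffAt_transition_real he he' hz).contDiffWithinAt
  refine h.congr_mono ?_ ?_
  · intro z _
    simp
  · intro z hz
    simpa using hz

/-- The partition of unity defining `integral` is only continuous. The Bochner argument
differentiates its cut-off functions, so a smooth one is taken on the underlying real manifold. -/
theorem exists_smooth_partition (m : ℕ) (M : Type*) [TopologicalSpace M]
    [ChartedSpace (Fin m → ℂ) M] [IsManifold 𝓘(ℂ, Fin m → ℂ) ω M] [CompactSpace M] [T2Space M] :
    ∃ (S : Finset M) (χ : M → M → ℝ),
      (∀ p, ∀ e ∈ atlas (Fin m → ℂ) M, ∀ z ∈ e.target,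
        ContDiffAt ℝ ∞ (fun w => χ p (e.symm w)) z) ∧
      (∀ p, Continuous (χ p)) ∧ (∀ p x, 0 ≤ χ p x) ∧
      (∀ p, tsupport (χ p) ⊆ (chartAt (Fin m → ℂ) p).source) ∧ ∀ x, ∑ p ∈ S, χ p x = 1 := by
  have : IsManifold 𝓘(ℝ, Fin m → ℂ) ∞ M := isManifold_real
  obtain ⟨ρ, hρ⟩ := SmoothPartitionOfUnity.exists_isSubordinate 𝓘(ℝ, Fin m → ℂ)
    (isClosed_univ (X := M)) (fun p : M => (chartAt (Fin m → ℂ) p).source)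
    (fun p => (chartAt (Fin m → ℂ) p).open_source)
    (fun x _ => Set.mem_iUnion.2 ⟨x, mem_chart_source _ x⟩)
  have hfin := ρ.locallyFinite.finite_nonempty_of_compact
  refine ⟨hfin.toFinset, fun p => ρ p, fun p e he z hz => ?_, fun p => (ρ p).2.continuous,
    fun p x => ρ.nonneg p x, hρ, fun x => ?_⟩
  · have h1 := contMDiffOn_symm_of_mem_maximalAtlas (I := 𝓘(ℝ, Fin m → ℂ)) (n := ∞)
      (IsManifold.subset_maximalAtlas he)
    have h2 := (ρ p).contMDiff.comp_contMDiffOn h1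
    exact (contMDiffOn_iff_contDiffOn.1 h2).contDiffAt (e.open_target.mem_nhds hz)
  · rw [← ρ.sum_eq_one (Set.mem_univ x), finsum_eq_sum_of_support_subset]
    intro p hp
    exact hfin.mem_toFinset.2 ⟨x, hp⟩

end Integration

/-! ### Local consequences of the Kähler and Ricci potential conditions -/

section LocalMetric

variable {m q : ℕ} {M : Type*} [TopologicalSpace M] [ChartedSpace (Fin m → ℂ) M]
  [IsManifold 𝓘(ℂ, Fin m → ℂ) ω M] {e : OpenPartialHomeomorph M (Fin m → ℂ)} {g : HermitianMetric m M} {f : M → ℝ}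
  {z : Fin m → ℂ}

theorem fundamentalForm_apply (w a b : Fin m → ℂ) :
    fundamentalForm g e w ![a, b] = ∑ i, ∑ j, (Complex.I * metricMatrix g e (e.symm w) i j) *
      (a i * conj (b j) - b i * conj (a j)) := by
  simp only [fundamentalForm, ContinuousAlternatingMap.sum_apply,
    ContinuousAlternatingMap.smul_apply, smul_eq_mul]
  refine Finset.sum_congr rfl fun i _ => Finset.sum_congr rfl fun j _ => ?_
  rw [ContinuousAlternatingMap.alternatizeUncurryFin_apply, Fin.sum_univ_two]
  simp [dz, dzBar, Fin.removeNth, sub_eq_add_neg]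

theorem contDiffAt_fundamentalForm (he : e ∈ atlas (Fin m → ℂ) M) (hz : z ∈ e.target) :
    ContDiffAt ℝ ∞ (fundamentalForm g e) z :=
  ContDiffAt.sum fun i _ => ContDiffAt.sum fun j _ =>
    (contDiffAt_const.mul (contDiffAt_metricMatrix g he hz i j)).smul contDiffAt_const

theorem fderiv_fundamentalForm (he : e ∈ atlas (Fin m → ℂ) M) (hz : z ∈ e.target)
    (a : Fin m → ℂ) (j k : Fin m) (s t : ℂ) :
    fderiv ℝ (fundamentalForm g e) z a ![Pi.single j s, Pi.single k t] =
      Complex.I * (fderiv ℝ (fun w => metricMatrix g e (e.symm w) j k) z a * (s * conj t) -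
        fderiv ℝ (fun w => metricMatrix g e (e.symm w) k j) z a * (t * conj s)) := by
  rw [← fderiv_continuousAlternatingMap_apply_const_apply
    (contDiffAt_fundamentalForm he hz).differentiableAt_top]
  have h : (fun w => fundamentalForm g e w ![Pi.single j s, Pi.single k t]) = fun w =>
      Complex.I * (metricMatrix g e (e.symm w) j k * (s * conj t) -
        metricMatrix g e (e.symm w) k j * (t * conj s)) := by
    funext w
    rw [fundamentalForm_apply]
    have h1 : ∀ (j k : Fin m) (s t : ℂ), ∑ i, ∑ l,
        Complex.I * metricMatrix g e (e.symm w) i l *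
          ((Pi.single j s : Fin m → ℂ) i * conj ((Pi.single k t : Fin m → ℂ) l)) =
        Complex.I * metricMatrix g e (e.symm w) j k * (s * conj t) := by
      intro j k s t
      simp [Pi.single_apply, apply_ite (starRingEnd ℂ)]
    simp only [mul_sub, Finset.sum_sub_distrib, h1]
    ring
  have hd : ∀ j k, DifferentiableAt ℝ (fun w => metricMatrix g e (e.symm w) j k) z := fun j k =>
    (contDiffAt_metricMatrix g he hz j k).differentiableAt_top
  rw [h, fderiv_const_mul (((hd j k).mul_const _).fun_sub ((hd k j).mul_const _)),
    fderiv_fun_sub ((hd j k).mul_const _) ((hd k j).mul_const _), fderiv_mul_const (hd j k),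
    fderiv_mul_const (hd k j)]
  simp
  ring

/-- This is the vanishing of the (2,1)-component of dω, obtained from the values of dω on real
vectors in the directions ∂_i, ∂_j, ∂_k. -/
theorem IsKahler.wirtinger_metricMatrix (hg : IsKahler g) (he : e ∈ atlas (Fin m → ℂ) M)
    (hz : z ∈ e.target) (i j k : Fin m) :
    wirtinger i (fun w => metricMatrix g e (e.symm w) j k) z =
      wirtinger j (fun w => metricMatrix g e (e.symm w) i k) z := by
  have key : ∀ s t r : ℂ, _ := fun s t r => congrArg (fun φ => φ
    ![(Pi.single i s : Fin m → ℂ), Pi.single j t, Pi.single k r]) (hg e he z hz)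
  have h0 : ∀ a b c : Fin m → ℂ, extDeriv (fundamentalForm g e) z ![a, b, c] =
      fderiv ℝ (fundamentalForm g e) z a ![b, c] - fderiv ℝ (fundamentalForm g e) z b ![a, c] +
        fderiv ℝ (fundamentalForm g e) z c ![a, b] := by
    intro a b c
    have h1 : (0 : Fin 3).removeNth ![a, b, c] = ![b, c] := by
      funext i; fin_cases i <;> rfl
    have h2 : (1 : Fin 3).removeNth ![a, b, c] = ![a, c] := by
      funext i; fin_cases i <;> rfl
    have h3 : (2 : Fin 3).removeNth ![a, b, c] = ![a, b] := by
      funext i; fin_cases i <;> rfl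
    rw [extDeriv, ContinuousAlternatingMap.alternatizeUncurryFin_apply, Fin.sum_univ_three,
      h1, h2, h3]
    simp [sub_eq_add_neg]
  simp only [h0, fderiv_fundamentalForm he hz, ContinuousAlternatingMap.coe_zero,
    Pi.zero_apply] at key
  -- The eight choices of 1 or `I` in each slot determine the complex-trilinear extension of dω on
  -- ∂_i, ∂_j, ∂̄_k.
  have k1 := key 1 1 1
  have k2 := key 1 1 Complex.I
  have k3 := key 1 Complex.I 1
  have k4 := key 1 Complex.I Complex.I
  have k5 := key Complex.I 1 1
  have k6 := key Complex.I 1 Complex.I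
  have k7 := key Complex.I Complex.I 1
  have k8 := key Complex.I Complex.I Complex.I
  simp only [map_one, Complex.conj_I] at k1 k2 k3 k4 k5 k6 k7 k8
  simp only [wirtinger]
  generalize fderiv ℝ (fun w => metricMatrix g e (e.symm w) j k) z = A at *
  generalize fderiv ℝ (fun w => metricMatrix g e (e.symm w) k j) z = A' at *
  generalize fderiv ℝ (fun w => metricMatrix g e (e.symm w) i k) z = B at *
  generalize fderiv ℝ (fun w => metricMatrix g e (e.symm w) k i) z = B' at *
  generalize fderiv ℝ (fun w => metricMatrix g e (e.symm w) i j) z = C at *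
  generalize fderiv ℝ (fun w => metricMatrix g e (e.symm w) j i) z = C' at *
  generalize A (Pi.single i 1) = a1 at *
  generalize A (Pi.single i Complex.I) = a2 at *
  generalize A' (Pi.single i 1) = a1' at *
  generalize A' (Pi.single i Complex.I) = a2' at *
  generalize B (Pi.single j 1) = b1 at *
  generalize B (Pi.single j Complex.I) = b2 at *
  generalize B' (Pi.single j 1) = b1' at *
  generalize B' (Pi.single j Complex.I) = b2' at *
  generalize C (Pi.single k 1) = c1 at *
  generalize C (Pi.single k Complex.I) = c2 at *
  generalize C' (Pi.single k 1) = c1' at *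
  generalize C' (Pi.single k Complex.I) = c2' at *
  have hI := Complex.I_sq
  have hI3 : Complex.I ^ 3 = -Complex.I := by rw [pow_succ, hI]; ring
  have hI4 : Complex.I ^ 4 = 1 := by rw [pow_succ, hI3]; ring_nf; rw [hI]; ring
  have hI5 : Complex.I ^ 5 = Complex.I := by rw [pow_succ, hI4, one_mul]
  rw [← sub_eq_zero]
  -- An `I` in slot i or j carries the weight -I, one in slot k the weight I. The prefactor joins
  -- the three factors 1/2 of the Wirtinger vectors with the inverse of the √-1 in ω.
  linear_combination (norm := (ring_nf; rw [hI, hI3, hI4, hI5]; ring)) (-Complex.I / 8) * (k1 + Complex.I * k2 - Complex.I * k3 + k4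
    - Complex.I * k5 + k6 - k7 - Complex.I * k8)

theorem IsKahler.wirtingerBar_metricMatrix (hg : IsKahler g) (he : e ∈ atlas (Fin m → ℂ) M)
    (hz : z ∈ e.target) (i j k : Fin m) :
    wirtingerBar i (fun w => metricMatrix g e (e.symm w) k j) z =
      wirtingerBar j (fun w => metricMatrix g e (e.symm w) k i) z := by
  have h : ∀ l, (fun w => metricMatrix g e (e.symm w) k l) =
      fun w => conj (metricMatrix g e (e.symm w) l k) := fun l =>
    funext fun w => (metricMatrix_conj g e _ l k).symm
  rw [h, h, wirtingerBar_conj, wirtingerBar_conj, hg.wirtinger_metricMatrix he hz]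

/-! ### The local weight and smoothness of the inverse metric -/

variable (g) in
theorem det_metricMatrix_re_pos (he : e ∈ atlas (Fin m → ℂ) M) {x : M} (hx : x ∈ e.source) :
    0 < (metricMatrix g e x).det.re :=
  (Complex.lt_def.1 (posDef_metricMatrix g he hx).det_pos).1

variable (g) in
theorem ofReal_det_metricMatrix_re (he : e ∈ atlas (Fin m → ℂ) M) {x : M} (hx : x ∈ e.source) :
    ((metricMatrix g e x).det.re : ℂ) = (metricMatrix g e x).det :=
  Complex.ext rfl (Complex.lt_def.1 (posDef_metricMatrix g he hx).det_pos).2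

variable (e g f) in
/-- The local weight `f + log det (g_{i j̄})` in the chart `e`. -/
def localWeight (w : Fin m → ℂ) : ℂ :=
  (f (e.symm w) : ℂ) + (Real.log (metricMatrix g e (e.symm w)).det.re : ℂ)

theorem exp_localWeight (he : e ∈ atlas (Fin m → ℂ) M) (hz : z ∈ e.target) :
    Complex.exp (localWeight e g f z) =
      (Real.exp (f (e.symm z)) : ℂ) * (metricMatrix g e (e.symm z)).det := by
  rw [localWeight, Complex.exp_add, ← Complex.ofReal_exp, ← Complex.ofReal_exp,
    Real.exp_log (det_metricMatrix_re_pos g he (e.map_target hz)),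
    ofReal_det_metricMatrix_re g he (e.map_target hz)]

theorem contDiffAt_ofReal_comp {u : (Fin m → ℂ) → ℝ} (hu : ContDiffAt ℝ ∞ u z) :
    ContDiffAt ℝ ∞ (fun w => (u w : ℂ)) z :=
  Complex.ofRealCLM.contDiff.contDiffAt.comp z hu

theorem IsRicciPotential.contDiffAt (hf : IsRicciPotential g f) (he : e ∈ atlas (Fin m → ℂ) M)
    (hz : z ∈ e.target) : ContDiffAt ℝ ∞ (fun w => f (e.symm w)) z :=
  (hf.1 e he).contDiffAt (e.open_target.mem_nhds hz)

variable (g) in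
theorem contDiffAt_log_det (he : e ∈ atlas (Fin m → ℂ) M) (hz : z ∈ e.target) :
    ContDiffAt ℝ ∞ (fun w => Real.log (metricMatrix g e (e.symm w)).det.re) z := by
  refine ContDiffAt.log ?_ (det_metricMatrix_re_pos g he (e.map_target hz)).ne'
  exact Complex.reCLM.contDiff.contDiffAt.comp z (contDiffAt_det (contDiffAt_metricMatrix g he hz))

theorem IsRicciPotential.contDiffAt_localWeight (hf : IsRicciPotential g f)
    (he : e ∈ atlas (Fin m → ℂ) M) (hz : z ∈ e.target) :
    ContDiffAt ℝ ∞ (localWeight e g f) z :=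
  (contDiffAt_ofReal_comp (hf.contDiffAt he hz)).add
    (contDiffAt_ofReal_comp (contDiffAt_log_det g he hz))

/-- Since the Ricci tensor is -∂∂̄ log det g, the equation Ric - ω = √-1 ∂∂̄f becomes ∂∂̄(f + log
det g) = -g. -/
theorem IsRicciPotential.wirtinger_wirtingerBar_localWeight (hf : IsRicciPotential g f)
    (he : e ∈ atlas (Fin m → ℂ) M) (hz : z ∈ e.target) (i j : Fin m) :
    wirtinger i (wirtingerBar j (localWeight e g f)) z = -metricMatrix g e (e.symm z) i j := by
  have h1 : wirtingerBar j (localWeight e g f) =ᶠ[𝓝 z] fun w =>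
      wirtingerBar j (fun w => (f (e.symm w) : ℂ)) w +
        wirtingerBar j (fun w => (Real.log (metricMatrix g e (e.symm w)).det.re : ℂ)) w := by
    filter_upwards [e.open_target.mem_nhds hz] with w hw
    exact wirtingerBar_add j (contDiffAt_ofReal_comp (hf.contDiffAt he hw))
      (contDiffAt_ofReal_comp (contDiffAt_log_det g he hw))
  rw [wirtinger_congr i h1, wirtinger_add i
    (contDiffAt_wirtingerBar j (contDiffAt_ofReal_comp (hf.contDiffAt he hz)))
    (contDiffAt_wirtingerBar j (contDiffAt_ofReal_comp (contDiffAt_log_det g he hz))),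
    ← hf.2 e he z hz i j, ricci]
  ring

variable (g) in
-- By Cramer's rule the entries are quotients of determinants of smooth matrices.
theorem contDiffAt_invMatrix (he : e ∈ atlas (Fin m → ℂ) M) (hz : z ∈ e.target) (i j : Fin m) :
    ContDiffAt ℝ ∞ (fun w => invMatrix g e (e.symm w) i j) z := by
  have h : (fun w => invMatrix g e (e.symm w) i j) = fun w =>
      ((metricMatrix g e (e.symm w)).det)⁻¹ *
        ((metricMatrix g e (e.symm w)).updateRow i (Pi.single j 1)).det := by
    funext w
    rw [invMatrix, Matrix.transpose_apply, Matrix.inv_def, Matrix.smul_apply,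
      Matrix.adjugate_apply, Ring.inverse_eq_inv', smul_eq_mul]
  have hdet : ContDiffAt ℝ ∞ (fun w => (metricMatrix g e (e.symm w)).det) z :=
    contDiffAt_det (contDiffAt_metricMatrix g he hz)
  rw [h]
  refine (hdet.inv (isUnit_det_metricMatrix g he (e.map_target hz)).ne_zero).mul
    (contDiffAt_det fun k l => ?_)
  by_cases hk : k = i
  · subst hk
    simp only [Matrix.updateRow_self]
    exact contDiffAt_const
  · simp only [Matrix.updateRow_ne hk]
    exact contDiffAt_metricMatrix g he hz k l

variable (e g) in
/-- The components of `α^♯` in the chart `e`, as functions on `ℂ^m`. -/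
def chartRaised (α : FormField m M q) (w : Fin m → ℂ) : (Fin q → Fin m) → ℂ :=
  raised g e α (e.symm w)

variable (g) in
theorem IsSmoothZeroQ.contDiffAt_chartRaised {α : FormField m M q} (hα : IsSmoothZeroQ α)
    (he : e ∈ atlas (Fin m → ℂ) M) (hz : z ∈ e.target) (I : Fin q → Fin m) :
    ContDiffAt ℝ ∞ (fun w => chartRaised e g α w I) z :=
  contDiffAt_tensorPow_mulVec (contDiffAt_invMatrix g he hz)
    (hα.contDiffAt_chartComponents he hz) I

end LocalMetric

/-! ### The weighted adjoint in local coordinates -/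

section LocalAdjoint

variable {m q : ℕ}

theorem setIntegral_wirtingerBar_eq_zero {U K : Set (Fin m → ℂ)} {h : (Fin m → ℂ) → ℂ}
    (hU : IsOpen U) (hK : IsCompact K) (hKU : K ⊆ U) (hs : ∀ z ∈ U, ContDiffAt ℝ ∞ h z)
    (h0 : ∀ z ∈ U, z ∉ K → h z = 0) (l : Fin m) : ∫ z in U, wirtingerBar l h z = 0 := by
  have h1 := setIntegral_wirtinger_eq_zero (h := fun w => conj (h w)) hU hK hKU
    (fun z hz => (hs z hz).conj_complex) (fun z hz hzK => by rw [h0 z hz hzK, map_zero]) l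
  simp only [wirtinger_conj] at h1
  rw [integral_conj] at h1
  simpa using h1

theorem setIntegral_wirtingerBar_mul_conj {U K : Set (Fin m → ℂ)} {a b : (Fin m → ℂ) → ℂ}
    (hU : IsOpen U) (hK : IsCompact K) (hKU : K ⊆ U) (ha : ∀ z ∈ U, ContDiffAt ℝ ∞ a z)
    (hb : ∀ z ∈ U, ContDiffAt ℝ ∞ b z) (h0 : ∀ z ∈ U, z ∉ K → a z = 0) (l : Fin m) :
    ∫ z in U, wirtingerBar l a z * conj (b z) = -∫ z in U, a z * conj (wirtinger l b z) := by
  have h1 := setIntegral_wirtingerBar_eq_zero (h := fun w => a w * conj (b w)) hU hK hKU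
    (fun z hz => (ha z hz).mul (hb z hz).conj_complex)
    (fun z hz hzK => by rw [h0 z hz hzK, zero_mul]) l
  have h2 : ∀ z ∈ U, wirtingerBar l (fun w => a w * conj (b w)) z =
      wirtingerBar l a z * conj (b z) + a z * conj (wirtinger l b z) := fun z hz => by
    rw [wirtingerBar_mul l (ha z hz) (hb z hz).conj_complex, wirtingerBar_conj]
  have hc : ∀ {u : (Fin m → ℂ) → ℂ}, (∀ z ∈ U, ContDiffAt ℝ ∞ u z) → ContinuousOn u U :=
    fun hu z hz => (hu z hz).continuousAt.continuousWithinAt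
  have h3 : IntegrableOn (fun z => wirtingerBar l a z * conj (b z)) U := by
    refine integrableOn_of_compact_support hU hK hKU
      (hc fun z hz => (contDiffAt_wirtingerBar l (ha z hz)).mul (hb z hz).conj_complex) ?_
    intro z hz hzK
    have : a =ᶠ[𝓝 z] fun _ => 0 := by
      filter_upwards [hU.mem_nhds hz, hK.isClosed.isOpen_compl.mem_nhds hzK] with w hw hwK
      exact h0 w hw hwK
    rw [wirtingerBar_congr l this, wirtingerBar_const, zero_mul]
  have h4 : IntegrableOn (fun z => a z * conj (wirtinger l b z)) U := by
    refine integrableOn_of_compact_support hU hK hKU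
      (hc fun z hz => (ha z hz).mul (contDiffAt_wirtinger l (hb z hz)).conj_complex) ?_
    intro z hz hzK
    rw [h0 z hz hzK, zero_mul]
  rw [setIntegral_congr_fun hU.measurableSet h2, integral_add h3 h4] at h1
  exact eq_neg_of_add_eq_zero_left h1

/-- A nonnegative function with zero integral vanishes almost everywhere, and a continuous one then
vanishes on the whole open set. In the order of ℂ, nonnegativity includes being real. -/
theorem eq_zero_of_setIntegral_eq_zero {U K : Set (Fin m → ℂ)} {h : (Fin m → ℂ) → ℂ}
    (hU : IsOpen U) (hK : IsCompact K) (hKU : K ⊆ U) (hc : ContinuousOn h U)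
    (h0 : ∀ z ∈ U, z ∉ K → h z = 0) (hpos : ∀ z ∈ U, 0 ≤ h z) (hint : ∫ z in U, h z = 0)
    {z : Fin m → ℂ} (hz : z ∈ U) : h z = 0 := by
  have hre : ∀ z ∈ U, ((h z).re : ℂ) = h z := fun z hz =>
    Complex.ext rfl (Complex.le_def.1 (hpos z hz)).2
  have h1 : IntegrableOn (fun z => (h z).re) U :=
    (integrableOn_of_compact_support hU hK hKU hc h0).re
  have h2 : ∫ z in U, (h z).re = 0 := by
    have := setIntegral_congr_fun (μ := volume) hU.measurableSet hre
    rw [integral_complex_ofReal, hint] at this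
    exact_mod_cast this
  rw [setIntegral_eq_zero_iff_of_nonneg_ae
    ((ae_restrict_iff' hU.measurableSet).2 (Eventually.of_forall fun z hz =>
      (Complex.le_def.1 (hpos z hz)).1)) h1] at h2
  have h3 : Set.EqOn (fun z => (h z).re) (fun _ => 0) U :=
    Measure.eqOn_open_of_ae_eq h2 hU (Complex.continuous_re.comp_continuousOn hc) continuousOn_const
  rw [← hre z hz]
  exact congrArg _ (h3 hz)

end LocalAdjoint

/-! ### The formal adjoint on the manifold as a weighted divergence -/

section Adjoint

variable {m q : ℕ} {M : Type*} [TopologicalSpace M] [ChartedSpace (Fin m → ℂ) M]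
  [IsManifold 𝓘(ℂ, Fin m → ℂ) ω M]
  {e : OpenPartialHomeomorph M (Fin m → ℂ)} {g : HermitianMetric m M} {f : M → ℝ}

/-- The inverse metric is Hermitian, so raising can be moved to the conjugated factor. The test form
then enters undifferentiated by any metric coefficient. -/
theorem sum_raised_mul_conj_comm (e : OpenPartialHomeomorph M (Fin m → ℂ)) (ξ γ : FormField m M q)
    (x : M) : ∑ I, raised g e ξ x I * conj (component e γ x I) =
      ∑ I, component e ξ x I * conj (raised g e γ x I) := by
  have h1 : ∀ I, conj (raised g e γ x I) =
      ((tensorPow (invMatrix g e x))ᵀ *ᵥ fun J => conj (component e γ x J)) I := by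
    intro I
    simp [raised, Matrix.mulVec, dotProduct, tensorPow_apply, invMatrix_conj]
  simp only [h1]
  simp only [mul_comm (component e ξ x _)]
  rw [mulVec_transpose_pairing]
  exact Finset.sum_congr rfl fun _ _ => mul_comm _ _

theorem formInner_chart {ξ γ : FormField m M q} (hξ : ∀ x, IsConjLinear (ξ x))
    (hγ : ∀ x, IsConjLinear (γ x)) (he : e ∈ atlas (Fin m → ℂ) M) {z : Fin m → ℂ}
    (hz : z ∈ e.target) : formInner g ξ γ (e.symm z) =
      (1 / (q.factorial : ℂ)) *
        ∑ I, chartComponents e ξ z I * conj (chartRaised e g γ z I) := by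
  rw [formInner_eq g (hξ _) (hγ _) he (e.map_target hz), sum_raised_mul_conj_comm]
  rfl

theorem IsSmoothZeroQ.component_dbar_eq_zero {ξ : FormField m M q} (hξ : IsSmoothZeroQ ξ)
    (he : e ∈ atlas (Fin m → ℂ) M) {x : M} (hx : x ∈ e.source) (h0 : ∀ᶠ y in 𝓝 x, ξ y = 0) :
    component e (FanoHodge.dbar ξ) x = 0 := by
  have h1 : chartComponents e ξ =ᶠ[𝓝 (e x)] fun _ _ => 0 := by
    have h2 : Tendsto e.symm (𝓝 (e x)) (𝓝 x) := by
      have := e.continuousAt_symm (e.map_source hx)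
      rwa [ContinuousAt, e.left_inv hx] at this
    filter_upwards [h2.eventually h0] with w hw
    funext J
    simp [chartComponents, component, hw]
  rw [hξ.component_dbar he hx, dbarComponents_congr h1]
  funext K
  simp [dbarComponents, wirtingerBar_const]

theorem isAntisymm_chartRaised (e : OpenPartialHomeomorph M (Fin m → ℂ)) (g : HermitianMetric m M)
    (α : FormField m M q) (w : Fin m → ℂ) : IsAntisymm (chartRaised e g α w) :=
  isAntisymm_raised g e α _

theorem conj_exp_localWeight (e : OpenPartialHomeomorph M (Fin m → ℂ)) (g : HermitianMetric m M)
    (f : M → ℝ) (w : Fin m → ℂ) :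
    conj (Complex.exp (localWeight e g f w)) = Complex.exp (localWeight e g f w) := by
  rw [← Complex.exp_conj, localWeight, map_add, Complex.conj_ofReal, Complex.conj_ofReal]

variable [CompactSpace M] [T2Space M]

theorem weightedInner_eq_setIntegral (hf : IsRicciPotential g f) {ξ γ : FormField m M q}
    (hξ : IsSmoothZeroQ ξ) (hγ : IsSmoothZeroQ γ) (he : e ∈ atlas (Fin m → ℂ) M) {K : Set M}
    (hK : IsCompact K) (hKe : K ⊆ e.source)
    (h0 : ∀ x, x ∉ K → component (chartAt (Fin m → ℂ) x) ξ x = 0) :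
    weightedInner g f ξ γ = (m.factorial : ℂ) * 2 ^ m / q.factorial *
      ∫ z in e.target, Complex.exp (localWeight e g f z) *
        ∑ I, chartComponents e ξ z I * conj (chartRaised e g γ z I) := by
  rw [weightedInner, integral_eq_chartIntegral g he hK hKe, chartIntegral, ← integral_const_mul]
  · refine setIntegral_congr_fun e.open_target.measurableSet fun z hz => ?_
    rw [formInner_chart hξ.isConjLinear hγ.isConjLinear he hz, exp_localWeight he hz,
      volumeDensity]
    ring
  · have h1 : ContinuousOn (fun z => (1 / (q.factorial : ℂ)) *
        (∑ I, chartComponents e ξ z I * conj (chartRaised e g γ z I)) *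
          (Real.exp (f (e.symm z)) : ℂ)) e.target := fun z hz => by
      refine ContDiffAt.continuousAt (𝕜 := ℝ) (n := ∞) ?_ |>.continuousWithinAt
      refine ContDiffAt.mul (contDiffAt_const.mul (ContDiffAt.sum fun I _ => ?_))
        (contDiffAt_ofReal_comp (hf.contDiffAt he hz).exp)
      exact (hξ.contDiffAt_chartComponents he hz I).mul
        (hγ.contDiffAt_chartRaised g he hz I).conj_complex
    refine h1.congr fun z hz => ?_
    rw [formInner_chart hξ.isConjLinear hγ.isConjLinear he hz]
  · intro x hx
    simp [formInner, h0 x hx]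

/-- The weak definition of the adjoint is made pointwise. Let D be the difference of the two sides;
integrating by parts against a form supported in the chart shows that D is orthogonal to it, and the
choice χ·(lowered D) forces D = 0 where χ = 1. The Kähler condition plays no role. -/
theorem IsDbarAdjoint.raised_eq (hf : IsRicciPotential g f) {α : FormField m M (q + 1)}
    {γ : FormField m M q} (hα : IsSmoothZeroQ α) (h : IsDbarAdjoint g f α γ)
    (he : e ∈ atlas (Fin m → ℂ) M) {z₀ : Fin m → ℂ} (hz₀ : z₀ ∈ e.target) (I₀ : Fin q → Fin m) :
    Complex.exp (localWeight e g f z₀) * chartRaised e g γ z₀ I₀ =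
      -∑ l, wirtinger l (fun w => Complex.exp (localWeight e g f w) *
        chartRaised e g α w (Fin.cons l I₀)) z₀ := by
  set ℓ := localWeight e g f with hℓ
  set X : Fin m → (Fin q → Fin m) → (Fin m → ℂ) → ℂ := fun l I w =>
    Complex.exp (ℓ w) * chartRaised e g α w (Fin.cons l I) with hX
  set D : (Fin m → ℂ) → (Fin q → Fin m) → ℂ := fun w I =>
    Complex.exp (ℓ w) * chartRaised e g γ w I + ∑ l, wirtinger l (X l I) w with hD
  have hℓs : ∀ z ∈ e.target, ContDiffAt ℝ ∞ (fun w => Complex.exp (ℓ w)) z := fun z hz =>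
    (hf.contDiffAt_localWeight he hz).cexp
  have hXs : ∀ z ∈ e.target, ∀ l I, ContDiffAt ℝ ∞ (X l I) z := fun z hz l I =>
    (hℓs z hz).mul (hα.contDiffAt_chartRaised g he hz _)
  have hDs : ∀ z ∈ e.target, ∀ I, ContDiffAt ℝ ∞ (fun w => D w I) z := fun z hz I =>
    ((hℓs z hz).mul (h.1.contDiffAt_chartRaised g he hz I)).add
      (ContDiffAt.sum fun l _ => contDiffAt_wirtinger l (hXs z hz l I))
  have hDanti : ∀ w, IsAntisymm (D w) := by
    intro w π J
    have h1 : ∀ l, X l (J ∘ π) = fun w => ((Equiv.Perm.sign π : ℤ) : ℂ) * X l J w := by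
      intro l
      funext w
      simp only [hX]
      have h2 := (isAntisymm_chartRaised e g α w).cons l π J
      beta_reduce at h2
      rw [h2]
      ring
    simp only [hD, h1, wirtinger_const_mul]
    rw [isAntisymm_chartRaised e g γ w π J, ← Finset.mul_sum]
    ring
  obtain ⟨χ, hχe, hχc, hχs, hχ01, hχ1⟩ := exists_contDiff_tsupport_subset (n := (⊤ : ℕ∞))
    (e.open_target.mem_nhds hz₀)
  have hK : IsCompact (tsupport χ) := hχc
  have hχ0 : ∀ z, z ∉ tsupport χ → χ z = 0 := fun z hz => image_eq_zero_of_notMem_tsupport hz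
  set G : (Fin m → ℂ) → Matrix (Fin m) (Fin m) ℂ := fun w => metricMatrix g e (e.symm w)
  -- Lowering the indices of `D` makes the pairing of `c` with the conjugate of `D` a cut-off
  -- Hermitian norm; the weight e^ℓ is already contained in `D`.
  set c : (Fin m → ℂ) → (Fin q → Fin m) → ℂ := fun w J =>
    (χ w : ℂ) * (tensorPow (G w)ᵀ *ᵥ D w) J with hc
  have hcs : ∀ z ∈ e.target, ∀ J, ContDiffAt ℝ ∞ (fun w => c w J) z := fun z hz J =>
    (contDiffAt_ofReal_comp hχs.contDiffAt).mul
      (contDiffAt_tensorPow_mulVec (P := fun w => (G w)ᵀ)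
        (fun i j => contDiffAt_metricMatrix g he hz j i) (hDs z hz) J)
  have hcanti : ∀ w, IsAntisymm (c w) := fun w => ((hDanti w).mulVec _).const_mul _
  have hc0 : ∀ z, z ∉ tsupport χ → c z = 0 := fun z hz => by
    funext J
    simp [hc, hχ0 z hz]
  have hξ : IsSmoothZeroQ (extendForm e c) :=
    isSmoothZeroQ_extendForm he hcanti hcs hK hχe fun z _ => hc0 z
  have hK' : IsCompact (e.symm '' tsupport χ) :=
    hK.image_of_continuousOn (e.continuousOn_symm.mono hχe)
  have hKe : e.symm '' tsupport χ ⊆ e.source := by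
    rintro _ ⟨z, hz, rfl⟩
    exact e.map_target (hχe hz)
  have hξ0 : ∀ x, x ∉ e.symm '' tsupport χ → extendForm e c x = 0 := fun x hx =>
    extendForm_eq_zero fun hxe => hc0 _ fun hmem => hx ⟨_, hmem, e.left_inv hxe⟩
  have hadj := h.2 _ hξ
  rw [weightedInner_eq_setIntegral hf hξ.dbar hα he hK' hKe fun x hx =>
      hξ.component_dbar_eq_zero (chart_mem_atlas _ x) (mem_chart_source _ x)
        (Filter.mem_of_superset (hK'.isClosed.isOpen_compl.mem_nhds hx) hξ0),
    weightedInner_eq_setIntegral hf hξ h.1 he hK' hKe fun x hx => by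
      funext J
      simp [component, hξ0 x hx]] at hadj
  have hcomp : ∀ z ∈ e.target, chartComponents e (extendForm e c) z = c z := fun z hz =>
    chartComponents_extendForm he hz (hcanti z)
  -- The alternation in ∂̄ costs a factor q + 1. It later cancels against the change of
  -- normalization from 1/q! to 1/(q+1)!.
  have hleft : ∀ z ∈ e.target, Complex.exp (ℓ z) *
      ∑ J, chartComponents e (dbar (extendForm e c)) z J * conj (chartRaised e g α z J) =
      (q + 1) * ∑ l, ∑ I, wirtingerBar l (fun w => c w I) z * conj (X l I z) := fun z hz => by
    have hev : chartComponents e (extendForm e c) =ᶠ[𝓝 z] c :=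
      Filter.mem_of_superset (e.open_target.mem_nhds hz) hcomp
    rw [hξ.chartComponents_dbar he hz, dbarComponents_congr hev,
      sum_dbarComponents_mul c (isAntisymm_chartRaised e g α z).conj, sum_cons, mul_left_comm,
      Finset.mul_sum]
    simp only [Finset.mul_sum]
    refine Finset.sum_congr rfl fun l _ => Finset.sum_congr rfl fun I _ => ?_
    simp only [Fin.cons_zero, Fin.tail_cons, hX, map_mul, hℓ, conj_exp_localWeight]
    ring
  have hright : ∀ z ∈ e.target, Complex.exp (ℓ z) *
      ∑ I, chartComponents e (extendForm e c) z I * conj (chartRaised e g γ z I) =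
      ∑ I, c z I * conj (Complex.exp (ℓ z) * chartRaised e g γ z I) := fun z hz => by
    rw [hcomp z hz, Finset.mul_sum]
    refine Finset.sum_congr rfl fun I _ => ?_
    rw [map_mul, hℓ, conj_exp_localWeight]
    ring
  have hint : ∀ a b : (Fin m → ℂ) → ℂ, (∀ z ∈ e.target, ContDiffAt ℝ ∞ a z) →
      (∀ z ∈ e.target, ContDiffAt ℝ ∞ b z) → (∀ z ∈ e.target, z ∉ tsupport χ → a z = 0) →
      IntegrableOn (fun z => a z * conj (b z)) e.target := fun a b ha hb h0 =>
    integrableOn_of_compact_support e.open_target hK hχe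
      (fun z hz => ((ha z hz).mul (hb z hz).conj_complex).continuousAt.continuousWithinAt)
      fun z hz hzK => by rw [h0 z hz hzK, zero_mul]
  have hdc0 : ∀ l I, ∀ z ∈ e.target, z ∉ tsupport χ → wirtingerBar l (fun w => c w I) z = 0 := by
    intro l I z _ hzK
    have : (fun w => c w I) =ᶠ[𝓝 z] fun _ => 0 := by
      filter_upwards [(isClosed_tsupport χ).isOpen_compl.mem_nhds hzK] with w hw
      rw [hc0 w hw]
      rfl
    rw [wirtingerBar_congr l this, wirtingerBar_const]
  have hc0' : ∀ I, ∀ z ∈ e.target, z ∉ tsupport χ → c z I = 0 := fun I z _ hzK => by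
    rw [hc0 z hzK]
    rfl
  have hτs : ∀ I, ∀ z ∈ e.target, ContDiffAt ℝ ∞
      (fun w => Complex.exp (ℓ w) * chartRaised e g γ w I) z := fun I z hz =>
    (hℓs z hz).mul (h.1.contDiffAt_chartRaised g he hz I)
  rw [setIntegral_congr_fun e.open_target.measurableSet hleft,
    setIntegral_congr_fun e.open_target.measurableSet hright, integral_const_mul,
    integral_finsetSum _ fun l _ => integrable_finsetSum _ fun I _ => hint _ _
      (fun z hz => contDiffAt_wirtingerBar l (hcs z hz I)) (fun z hz => hXs z hz l I) (hdc0 l I),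
    integral_finsetSum _ fun I _ => hint _ _ (fun z hz => hcs z hz I) (hτs I) (hc0' I)] at hadj
  -- Boundary terms are absent because `c` is supported in the compact set `tsupport χ`.
  have hparts : ∀ l, ∫ z in e.target, ∑ I, wirtingerBar l (fun w => c w I) z * conj (X l I z) =
      -∑ I, ∫ z in e.target, c z I * conj (wirtinger l (X l I) z) := fun l => by
    rw [integral_finsetSum _ fun I _ => hint _ _
      (fun z hz => contDiffAt_wirtingerBar l (hcs z hz I)) (fun z hz => hXs z hz l I) (hdc0 l I),
      ← Finset.sum_neg_distrib]
    exact Finset.sum_congr rfl fun I _ => setIntegral_wirtingerBar_mul_conj e.open_target hK hχe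
      (fun z hz => hcs z hz I) (fun z hz => hXs z hz l I) (hc0' I) l
  rw [Finset.sum_congr rfl fun l _ => hparts l, Finset.sum_neg_distrib, Finset.sum_comm] at hadj
  have hDint : ∫ z in e.target, ∑ I, c z I * conj (D z I) = 0 := by
    have h1 : ∀ I, ∫ z in e.target, c z I * conj (D z I) =
        (∫ z in e.target, c z I * conj (Complex.exp (ℓ z) * chartRaised e g γ z I)) +
          ∑ l, ∫ z in e.target, c z I * conj (wirtinger l (X l I) z) := fun I => by
      rw [← integral_finsetSum _ fun l _ => hint _ _ (fun z hz => hcs z hz I)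
        (fun z hz => contDiffAt_wirtinger l (hXs z hz l I)) (hc0' I),
        ← integral_add (hint _ _ (fun z hz => hcs z hz I) (hτs I) (hc0' I))
          (integrable_finsetSum _ fun l _ => hint _ _ (fun z hz => hcs z hz I)
            (fun z hz => contDiffAt_wirtinger l (hXs z hz l I)) (hc0' I))]
      refine integral_congr_ae (Eventually.of_forall fun z => ?_)
      simp only [hD, map_add, map_sum, mul_add, Finset.mul_sum]
    rw [integral_finsetSum _ fun I _ => hint _ _ (fun z hz => hcs z hz I)
      (fun z hz => hDs z hz I) (hc0' I), Finset.sum_congr rfl fun I _ => h1 I,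
      Finset.sum_add_distrib]
    have hm : (m.factorial : ℂ) ≠ 0 := Nat.cast_ne_zero.2 m.factorial_ne_zero
    have hq : (q.factorial : ℂ) ≠ 0 := Nat.cast_ne_zero.2 q.factorial_ne_zero
    have hq1 : (q + 1 : ℂ) ≠ 0 := Nat.cast_add_one_ne_zero q
    rw [Nat.factorial_succ, Nat.cast_mul, Nat.cast_add_one] at hadj
    field_simp at hadj
    linear_combination -hadj
  have hpos : ∀ z ∈ e.target, 0 ≤ ∑ I, c z I * conj (D z I) := fun z hz => by
    have h1 := sum_tensorPow_mul_conj_nonneg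
      (posDef_metricMatrix g he (e.map_target hz)).transpose (D z)
    have h2 : (0 : ℂ) ≤ (χ z : ℂ) := Complex.zero_le_real.2 (hχ01 ⟨z, rfl⟩).1
    simp only [hc, mul_assoc]
    rw [← Finset.mul_sum]
    exact mul_nonneg h2 h1
  have hzero := eq_zero_of_setIntegral_eq_zero e.open_target hK hχe
    (fun z hz => (ContDiffAt.sum fun I _ => (hcs z hz I).mul
      (hDs z hz I).conj_complex).continuousAt.continuousWithinAt)
    (fun z hz hzK => Finset.sum_eq_zero fun I _ => by rw [hc0' I z hz hzK, zero_mul])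
    hpos hDint hz₀
  simp only [hc, hχ1, Complex.ofReal_one, one_mul] at hzero
  have hD0 := eq_zero_of_sum_tensorPow_mul_conj
    (posDef_metricMatrix g he (e.map_target hz₀)).transpose hzero
  exact eq_neg_of_add_eq_zero_left (congrFun hD0 I₀)

end Adjoint

/-! ### Independence of the chart -/

section Invariance

variable {m q : ℕ} {M : Type*} [TopologicalSpace M] [ChartedSpace (Fin m → ℂ) M]
  [IsManifold 𝓘(ℂ, Fin m → ℂ) ω M]
  {e e' : OpenPartialHomeomorph M (Fin m → ℂ)} {g : HermitianMetric m M}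
  {z : Fin m → ℂ}

theorem chartRaised_eq_mulVec {α : FormField m M q} (hα : ∀ x, IsConjLinear (α x))
    (he : e ∈ atlas (Fin m → ℂ) M) (he' : e' ∈ atlas (Fin m → ℂ) M)
    (hz : z ∈ e.target ∩ e.symm ⁻¹' e'.source) :
    chartRaised e' g α (e' (e.symm z)) = tensorPow (jacobian e e' z) *ᵥ chartRaised e g α z := by
  have h := raised_eq_mulVec g (hα (e.symm z)) he he' (e.map_target hz.1) hz.2
  rw [e.right_inv hz.1] at h
  rw [chartRaised, chartRaised, e'.left_inv hz.2, h]

/-- Raised components transform by the holomorphic Jacobian, which ∂̄ does not differentiate. So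
∂̄α^♯ is a tensor without any connection. -/
theorem sum_conj_jacobian_mul_wirtingerBar_chartRaised {α : FormField m M q}
    (hα : IsSmoothZeroQ α) (he : e ∈ atlas (Fin m → ℂ) M) (he' : e' ∈ atlas (Fin m → ℂ) M)
    (hz : z ∈ e.target ∩ e.symm ⁻¹' e'.source) (j : Fin m) (K : Fin q → Fin m) :
    ∑ b, conj (jacobian e e' z b j) *
        wirtingerBar b (fun w => chartRaised e' g α w K) (e' (e.symm z)) =
      (tensorPow (jacobian e e' z) *ᵥ
        fun I => wirtingerBar j (fun w => chartRaised e g α w I) z) K := by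
  have h1 : (fun w => chartRaised e' g α (e' (e.symm w)) K) =ᶠ[𝓝 z]
      fun w => (tensorPow (jacobian e e' w) *ᵥ chartRaised e g α w) K := by
    filter_upwards [(isOpen_overlap e e').mem_nhds hz] with w hw
    rw [chartRaised_eq_mulVec hα.isConjLinear he he' hw]
  have h2 := wirtingerBar_comp_holomorphic (u := fun w => chartRaised e' g α w K)
    (differentiableAt_transition he he' hz)
    (hα.contDiffAt_chartRaised g he' (transition_mem hz) K).differentiableAt_top j
  refine h2.symm.trans ?_
  rw [wirtingerBar_congr j h1, wirtingerBar_tensorPow_mulVec (contDiffAt_jacobian he he' hz)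
    (hα.contDiffAt_chartRaised g he hz.1)]
  simp [wirtingerBar_jacobian he he' hz]

theorem chartMetric_eq (he : e ∈ atlas (Fin m → ℂ) M) (he' : e' ∈ atlas (Fin m → ℂ) M)
    (hz : z ∈ e.target ∩ e.symm ⁻¹' e'.source) :
    metricMatrix g e (e.symm z) = (jacobian e e' z)ᵀ *
      metricMatrix g e' (e'.symm (e' (e.symm z))) * (jacobian e e' z).map conj := by
  have h := metricMatrix_eq g he he' (e.map_target hz.1) hz.2
  rw [e.right_inv hz.1] at h
  rw [e'.left_inv hz.2, h]

/-- All factors are tensors, and after contraction only the index l remains free; it transforms as a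
vector of type (1,0). This makes the divergence argument global. -/
theorem sum_jacobian_mul_bochnerField {α : FormField m M (q + 1)} (hα : IsSmoothZeroQ α)
    (he : e ∈ atlas (Fin m → ℂ) M) (he' : e' ∈ atlas (Fin m → ℂ) M)
    (hz : z ∈ e.target ∩ e.symm ⁻¹' e'.source) (k : Fin m) :
    ∑ l, jacobian e e' z k l *
        bochnerField (fun w => metricMatrix g e (e.symm w)) (chartRaised e g α) l z =
      bochnerField (fun w => metricMatrix g e' (e'.symm w)) (chartRaised e' g α) k
        (e' (e.symm z)) := by
  set A := jacobian e e' z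
  set G' := metricMatrix g e' (e'.symm (e' (e.symm z))) with hG'
  set X : Fin m → (Fin (q + 1) → Fin m) → ℂ := fun j K =>
    wirtingerBar j (fun w => chartRaised e g α w K) z with hX
  set X' : Fin m → (Fin (q + 1) → Fin m) → ℂ := fun j K =>
    wirtingerBar j (fun w => chartRaised e' g α w K) (e' (e.symm z)) with hX'
  set Y : Fin m → (Fin q → Fin m) → ℂ := fun j =>
    tensorPow (A.map conj) *ᵥ fun J => conj (chartRaised e g α z (Fin.cons j J)) with hY
  set Y' : Fin m → (Fin q → Fin m) → ℂ := fun j J =>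
    conj (chartRaised e' g α (e' (e.symm z)) (Fin.cons j J)) with hY'
  have h1 : ∀ j K, ∑ b, conj (A b j) * X' b K = (tensorPow A *ᵥ X j) K :=
    sum_conj_jacobian_mul_wirtingerBar_chartRaised hα he he' hz
  have h2 : ∀ b J, Y' b J = ∑ j, conj (A b j) * Y j J := by
    intro b J
    simp only [hY', chartRaised_eq_mulVec hα.isConjLinear he he' hz, tensorPow_mulVec_cons]
    rw [map_sum]
    refine Finset.sum_congr rfl fun j _ => ?_
    rw [map_mul]
    congr 1
    simp [hY, Matrix.mulVec, dotProduct, tensorPow_apply, A]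
  have h3 : ∀ l, bochnerField (fun w => metricMatrix g e (e.symm w)) (chartRaised e g α) l z =
      ∑ j, ∑ I, (tensorPow A *ᵥ fun I => X j (Fin.cons l I)) I * (tensorPow G' *ᵥ Y j) I := by
    intro l
    rw [bochnerField]
    refine Finset.sum_congr rfl fun j _ => ?_
    rw [chartMetric_eq he he' hz, tensorPow_mul, tensorPow_mul, ← Matrix.mulVec_mulVec,
      ← Matrix.mulVec_mulVec, tensorPow_transpose]
    simp only [mul_comm (wirtingerBar j _ z)]
    rw [mulVec_transpose_pairing]
    exact Finset.sum_congr rfl fun I _ => mul_comm _ _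
  have h4 : bochnerField (fun w => metricMatrix g e' (e'.symm w)) (chartRaised e' g α) k
      (e' (e.symm z)) = ∑ b, ∑ I, X' b (Fin.cons k I) * (tensorPow G' *ᵥ Y' b) I := rfl
  have h5 : ∀ b I, (tensorPow G' *ᵥ Y' b) I = ∑ j, conj (A b j) * (tensorPow G' *ᵥ Y j) I := by
    intro b I
    simp only [Matrix.mulVec, dotProduct, h2, Finset.mul_sum]
    rw [Finset.sum_comm]
    exact Finset.sum_congr rfl fun _ _ => Finset.sum_congr rfl fun _ _ => by ring
  have h6 : ∀ j I, ∑ l, A k l * (tensorPow A *ᵥ fun I => X j (Fin.cons l I)) I =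
      ∑ b, conj (A b j) * X' b (Fin.cons k I) := by
    intro j I
    rw [h1, tensorPow_mulVec_cons]
  calc ∑ l, A k l * bochnerField (fun w => metricMatrix g e (e.symm w)) (chartRaised e g α) l z
      = ∑ j, ∑ I, (∑ l, A k l * (tensorPow A *ᵥ fun I => X j (Fin.cons l I)) I) *
          (tensorPow G' *ᵥ Y j) I := by
        simp only [h3, Finset.mul_sum, Finset.sum_mul]
        rw [Finset.sum_comm]
        refine Finset.sum_congr rfl fun j _ => ?_
        rw [Finset.sum_comm]
        exact Finset.sum_congr rfl fun _ _ => Finset.sum_congr rfl fun _ _ => by ring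
    _ = ∑ b, ∑ I, X' b (Fin.cons k I) * ∑ j, conj (A b j) * (tensorPow G' *ᵥ Y j) I := by
        simp only [h6, Finset.mul_sum, Finset.sum_mul]
        rw [Finset.sum_comm]
        conv_rhs => rw [Finset.sum_comm]
        refine Finset.sum_congr rfl fun I _ => ?_
        rw [Finset.sum_comm]
        exact Finset.sum_congr rfl fun _ _ => Finset.sum_congr rfl fun _ _ => by ring
    _ = _ := by simp only [h4, h5]

variable (e g) in
/-- The derivative of `φ` along the Bochner vector field of `α`, in the chart `e`. -/
def bochnerDeriv (α : FormField m M (q + 1)) (φ : M → ℝ) (w : Fin m → ℂ) : ℂ :=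
  ∑ l, wirtinger l (fun w => (φ (e.symm w) : ℂ)) w *
    bochnerField (fun w => metricMatrix g e (e.symm w)) (chartRaised e g α) l w

theorem bochnerDeriv_eq {α : FormField m M (q + 1)} (hα : IsSmoothZeroQ α) {φ : M → ℝ}
    (hφ : ∀ e ∈ atlas (Fin m → ℂ) M, ∀ z ∈ e.target, ContDiffAt ℝ ∞ (fun w => φ (e.symm w)) z)
    (he : e ∈ atlas (Fin m → ℂ) M) (he' : e' ∈ atlas (Fin m → ℂ) M)
    (hz : z ∈ e.target ∩ e.symm ⁻¹' e'.source) :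
    bochnerDeriv e g α φ z = bochnerDeriv e' g α φ (e' (e.symm z)) := by
  have h1 : ∀ l, wirtinger l (fun w => (φ (e.symm w) : ℂ)) z =
      ∑ k, jacobian e e' z k l *
        wirtinger k (fun w => (φ (e'.symm w) : ℂ)) (e' (e.symm z)) := by
    intro l
    refine Eq.trans ?_ (wirtinger_comp_holomorphic (u := fun w => (φ (e'.symm w) : ℂ))
      (differentiableAt_transition he he' hz)
      (contDiffAt_ofReal_comp (hφ e' he' _ (transition_mem hz))).differentiableAt_top l)
    refine wirtinger_congr l ?_
    filter_upwards [(isOpen_overlap e e').mem_nhds hz] with w hw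
    rw [e'.left_inv hw.2]
  rw [bochnerDeriv, bochnerDeriv]
  simp only [h1, ← sum_jacobian_mul_bochnerField hα he he' hz, Finset.sum_mul, Finset.mul_sum]
  rw [Finset.sum_comm]
  exact Finset.sum_congr rfl fun _ _ => Finset.sum_congr rfl fun _ _ => by ring

end Invariance

/-! ### The integrated Bochner formula -/

section Global

variable {m q : ℕ} {M : Type*} [TopologicalSpace M] [ChartedSpace (Fin m → ℂ) M]
  [IsManifold 𝓘(ℂ, Fin m → ℂ) ω M] [CompactSpace M] [T2Space M]
  {e : OpenPartialHomeomorph M (Fin m → ℂ)} {g : HermitianMetric m M} {f : M → ℝ} {lam : ℂ}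
  {z : Fin m → ℂ}

theorem chartComponents_smul (e : OpenPartialHomeomorph M (Fin m → ℂ)) (η : FormField m M q)
    (c : ℂ) (w : Fin m → ℂ) (J : Fin q → Fin m) :
    chartComponents e (c • η) w J = c * chartComponents e η w J := rfl

theorem dbarComponents_const_mul (a : (Fin m → ℂ) → (Fin q → Fin m) → ℂ) (c : ℂ)
    (z : Fin m → ℂ) (K : Fin (q + 1) → Fin m) :
    dbarComponents (fun w J => c * a w J) z K = c * dbarComponents a z K := by
  simp only [dbarComponents, wirtingerBar_const_mul, Finset.mul_sum]
  exact Finset.sum_congr rfl fun b _ => by ring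

theorem dbarComponents_add {a b : (Fin m → ℂ) → (Fin q → Fin m) → ℂ}
    (ha : ∀ J, ContDiffAt ℝ ∞ (fun w => a w J) z) (hb : ∀ J, ContDiffAt ℝ ∞ (fun w => b w J) z)
    (K : Fin (q + 1) → Fin m) :
    dbarComponents (fun w J => a w J + b w J) z K = dbarComponents a z K + dbarComponents b z K := by
  simp only [dbarComponents, ← Finset.sum_add_distrib]
  refine Finset.sum_congr rfl fun k _ => ?_
  rw [wirtingerBar_add _ (ha _) (hb _), mul_add]

/-- The `∂̄`-derivative of the equation `Δ_f η = λ η`. -/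
theorem IsWeightedLaplacian.exists_adjoint {η : FormField m M q} (hη : IsSmoothZeroQ η)
    (h : IsWeightedLaplacian g f η (lam • η)) :
    ∃ γ, IsDbarAdjoint g f (dbar η) γ ∧ ∀ e ∈ atlas (Fin m → ℂ) M, ∀ z ∈ e.target, ∀ K,
      dbarComponents (chartComponents e γ) z K = lam * chartComponents e (dbar η) z K := by
  cases q with
  | zero =>
    -- On functions ∂̄_f^*∂̄η is already λη, so ∂̄ is applied to λη directly.
    refine ⟨lam • η, h, fun e he z hz K => ?_⟩
    rw [hη.chartComponents_dbar he hz, ← dbarComponents_const_mul]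
    rfl
  | succ q =>
    -- Here λη = γ + ∂̄β, and the second term is removed by ∂̄² = 0.
    obtain ⟨γ, β, hγ, hβ, hsum⟩ := h
    refine ⟨γ, hγ, fun e he z hz K => ?_⟩
    have h1 : (fun w J => lam * chartComponents e η w J) =
        fun w J => chartComponents e γ w J + chartComponents e (dbar β) w J := by
      funext w J
      rw [← chartComponents_smul, hsum]
      rfl
    rw [hη.chartComponents_dbar he hz, ← dbarComponents_const_mul, h1,
      dbarComponents_add (hγ.1.contDiffAt_chartComponents he hz)
        (hβ.1.dbar.contDiffAt_chartComponents he hz),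
      hβ.1.dbarComponents_chartComponents_dbar he hz]
    simp

theorem lower_chartRaised (he : e ∈ atlas (Fin m → ℂ) M) (hz : z ∈ e.target)
    (α : FormField m M q) :
    tensorPow (metricMatrix g e (e.symm z))ᵀ *ᵥ chartRaised e g α z = chartComponents e α z :=
  lower_raised g he (e.map_target hz) α

variable (e g) in
/-- The squared norm of `α`, up to a constant factor, in the chart `e`. -/
def chartNormSq (α : FormField m M q) (w : Fin m → ℂ) : ℂ :=
  ∑ K, (tensorPow (metricMatrix g e (e.symm w))ᵀ *ᵥ chartRaised e g α w) K *
    conj (chartRaised e g α w K)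

variable (e g) in
/-- The squared norm of `∂̄α^♯`, up to a constant factor, in the chart `e`. -/
def chartDbarNormSq (α : FormField m M (q + 1)) (w : Fin m → ℂ) : ℂ :=
  dbarNormSq (fun w => metricMatrix g e (e.symm w)) (fun w => invMatrix g e (e.symm w))
    (chartRaised e g α) w

variable (e g) in
/-- The Bochner vector field of `α` in the chart `e`. -/
def chartBochnerField (α : FormField m M (q + 1)) (l : Fin m) (w : Fin m → ℂ) : ℂ :=
  bochnerField (fun w => metricMatrix g e (e.symm w)) (chartRaised e g α) l w

theorem bochner_formula_chart (hg : IsKahler g) (hf : IsRicciPotential g f)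
    {η : FormField m M q} (hη : IsSmoothZeroQ η) {γ : FormField m M q}
    (hγ : IsDbarAdjoint g f (dbar η) γ)
    (heigen : ∀ e ∈ atlas (Fin m → ℂ) M, ∀ z ∈ e.target, ∀ K,
      dbarComponents (chartComponents e γ) z K = lam * chartComponents e (dbar η) z K)
    (he : e ∈ atlas (Fin m → ℂ) M) (hz : z ∈ e.target) :
    (q + 1) * ∑ l, wirtinger l
        (fun w => Complex.exp (localWeight e g f w) * chartBochnerField e g (dbar η) l w) z =
      Complex.exp (localWeight e g f z) * ((q + 1 - lam) * chartNormSq e g (dbar η) z +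
        chartDbarNormSq e g (dbar η) z) := by
  have hU := e.open_target.mem_nhds hz
  have hlow : ∀ {r : ℕ} (α : FormField m M r), (fun w =>
      tensorPow (metricMatrix g e (e.symm w))ᵀ *ᵥ chartRaised e g α w) =ᶠ[𝓝 z]
        chartComponents e α := fun α =>
    Filter.mem_of_superset hU fun w hw => lower_chartRaised he hw α
  have h := bochner_formula (q := q) (z := z) (lam := lam) (ℓ := localWeight e g f)
    (G := fun w => metricMatrix g e (e.symm w)) (H := fun w => invMatrix g e (e.symm w))
    (σ := chartRaised e g (dbar η)) (τ := chartRaised e g γ)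
    (Filter.mem_of_superset hU fun w hw => hf.contDiffAt_localWeight he hw)
    (contDiffAt_metricMatrix g he hz)
    (metricMatrix_mul_invMatrix_transpose g he (e.map_target hz)) (invMatrix_conj g e _)
    (hg.wirtinger_metricMatrix he hz) (hg.wirtingerBar_metricMatrix he hz)
    (hf.wirtinger_wirtingerBar_localWeight he hz)
    (Filter.mem_of_superset hU fun w hw => hη.dbar.contDiffAt_chartRaised g he hw)
    (Eventually.of_forall fun w => isAntisymm_chartRaised e g _ w)
    (hγ.1.contDiffAt_chartRaised g he hz)
    (Filter.mem_of_superset hU fun w hw => hγ.raised_eq hf hη.dbar he hw)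
    (fun K => by
      rw [lower_chartRaised he hz, ← heigen e he z hz K]
      exact congrFun (dbarComponents_congr (hlow γ)) K)
    (fun K => (congrFun (dbarComponents_congr (hlow (dbar η))) K).trans
      (congrFun (hη.dbarComponents_chartComponents_dbar he hz) K))
  have hexp : Complex.exp (localWeight e g f z) * Complex.exp (-localWeight e g f z) = 1 := by
    rw [← Complex.exp_add]
    simp
  rw [chartNormSq, chartDbarNormSq, ← h, ← Finset.mul_sum, mul_left_comm, ← mul_assoc (Complex.exp _),
    hexp, one_mul]
  rfl

theorem chartNormSq_nonneg (he : e ∈ atlas (Fin m → ℂ) M) (hz : z ∈ e.target)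
    (α : FormField m M q) : 0 ≤ chartNormSq e g α z :=
  sum_tensorPow_mul_conj_nonneg (posDef_metricMatrix g he (e.map_target hz)).transpose _

theorem chartComponents_eq_zero_of_chartNormSq (he : e ∈ atlas (Fin m → ℂ) M) (hz : z ∈ e.target)
    {α : FormField m M q} (h : chartNormSq e g α z = 0) : chartComponents e α z = 0 := by
  rw [← lower_chartRaised (g := g) he hz, eq_zero_of_sum_tensorPow_mul_conj
    (posDef_metricMatrix g he (e.map_target hz)).transpose h, Matrix.mulVec_zero]

theorem chartDbarNormSq_nonneg (he : e ∈ atlas (Fin m → ℂ) M) (hz : z ∈ e.target)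
    (α : FormField m M (q + 1)) : 0 ≤ chartDbarNormSq e g α z :=
  dbarNormSq_nonneg (posDef_metricMatrix g he (e.map_target hz))
    (metricMatrix_transpose_mul_invMatrix g he (e.map_target hz))

theorem contDiffAt_chartNormSq {α : FormField m M q} (hα : IsSmoothZeroQ α)
    (he : e ∈ atlas (Fin m → ℂ) M) (hz : z ∈ e.target) :
    ContDiffAt ℝ ∞ (chartNormSq e g α) z :=
  ContDiffAt.sum fun K _ => (contDiffAt_tensorPow_mulVec
    (P := fun w => (metricMatrix g e (e.symm w))ᵀ)
    (fun i j => contDiffAt_metricMatrix g he hz j i) (hα.contDiffAt_chartRaised g he hz) K).mul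
      (hα.contDiffAt_chartRaised g he hz K).conj_complex

theorem contDiffAt_chartDbarNormSq {α : FormField m M (q + 1)} (hα : IsSmoothZeroQ α)
    (he : e ∈ atlas (Fin m → ℂ) M) (hz : z ∈ e.target) :
    ContDiffAt ℝ ∞ (chartDbarNormSq e g α) z :=
  ContDiffAt.sum fun K _ => (contDiffAt_tensorPow_mulVec
    (P := fun w => (metricMatrix g e (e.symm w))ᵀ)
    (u := fun w I => wirtingerBar (K 0) (fun w => chartRaised e g α w I) w)
    (fun i j => contDiffAt_metricMatrix g he hz j i)
    (fun I => contDiffAt_wirtingerBar _ (hα.contDiffAt_chartRaised g he hz I)) _).mul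
      (ContDiffAt.conj_complex (ContDiffAt.sum fun j _ => (contDiffAt_invMatrix g he hz _ j).mul
        (contDiffAt_wirtingerBar j (hα.contDiffAt_chartRaised g he hz _))))

theorem contDiffAt_chartBochnerField {α : FormField m M (q + 1)} (hα : IsSmoothZeroQ α)
    (he : e ∈ atlas (Fin m → ℂ) M) (hz : z ∈ e.target) (l : Fin m) :
    ContDiffAt ℝ ∞ (chartBochnerField e g α l) z := by
  unfold chartBochnerField bochnerField
  exact ContDiffAt.sum fun j _ => ContDiffAt.sum fun I _ =>
    (contDiffAt_wirtingerBar j (hα.contDiffAt_chartRaised g he hz _)).mul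
      (contDiffAt_tensorPow_mulVec (P := fun w => metricMatrix g e (e.symm w))
        (u := fun w J => conj (chartRaised e g α w (Fin.cons j J)))
        (contDiffAt_metricMatrix g he hz)
        (fun J => (hα.contDiffAt_chartRaised g he hz _).conj_complex) I)

theorem bochnerDeriv_eq_zero {α : FormField m M (q + 1)} {φ : M → ℝ} (hz : z ∈ e.target)
    (h : e.symm z ∉ tsupport φ) : bochnerDeriv e g α φ z = 0 := by
  refine Finset.sum_eq_zero fun l _ => ?_
  have h1 : (fun w => (φ (e.symm w) : ℂ)) =ᶠ[𝓝 z] fun _ => 0 := by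
    filter_upwards [(e.continuousAt_symm hz).eventually
      ((isClosed_tsupport φ).isOpen_compl.mem_nhds h)] with w hw
    rw [image_eq_zero_of_notMem_tsupport hw, Complex.ofReal_zero]
  rw [wirtinger_congr l h1, wirtinger_const, zero_mul]

/-- The Bochner formula integrated against a cut-off function supported in a chart. -/
theorem setIntegral_bochner (hg : IsKahler g) (hf : IsRicciPotential g f)
    {η : FormField m M q} (hη : IsSmoothZeroQ η) {γ : FormField m M q}
    (hγ : IsDbarAdjoint g f (dbar η) γ)
    (heigen : ∀ e ∈ atlas (Fin m → ℂ) M, ∀ z ∈ e.target, ∀ K,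
      dbarComponents (chartComponents e γ) z K = lam * chartComponents e (dbar η) z K)
    (he : e ∈ atlas (Fin m → ℂ) M) {χ : M → ℝ}
    (hχ : ∀ z ∈ e.target, ContDiffAt ℝ ∞ (fun w => χ (e.symm w)) z)
    (hχe : tsupport χ ⊆ e.source) :
    (q + 1) * (∫ z in e.target,
        Complex.exp (localWeight e g f z) * bochnerDeriv e g (dbar η) χ z) +
      ((q + 1 - lam) * (∫ z in e.target, (χ (e.symm z) : ℂ) *
        (Complex.exp (localWeight e g f z) * chartNormSq e g (dbar η) z)) +
      ∫ z in e.target, (χ (e.symm z) : ℂ) *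
        (Complex.exp (localWeight e g f z) * chartDbarNormSq e g (dbar η) z)) = 0 := by
  set ℓ := localWeight e g f
  have hα := hη.dbar
  have hK := isCompact_image_tsupport hχe
  have hKe := image_tsupport_subset hχe
  have hχ0 : ∀ z ∈ e.target, z ∉ e '' tsupport χ → (χ (e.symm z) : ℂ) = 0 := fun z hz h => by
    rw [eq_zero_of_notMem_image_tsupport hz h, Complex.ofReal_zero]
  have hχc : ∀ z ∈ e.target, ContDiffAt ℝ ∞ (fun w => (χ (e.symm w) : ℂ)) z := fun z hz =>
    contDiffAt_ofReal_comp (hχ z hz)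
  have hexp : ∀ z ∈ e.target, ContDiffAt ℝ ∞ (fun w => Complex.exp (ℓ w)) z := fun z hz =>
    (hf.contDiffAt_localWeight he hz).cexp
  have hX : ∀ l, ∀ z ∈ e.target,
      ContDiffAt ℝ ∞ (fun w => Complex.exp (ℓ w) * chartBochnerField e g (dbar η) l w) z :=
    fun l z hz => (hexp z hz).mul (contDiffAt_chartBochnerField hα he hz l)
  -- The cut-off makes χ e^ℓ V compactly supported, so its divergence integrates to zero. The
  -- product rule splits it into the derivative of χ along V and χ times the Bochner identity.
  have hzero : ∀ l, ∫ z in e.target, wirtinger l (fun w => (χ (e.symm w) : ℂ) *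
      (Complex.exp (ℓ w) * chartBochnerField e g (dbar η) l w)) z = 0 := fun l =>
    setIntegral_wirtinger_eq_zero e.open_target hK hKe
      (fun z hz => (hχc z hz).mul (hX l z hz))
      (fun z hz h => by rw [hχ0 z hz h, zero_mul]) l
  have hint : ∀ {u : (Fin m → ℂ) → ℂ}, (∀ z ∈ e.target, ContDiffAt ℝ ∞ u z) →
      (∀ z ∈ e.target, z ∉ e '' tsupport χ → u z = 0) → IntegrableOn u e.target := fun hu h0 =>
    integrableOn_of_compact_support e.open_target hK hKe
      (fun z hz => (hu z hz).continuousAt.continuousWithinAt) h0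
  have hB : ∀ z ∈ e.target, z ∉ e '' tsupport χ → bochnerDeriv e g (dbar η) χ z = 0 :=
    fun z hz h => bochnerDeriv_eq_zero hz fun hmem => h ⟨_, hmem, e.right_inv hz⟩
  have hI1 : IntegrableOn (fun z => Complex.exp (ℓ z) * bochnerDeriv e g (dbar η) χ z) e.target :=
    hint (fun z hz => (hexp z hz).mul (ContDiffAt.sum fun l _ =>
      (contDiffAt_wirtinger l (hχc z hz)).mul (contDiffAt_chartBochnerField hα he hz l)))
      fun z hz h => by rw [hB z hz h, mul_zero]
  have hI2 : IntegrableOn (fun z => (χ (e.symm z) : ℂ) *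
      (Complex.exp (ℓ z) * chartNormSq e g (dbar η) z)) e.target :=
    hint (fun z hz => (hχc z hz).mul ((hexp z hz).mul (contDiffAt_chartNormSq hα he hz)))
      fun z hz h => by rw [hχ0 z hz h, zero_mul]
  have hI3 : IntegrableOn (fun z => (χ (e.symm z) : ℂ) *
      (Complex.exp (ℓ z) * chartDbarNormSq e g (dbar η) z)) e.target :=
    hint (fun z hz => (hχc z hz).mul ((hexp z hz).mul (contDiffAt_chartDbarNormSq hα he hz)))
      fun z hz h => by rw [hχ0 z hz h, zero_mul]
  have hsum : ∫ z in e.target, (q + 1 : ℂ) * ∑ l, wirtinger l (fun w => (χ (e.symm w) : ℂ) *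
      (Complex.exp (ℓ w) * chartBochnerField e g (dbar η) l w)) z = 0 := by
    rw [integral_const_mul, integral_finsetSum]
    · simp [hzero]
    · intro l _
      refine hint (fun z hz => contDiffAt_wirtinger l ((hχc z hz).mul (hX l z hz))) ?_
      intro z hz h
      have h1 : (fun w => (χ (e.symm w) : ℂ) *
          (Complex.exp (ℓ w) * chartBochnerField e g (dbar η) l w)) =ᶠ[𝓝 z] fun _ => 0 := by
        filter_upwards [e.open_target.mem_nhds hz, hK.isClosed.isOpen_compl.mem_nhds h]
          with w hw hwK
        rw [hχ0 w hw hwK, zero_mul]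
      rw [wirtinger_congr l h1, wirtinger_const]
  rw [← hsum, ← integral_const_mul, ← integral_const_mul, ← integral_add (hI2.const_mul _) hI3,
    ← integral_add (hI1.const_mul _) ((hI2.const_mul _).fun_add hI3)]
  refine setIntegral_congr_fun e.open_target.measurableSet fun z hz => ?_
  have h1 := bochner_formula_chart hg hf hη hγ heigen he hz
  have h2 : ∀ l, wirtinger l (fun w => (χ (e.symm w) : ℂ) *
      (Complex.exp (ℓ w) * chartBochnerField e g (dbar η) l w)) z =
      wirtinger l (fun w => (χ (e.symm w) : ℂ)) z *
        (Complex.exp (ℓ z) * chartBochnerField e g (dbar η) l z) + (χ (e.symm z) : ℂ) *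
          wirtinger l (fun w => Complex.exp (ℓ w) * chartBochnerField e g (dbar η) l w) z :=
    fun l => wirtinger_mul l (hχc z hz) (hX l z hz)
  have h3 : ∑ l, wirtinger l (fun w => (χ (e.symm w) : ℂ)) z *
      (Complex.exp (ℓ z) * chartBochnerField e g (dbar η) l z) =
      Complex.exp (ℓ z) * bochnerDeriv e g (dbar η) χ z := by
    rw [bochnerDeriv, Finset.mul_sum]
    exact Finset.sum_congr rfl fun l _ => mul_left_comm _ _ _
  simp only [h2, Finset.sum_add_distrib, ← Finset.mul_sum]
  rw [h3]
  linear_combination -(χ (e.symm z) : ℂ) * h1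

end Global

/-! ### The first eigenvalue -/

section Eigenvalue

variable {m q : ℕ} {M : Type*} [TopologicalSpace M] [ChartedSpace (Fin m → ℂ) M]
  [IsManifold 𝓘(ℂ, Fin m → ℂ) ω M] [CompactSpace M] [T2Space M]
  {e : OpenPartialHomeomorph M (Fin m → ℂ)} {g : HermitianMetric m M} {f : M → ℝ} {lam : ℂ}
  {z : Fin m → ℂ}

/-- The cut-off functions sum to the constant 1, whose derivative is zero. -/
theorem sum_bochnerDeriv_eq_zero {S : Finset M} {χ : M → M → ℝ}
    (hχ : ∀ p, ∀ z ∈ e.target, ContDiffAt ℝ ∞ (fun w => χ p (e.symm w)) z)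
    (hχ1 : ∀ x, ∑ p ∈ S, χ p x = 1) (α : FormField m M (q + 1)) (hz : z ∈ e.target) :
    ∑ p ∈ S, bochnerDeriv e g α (χ p) z = 0 := by
  simp only [bochnerDeriv]
  rw [Finset.sum_comm]
  refine Finset.sum_eq_zero fun l _ => ?_
  rw [← Finset.sum_mul, ← wirtinger_sum _ _ fun p _ => contDiffAt_ofReal_comp (hχ p z hz)]
  have h1 : (fun w => ∑ p ∈ S, (χ p (e.symm w) : ℂ)) = fun _ => 1 := by
    funext w
    rw [← Complex.ofReal_sum, hχ1, Complex.ofReal_one]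
  rw [h1, wirtinger_const, zero_mul]

/-- The summands live in different charts. By chart independence each is, up to a common nonzero
constant, the integral over `M` of a global function; under one integral the sum vanishes pointwise.
-/
theorem sum_setIntegral_bochnerDeriv_eq_zero (hf : IsRicciPotential g f)
    {α : FormField m M (q + 1)} (hα : IsSmoothZeroQ α) {S : Finset M} {χ : M → M → ℝ}
    (hχ : ∀ p, ∀ e ∈ atlas (Fin m → ℂ) M, ∀ z ∈ e.target,
      ContDiffAt ℝ ∞ (fun w => χ p (e.symm w)) z)
    (hχe : ∀ p, tsupport (χ p) ⊆ (chartAt (Fin m → ℂ) p).source)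
    (hχ1 : ∀ x, ∑ p ∈ S, χ p x = 1) :
    ∑ p ∈ S, ∫ z in (chartAt (Fin m → ℂ) p).target,
      Complex.exp (localWeight (chartAt (Fin m → ℂ) p) g f z) *
        bochnerDeriv (chartAt (Fin m → ℂ) p) g α (χ p) z = 0 := by
  set u : M → M → ℂ := fun p x => (Real.exp (f x) : ℂ) *
    bochnerDeriv (chartAt (Fin m → ℂ) x) g α (χ p) (chartAt (Fin m → ℂ) x x) with hu
  have hchart : ∀ p, ∀ e ∈ atlas (Fin m → ℂ) M, ∀ z ∈ e.target,
      u p (e.symm z) = (Real.exp (f (e.symm z)) : ℂ) * bochnerDeriv e g α (χ p) z := by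
    intro p e he z hz
    rw [hu, bochnerDeriv_eq hα (hχ p) he (chart_mem_atlas _ (e.symm z))
      ⟨hz, mem_chart_source _ (e.symm z)⟩]
  have hcont : ∀ p, ∀ e ∈ atlas (Fin m → ℂ) M,
      ContinuousOn (fun z => u p (e.symm z)) e.target := by
    intro p e he
    refine ContinuousOn.congr (f := fun z => (Real.exp (f (e.symm z)) : ℂ) *
      bochnerDeriv e g α (χ p) z) (fun z hz => ?_) (hchart p e he)
    have h1 : ContDiffAt ℝ ∞ (bochnerDeriv e g α (χ p)) z :=
      ContDiffAt.sum fun l _ => (contDiffAt_wirtinger l (contDiffAt_ofReal_comp (hχ p e he z hz))).mul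
        (contDiffAt_chartBochnerField hα he hz l)
    exact ((contDiffAt_ofReal_comp (hf.contDiffAt he hz).exp).mul
      h1).continuousAt.continuousWithinAt
  have h1 : ∀ p, integral g (u p) = (m.factorial : ℂ) * 2 ^ m *
      ∫ z in (chartAt (Fin m → ℂ) p).target,
        Complex.exp (localWeight (chartAt (Fin m → ℂ) p) g f z) *
          bochnerDeriv (chartAt (Fin m → ℂ) p) g α (χ p) z := by
    intro p
    have hp := chart_mem_atlas (Fin m → ℂ) p
    rw [integral_eq_chartIntegral g hp (isClosed_tsupport (χ p)).isCompact (hχe p)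
      (hcont p _ hp), chartIntegral, ← integral_const_mul]
    · refine setIntegral_congr_fun (chartAt (Fin m → ℂ) p).open_target.measurableSet fun z hz => ?_
      rw [hchart p _ hp z hz, exp_localWeight hp hz, volumeDensity]
      ring
    · intro x hx
      have h2 : (chartAt (Fin m → ℂ) x).symm (chartAt (Fin m → ℂ) x x) = x :=
        (chartAt (Fin m → ℂ) x).left_inv (mem_chart_source _ x)
      rw [hu]
      beta_reduce
      rw [bochnerDeriv_eq_zero (mem_chart_target _ x) (by rwa [h2]), mul_zero]
  have h2 : integral g (fun x => ∑ p ∈ S, u p x) = 0 := by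
    have h3 : (fun x => ∑ p ∈ S, u p x) = fun _ => 0 := by
      funext x
      rw [hu, ← Finset.mul_sum, sum_bochnerDeriv_eq_zero
        (fun p => hχ p _ (chart_mem_atlas _ x)) hχ1 α (mem_chart_target _ x), mul_zero]
    rw [h3, integral]
    simp
  rw [integral_finset_sum g S fun p _ => hcont p, Finset.sum_congr rfl fun p _ => h1 p,
    ← Finset.mul_sum] at h2
  refine (mul_eq_zero.1 h2).resolve_left (mul_ne_zero ?_ (pow_ne_zero _ two_ne_zero))
  exact Nat.cast_ne_zero.2 m.factorial_ne_zero

theorem setIntegral_nonneg_complex {U : Set (Fin m → ℂ)} (hU : MeasurableSet U)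
    {h : (Fin m → ℂ) → ℂ} (hpos : ∀ z ∈ U, 0 ≤ h z) : 0 ≤ ∫ z in U, h z := by
  have h1 : ∫ z in U, h z = ((∫ z in U, (h z).re : ℝ) : ℂ) := by
    rw [← integral_complex_ofReal]
    exact setIntegral_congr_fun hU fun z hz => Complex.ext rfl (Complex.le_def.1 (hpos z hz)).2.symm
  rw [h1]
  exact Complex.zero_le_real.2 (setIntegral_nonneg hU fun z hz => (Complex.le_def.1 (hpos z hz)).1)

/-- The two families of ∂̄-derivatives differ by an invertible linear transformation. This carries
holomorphy from the charts of the partition of unity to an arbitrary chart. -/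
theorem wirtingerBar_chartRaised_eq_zero_of_overlap {e' : OpenPartialHomeomorph M (Fin m → ℂ)}
    {α : FormField m M q} (hα : IsSmoothZeroQ α) (he : e ∈ atlas (Fin m → ℂ) M)
    (he' : e' ∈ atlas (Fin m → ℂ) M) (hz : z ∈ e.target ∩ e.symm ⁻¹' e'.source)
    (h : ∀ j K, wirtingerBar j (fun w => chartRaised e' g α w K) (e' (e.symm z)) = 0)
    (j : Fin m) (K : Fin q → Fin m) :
    wirtingerBar j (fun w => chartRaised e g α w K) z = 0 := by
  have h1 : tensorPow (jacobian e e' z) *ᵥ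
      (fun I => wirtingerBar j (fun w => chartRaised e g α w I) z) = 0 := by
    funext K
    rw [← sum_conj_jacobian_mul_wirtingerBar_chartRaised hα he he' hz j K]
    simp [h]
  have h2 : jacobian e' e (e' (e.symm z)) * jacobian e e' z = 1 := by
    have := jacobian_mul_jacobian he' he hz.2 (e.map_target hz.1)
    rwa [e.right_inv hz.1] at this
  have h3 := congrArg (fun v => tensorPow (jacobian e' e (e' (e.symm z))) *ᵥ v) h1
  simp only [Matrix.mulVec_mulVec, ← tensorPow_mul, h2, tensorPow_one, Matrix.one_mulVec,
    Matrix.mulVec_zero] at h3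
  exact congrFun h3 K

theorem wirtingerBar_eq_zero_of_chartDbarNormSq (he : e ∈ atlas (Fin m → ℂ) M) (hz : z ∈ e.target)
    {α : FormField m M (q + 1)} (h : chartDbarNormSq e g α z = 0) (j : Fin m)
    (K : Fin (q + 1) → Fin m) : wirtingerBar j (fun w => chartRaised e g α w K) z = 0 :=
  wirtingerBar_eq_zero_of_dbarNormSq (G := fun w => metricMatrix g e (e.symm w))
    (H := fun w => invMatrix g e (e.symm w)) (posDef_metricMatrix g he (e.map_target hz))
    (metricMatrix_transpose_mul_invMatrix g he (e.map_target hz)) h j K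

theorem eq_zero_of_chartComponents {α : FormField m M q} (hα : ∀ x, IsConjLinear (α x))
    (he : e ∈ atlas (Fin m → ℂ) M) {x : M} (hx : x ∈ e.source)
    (h : chartComponents e α (e x) = 0) : α x = 0 := by
  rw [chartComponents, e.left_inv hx] at h
  ext v
  have hv : v = fun k => ∑ i, chartDeriv e x (v k) i • frame e x i := by
    funext k
    rw [← coordInv_sum, coordInv_chartDeriv he hx]
  rw [hv, (hα x).map_sum_smul]
  have h1 : ∀ K : Fin q → Fin m, α x (fun k => frame e x (K k)) = 0 := congrFun h
  simp [h1]

/-- The eigenvalue estimate, with the equality case. -/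
theorem IsWeightedLaplacian.eigenvalue_bound (hg : IsKahler g) (hf : IsRicciPotential g f)
    {η : FormField m M q} (hη : IsSmoothZeroQ η) (h : IsWeightedLaplacian g f η (lam • η))
    (hne : dbar η ≠ 0) :
    lam.im = 0 ∧ (q + 1 : ℝ) ≤ lam.re ∧ (lam = q + 1 → ∀ e ∈ atlas (Fin m → ℂ) M,
      ∀ z ∈ e.target, ∀ j K, wirtingerBar j (fun w => chartRaised e g (dbar η) w K) z = 0) := by
  obtain ⟨γ, hγ, heigen⟩ := h.exists_adjoint hη
  obtain ⟨S, χ, hχ, -, hχ0, hχe, hχ1⟩ := exists_smooth_partition m M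
  have hα := hη.dbar
  have hat : ∀ p : M, chartAt (Fin m → ℂ) p ∈ atlas (Fin m → ℂ) M := fun p => chart_mem_atlas _ p
  set N : M → (Fin m → ℂ) → ℂ := fun p z => (χ p ((chartAt (Fin m → ℂ) p).symm z) : ℂ) *
    (Complex.exp (localWeight (chartAt (Fin m → ℂ) p) g f z) *
      chartNormSq (chartAt (Fin m → ℂ) p) g (dbar η) z) with hN
  set E : M → (Fin m → ℂ) → ℂ := fun p z => (χ p ((chartAt (Fin m → ℂ) p).symm z) : ℂ) *
    (Complex.exp (localWeight (chartAt (Fin m → ℂ) p) g f z) *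
      chartDbarNormSq (chartAt (Fin m → ℂ) p) g (dbar η) z) with hE
  have hexp : ∀ (e : OpenPartialHomeomorph M (Fin m → ℂ)) z,
      0 ≤ Complex.exp (localWeight e g f z) := by
    intro e z
    rw [localWeight, ← Complex.ofReal_add, ← Complex.ofReal_exp]
    exact Complex.zero_le_real.2 (Real.exp_pos _).le
  have hχC : ∀ p x, (0 : ℂ) ≤ (χ p x : ℂ) := fun p x => Complex.zero_le_real.2 (hχ0 p x)
  have hNpos : ∀ p, ∀ z ∈ (chartAt (Fin m → ℂ) p).target, 0 ≤ N p z := fun p z hz =>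
    mul_nonneg (hχC _ _) (mul_nonneg (hexp _ _) (chartNormSq_nonneg (hat p) hz _))
  have hEpos : ∀ p, ∀ z ∈ (chartAt (Fin m → ℂ) p).target, 0 ≤ E p z := fun p z hz =>
    mul_nonneg (hχC _ _) (mul_nonneg (hexp _ _) (chartDbarNormSq_nonneg (hat p) hz _))
  -- Summing the localized identities over the partition removes the terms with derivatives of the
  -- cut-offs and leaves (q+1-λ)N + E = 0.
  have hmain : (q + 1 - lam) * (∑ p ∈ S, ∫ z in (chartAt (Fin m → ℂ) p).target, N p z) +
      ∑ p ∈ S, ∫ z in (chartAt (Fin m → ℂ) p).target, E p z = 0 := by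
    have h1 := Finset.sum_congr (rfl : S = S) fun p _ =>
      setIntegral_bochner hg hf hη hγ heigen (hat p) (hχ p _ (hat p)) (hχe p)
    rw [Finset.sum_add_distrib, Finset.sum_add_distrib, ← Finset.mul_sum, ← Finset.mul_sum,
      sum_setIntegral_bochnerDeriv_eq_zero hf hα hχ hχe hχ1] at h1
    simpa using h1
  have hvanish : ∀ (p : M) (u : (Fin m → ℂ) → ℂ), (∀ z ∈ (chartAt (Fin m → ℂ) p).target,
      ContDiffAt ℝ ∞ u z) → (∀ z ∈ (chartAt (Fin m → ℂ) p).target, 0 ≤ u z) →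
      ∫ z in (chartAt (Fin m → ℂ) p).target, (χ p ((chartAt (Fin m → ℂ) p).symm z) : ℂ) *
        (Complex.exp (localWeight (chartAt (Fin m → ℂ) p) g f z) * u z) = 0 →
      ∀ z ∈ (chartAt (Fin m → ℂ) p).target, χ p ((chartAt (Fin m → ℂ) p).symm z) ≠ 0 →
        u z = 0 := by
    intro p u hu hpos hint z hz hne
    have h1 := eq_zero_of_setIntegral_eq_zero (chartAt (Fin m → ℂ) p).open_target
      (isCompact_image_tsupport (hχe p)) (image_tsupport_subset (hχe p))
      (fun z hz => ((contDiffAt_ofReal_comp (hχ p _ (hat p) z hz)).mul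
        ((hf.contDiffAt_localWeight (hat p) hz).cexp.mul
          (hu z hz))).continuousAt.continuousWithinAt)
      (fun z hz hK => by
        rw [eq_zero_of_notMem_image_tsupport hz hK, Complex.ofReal_zero, zero_mul])
      (fun z hz => mul_nonneg (hχC _ _) (mul_nonneg (hexp _ _) (hpos z hz))) hint hz
    simpa [hne] using h1
  have hexists : ∀ x : M, ∃ p ∈ S, χ p x ≠ 0 := by
    intro x
    refine Finset.exists_ne_zero_of_sum_ne_zero ?_
    rw [hχ1 x]
    exact one_ne_zero
  have hNS : ∀ p ∈ S, 0 ≤ ∫ z in (chartAt (Fin m → ℂ) p).target, N p z := fun p _ =>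
    setIntegral_nonneg_complex (chartAt (Fin m → ℂ) p).open_target.measurableSet (hNpos p)
  have hES : ∀ p ∈ S, 0 ≤ ∫ z in (chartAt (Fin m → ℂ) p).target, E p z := fun p _ =>
    setIntegral_nonneg_complex (chartAt (Fin m → ℂ) p).open_target.measurableSet (hEpos p)
  -- If N were zero, |∂̄η|² would vanish wherever some cut-off is nonzero, hence everywhere.
  have hNne : ∑ p ∈ S, ∫ z in (chartAt (Fin m → ℂ) p).target, N p z ≠ 0 := by
    intro h0
    refine hne ?_
    have h1 := (Finset.sum_eq_zero_iff_of_nonneg hNS).1 h0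
    funext x
    obtain ⟨p, hp, hpx⟩ := hexists x
    have hxp : x ∈ (chartAt (Fin m → ℂ) p).source := hχe p (subset_tsupport _ hpx)
    have h2 := hvanish p _ (fun z hz => contDiffAt_chartNormSq hα (hat p) hz)
      (fun z hz => chartNormSq_nonneg (hat p) hz _) (h1 p hp) _
      ((chartAt (Fin m → ℂ) p).map_source hxp)
      (by rwa [(chartAt (Fin m → ℂ) p).left_inv hxp])
    have h3 := chartComponents_eq_zero_of_chartNormSq (hat p)
      ((chartAt (Fin m → ℂ) p).map_source hxp) h2
    exact eq_zero_of_chartComponents hα.isConjLinear (hat p) hxp h3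
  have hNsum := Finset.sum_nonneg hNS
  have hEsum := Finset.sum_nonneg hES
  set NN := ∑ p ∈ S, ∫ z in (chartAt (Fin m → ℂ) p).target, N p z
  set EE := ∑ p ∈ S, ∫ z in (chartAt (Fin m → ℂ) p).target, E p z with hEE
  have hNpos' : 0 < NN := lt_of_le_of_ne hNsum hNne.symm
  -- Both sums are nonnegative in the order of ℂ, so this one formula gives reality of the
  -- eigenvalue and the lower bound.
  have hlam : lam = q + 1 + EE / NN := by
    field_simp
    linear_combination -hmain
  have hquot : 0 ≤ EE / NN := div_nonneg hEsum hNpos'.le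
  obtain ⟨hre, him⟩ := Complex.le_def.1 hquot
  refine ⟨?_, ?_, fun hl => ?_⟩
  · rw [hlam]
    simpa using him.symm
  · rw [hlam]
    simpa using hre
  · have hE0 : EE = 0 := by
      rw [hl] at hmain
      simpa using hmain
    have h1 := (Finset.sum_eq_zero_iff_of_nonneg hES).1 hE0
    intro e he z hz
    obtain ⟨p, hp, hpx⟩ := hexists (e.symm z)
    have hxp : e.symm z ∈ (chartAt (Fin m → ℂ) p).source := hχe p (subset_tsupport _ hpx)
    have hxt := (chartAt (Fin m → ℂ) p).map_source hxp
    refine wirtingerBar_chartRaised_eq_zero_of_overlap hα he (hat p) ⟨hz, hxp⟩ ?_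
    exact wirtingerBar_eq_zero_of_chartDbarNormSq (hat p) hxt
      (hvanish p _ (fun z hz => contDiffAt_chartDbarNormSq hα (hat p) hz)
        (fun z hz => chartDbarNormSq_nonneg (hat p) hz _) (h1 p hp) _ hxt
        (by rwa [(chartAt (Fin m → ℂ) p).left_inv hxp]))

end Eigenvalue

/-! ### Holomorphic multivector fields -/

section Multivector

variable {m p : ℕ}

/-- Multi-indices with a repetition give zero. Every other one is uniquely an increasing multi-index
followed by a permutation, and the signs of coefficient and wedge cancel, so each increasing index
is counted p! times. -/
theorem sum_smul_ιMulti {V : Type*} [AddCommGroup V] [Module ℂ V] (v : Fin m → V)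
    {σ : (Fin p → Fin m) → ℂ} (hσ : IsAntisymm σ) :
    ∑ I, σ I • exteriorPower.ιMulti ℂ p (fun k => v (I k)) =
      (p.factorial : ℂ) • ∑ s : Set.powersetCard (Fin m) p,
        σ (Set.powersetCard.ofFinEmbEquiv.symm s) • exteriorPower.ιMulti_family ℂ p v s := by
  set ord : Set.powersetCard (Fin m) p → Fin p → Fin m := fun s =>
    Set.powersetCard.ofFinEmbEquiv.symm s with hord
  have hinj : ∀ s, Function.Injective (ord s) := fun s =>
    (Set.powersetCard.ofFinEmbEquiv.symm s).injective
  have hmem : ∀ s i, i ∈ Set.range (ord s) ↔ i ∈ s :=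
    Set.powersetCard.mem_range_ofFinEmbEquiv_symm_iff_mem
  have hterm : ∀ (s : Set.powersetCard (Fin m) p) (π : Equiv.Perm (Fin p)),
      σ (ord s) • exteriorPower.ιMulti_family ℂ p v s =
        σ (ord s ∘ π) • exteriorPower.ιMulti ℂ p (fun k => v ((ord s ∘ π) k)) := by
    intro s π
    have h1 : exteriorPower.ιMulti ℂ p (fun k => v ((ord s ∘ π) k)) =
        Equiv.Perm.sign π • exteriorPower.ιMulti_family ℂ p v s :=
      (exteriorPower.ιMulti ℂ p).map_perm (fun k => v (ord s k)) π
    rw [h1, hσ π (ord s)]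
    rcases Int.units_eq_one_or (Equiv.Perm.sign π) with h | h <;> simp [h]
  have hsum : ∑ sπ : Set.powersetCard (Fin m) p × Equiv.Perm (Fin p),
      σ (ord sπ.1) • exteriorPower.ιMulti_family ℂ p v sπ.1 =
        ∑ I, σ I • exteriorPower.ιMulti ℂ p (fun k => v (I k)) := by
    refine Finset.sum_of_injOn (fun sπ => ord sπ.1 ∘ sπ.2) ?_ (fun _ _ => Finset.mem_coe.2
      (Finset.mem_univ _)) ?_ fun sπ _ => hterm sπ.1 sπ.2
    · rintro ⟨s, π⟩ - ⟨s', π'⟩ - h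
      have h1 : ord s ∘ π = ord s' ∘ π' := h
      have h2 : s = s' := by
        -- The index set is recovered as the range of the multi-index, and then the permutation by
        -- injectivity of the increasing enumeration.
        refine SetLike.ext fun i => ?_
        rw [← hmem, ← hmem, ← π.surjective.range_comp, h1, π'.surjective.range_comp]
      subst h2
      have h3 : π = π' := Equiv.ext fun k => hinj s (congrFun h1 k)
      rw [h3]
    · intro I _ hI
      by_cases hIinj : Function.Injective I
      · exfalso
        refine hI ?_
        have hcard : (Finset.image I Finset.univ).card = p := by
          rw [Finset.card_image_of_injective _ hIinj, Finset.card_fin]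
        set s : Set.powersetCard (Fin m) p := ⟨Finset.image I Finset.univ, hcard⟩ with hs
        have hrange : ∀ k, ∃ l, ord s l = I k := fun k =>
          (hmem s (I k)).2 (Finset.mem_image_of_mem I (Finset.mem_univ k))
        choose π hπ using hrange
        have hπinj : Function.Injective π := fun a b hab => hIinj (by rw [← hπ a, ← hπ b, hab])
        refine ⟨(s, Equiv.ofBijective π (Finite.injective_iff_bijective.1 hπinj)),
          Finset.mem_coe.2 (Finset.mem_univ _), ?_⟩
        funext k
        exact hπ k
      · rw [(exteriorPower.ιMulti ℂ p).map_eq_zero_of_not_injective (fun k => v (I k)) fun h =>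
          hIinj (Function.Injective.of_comp (f := v) h), smul_zero]
  rw [← hsum, Fintype.sum_prod_type, Finset.smul_sum]
  refine Finset.sum_congr rfl fun s _ => ?_
  simp only [Finset.sum_const, Finset.card_univ, Fintype.card_perm, Fintype.card_fin,
    Nat.cast_smul_eq_nsmul]
  rfl

variable {M : Type*} [TopologicalSpace M] [ChartedSpace (Fin m → ℂ) M]
  [IsManifold 𝓘(ℂ, Fin m → ℂ) ω M]
  {e e' : OpenPartialHomeomorph M (Fin m → ℂ)} {g : HermitianMetric m M} {x : M}

theorem sum_raised_smul_ιMulti {α : FormField m M p} (hα : IsConjLinear (α x))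
    (he : e ∈ atlas (Fin m → ℂ) M) (he' : e' ∈ atlas (Fin m → ℂ) M)
    (hx : x ∈ e.source) (hx' : x ∈ e'.source) :
    ∑ I, raised g e α x I • exteriorPower.ιMulti ℂ p (fun k => frame e x (I k)) =
      ∑ I, raised g e' α x I • exteriorPower.ιMulti ℂ p (fun k => frame e' x (I k)) := by
  have h1 : ∀ J : Fin p → Fin m, exteriorPower.ιMulti ℂ p (fun k => frame e x (J k)) =
      ∑ I : Fin p → Fin m, tensorPow (jacobian e e' (e x)) I J •
        exteriorPower.ιMulti ℂ p (fun k => frame e' x (I k)) := by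
    intro J
    simp only [frame_eq_sum he he' hx hx']
    have h2 := (exteriorPower.ιMulti ℂ p (M := TangentSpace 𝓘(ℂ, Fin m → ℂ) x)).toMultilinearMap.map_sum
      fun k i => jacobian e e' (e x) i (J k) • frame e' x i
    refine h2.trans (Finset.sum_congr rfl fun I _ => ?_)
    rw [MultilinearMap.map_smul_univ]
    rfl
  simp only [h1, raised_eq_mulVec g hα he he' hx hx', Matrix.mulVec, dotProduct, Finset.smul_sum,
    Finset.sum_smul, smul_smul]
  rw [Finset.sum_comm]
  exact Finset.sum_congr rfl fun _ _ => Finset.sum_congr rfl fun _ _ => by rw [mul_comm]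

/-- By chart independence the preferred chart is replaced by `e`; the factor p! from collecting
increasing indices cancels the normalization of `sharp`. -/
theorem sharp_eq_sum {α : FormField m M p} (hα : IsConjLinear (α x))
    (he : e ∈ atlas (Fin m → ℂ) M) (hx : x ∈ e.source) :
    sharp g α x = ∑ s : Set.powersetCard (Fin m) p,
      raised g e α x (Set.powersetCard.ofFinEmbEquiv.symm s) •
        exteriorPower.ιMulti_family ℂ p (frame e x) s := by
  have h1 : sharp g α x = (1 / (p.factorial : ℂ)) • ∑ I : Fin p → Fin m,
      raised g (chartAt (Fin m → ℂ) x) α x I •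
        exteriorPower.ιMulti ℂ p (fun k => frame (chartAt (Fin m → ℂ) x) x (I k)) := by
    rw [sharp]
    congr 1
    refine Finset.sum_congr rfl fun I _ => ?_
    rw [← Finset.sum_smul]
    rfl
  have hp : (p.factorial : ℂ) ≠ 0 := Nat.cast_ne_zero.2 p.factorial_ne_zero
  rw [h1, ← sum_raised_smul_ιMulti hα he (chart_mem_atlas _ x) hx (mem_chart_source _ x),
    sum_smul_ιMulti _ (isAntisymm_raised g e α x), smul_smul, one_div, inv_mul_cancel₀ hp, one_smul]

theorem isHolomorphicSection_sharp {α : FormField m M p} (hα : IsSmoothZeroQ α)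
    (h : ∀ e ∈ atlas (Fin m → ℂ) M, ∀ z ∈ e.target, ∀ j K,
      wirtingerBar j (fun w => chartRaised e g α w K) z = 0) :
    IsHolomorphicSection (sharp g α) := fun e he =>
  ⟨fun s z => chartRaised e g α z (Set.powersetCard.ofFinEmbEquiv.symm s),
    fun _ z hz => (differentiableAt_of_wirtingerBar_eq_zero
      (hα.contDiffAt_chartRaised g he hz _).differentiableAt_top
      fun j => h e he z hz j _).differentiableWithinAt,
    fun _ hz => sharp_eq_sum (hα.isConjLinear _) he (e.map_target hz)⟩

end Multivector

end FanoHodge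

end

theorem theorem1p2 (m q : ℕ) (M : Type*) [TopologicalSpace M] [CompactSpace M] [T2Space M]
    [ChartedSpace (Fin m → ℂ) M] [IsManifold 𝓘(ℂ, Fin m → ℂ) ω M]
    (g : FanoHodge.HermitianMetric m M) (hg : FanoHodge.IsKahler g)
    (f : M → ℝ) (hf : FanoHodge.IsRicciPotential g f)
    (η : FanoHodge.FormField m M q) (hη : FanoHodge.IsSmoothZeroQ η)
    (lam : ℂ) (hlam : FanoHodge.IsWeightedLaplacian g f η (lam • η))
    (hne : FanoHodge.dbar η ≠ 0) :
    lam.im = 0 ∧ (q + 1 : ℝ) ≤ lam.re ∧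
      (lam = q + 1 →
        FanoHodge.IsHolomorphicSection (FanoHodge.sharp g (FanoHodge.dbar η))) := by
  obtain ⟨h1, h2, h3⟩ := hlam.eigenvalue_bound hg hf hη hne
  exact ⟨h1, h2, fun hl => FanoHodge.isHolomorphicSection_sharp hη.dbar (h3 hl)⟩
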